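/- Let $m$ be a positive integer, let $H, H_1,\dots,H_m$ be finite-dimensional Euclidean spaces equipped with Lebesgue measure, and let $\mathbf{p}=(p_1,\dots,p_m)$ with $0\le p_j\le 1$. For an $m$-tuple $\mathbf{L}=(L_j)_{j=1}^m$ of linear maps $L_j:H\to H_j$, let $\mathrm{BL}_{\mathrm{loc}}(\mathbf{L},\mathbf{p})\in[0,\infty]$ denote the smallest constant $C$ for which $$ \int_{\|x\|_H\le 1}\ \prod_{j=1}^m \big(f_j(L_jx)\big)^{p_j}\,dx\ \le\ C\prod_{j=1}^m\bigg(\int_{H_j}f_j\bigg)^{p_j} $$ holds for all nonnegative integrable functions $f_j:H_j\to\mathbb{R}$, $1\le j\le m$ (and $\mathrm{BL}_{\mathrm{loc}}(\mathbf{L},\mathbf{p})=\infty$ if there is no such finite $C$). Here $0^0=1$. Write $\|\mathbf{L}\|=\max_j\|L_j\|$, with $\|L_j\|$ the operator norm. **Theorem.** Suppose that $\mathbf{L}^0=(L^0_j)_{j=1}^m$ is an $m$-tuple of surjective linear maps $L^0_j:H\to H_j$ such that $\mathrm{BL}_{\mathrm{loc}}(\mathbf{L}^0,\mathbf{p})<\infty$.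 Then there exist $\delta>0$ and a constant $C<\infty$ such that $$ \mathrm{BL}_{\mathrm{loc}}(\mathbf{L},\mathbf{p})\le C $$ for every $m$-tuple $\mathbf{L}$ of linear maps $L_j:H\to H_j$ with $\|\mathbf{L}-\mathbf{L}^0\|<\delta$. -/

import Mathlib

open MeasureTheory Set
open scoped ENNReal NNReal

noncomputable section

/-- `(L, p)` is a Brascamp--Lieb datum: finitely many surjective linear maps `L j : H → H' j`
between finite-dimensional euclidean spaces, together with exponents `0 ≤ p j ≤ 1`. -/
structure IsBrascampLiebDatum {m : ℕ} {H : Type*} {H' : Fin m → Type*}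
    [NormedAddCommGroup H] [InnerProductSpace ℝ H]
    [∀ j, NormedAddCommGroup (H' j)] [∀ j, InnerProductSpace ℝ (H' j)]
    (L : ∀ j, H →L[ℝ] H' j) (p : Fin m → ℝ) : Prop where
  surjective : ∀ j, Function.Surjective (L j)
  exponent_nonneg : ∀ j, 0 ≤ p j
  exponent_le_one : ∀ j, p j ≤ 1

/-- `C` is admissible in the localised Brascamp--Lieb inequality
`∫_{‖x‖ ≤ 1} ∏ j, f j (L j x) ^ p j dx ≤ C * ∏ j, (∫ f j) ^ p j`
for all nonnegative integrable inputs `f j`. The left-hand side is a `[0, ∞]`-valued integral, so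
that a divergent integral counts as `∞`. -/
def LocalBrascampLiebInequality {m : ℕ} {H : Type*} {H' : Fin m → Type*}
    [NormedAddCommGroup H] [InnerProductSpace ℝ H] [FiniteDimensional ℝ H]
    [MeasurableSpace H] [BorelSpace H]
    [∀ j, NormedAddCommGroup (H' j)] [∀ j, InnerProductSpace ℝ (H' j)]
    [∀ j, FiniteDimensional ℝ (H' j)]
    [∀ j, MeasurableSpace (H' j)] [∀ j, BorelSpace (H' j)]
    (L : ∀ j, H →L[ℝ] H' j) (p : Fin m → ℝ) (C : ℝ≥0∞) : Prop :=
  ∀ f : ∀ j, H' j → ℝ, (∀ j y, 0 ≤ f j y) → (∀ j, Integrable (f j) volume) →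
    ∫⁻ x in Metric.closedBall (0 : H) 1, ENNReal.ofReal (∏ j, f j (L j x) ^ p j)
      ≤ C * ENNReal.ofReal (∏ j, (∫ y, f j y) ^ p j)

/-- The localised Brascamp--Lieb constant: the best constant in the localised inequality, equal to
`∞` if the inequality holds with no finite constant. -/
def localBrascampLiebConst {m : ℕ} {H : Type*} {H' : Fin m → Type*}
    [NormedAddCommGroup H] [InnerProductSpace ℝ H] [FiniteDimensional ℝ H]
    [MeasurableSpace H] [BorelSpace H]
    [∀ j, NormedAddCommGroup (H' j)] [∀ j, InnerProductSpace ℝ (H' j)]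
    [∀ j, FiniteDimensional ℝ (H' j)]
    [∀ j, MeasurableSpace (H' j)] [∀ j, BorelSpace (H' j)]
    (L : ∀ j, H →L[ℝ] H' j) (p : Fin m → ℝ) : ℝ≥0∞ :=
  sInf {C : ℝ≥0∞ | LocalBrascampLiebInequality L p C}

end

namespace BrascampLieb
open ProbabilityTheory Filter Topology
open scoped RealInnerProductSpace

/-! ### Gaussian Hölder inequality -/

/-! A finite constant at L⁰ forces a rank condition there. The rank condition gives a bound on
Gaussians that is uniform near L⁰, and the Gaussian bound controls all inputs.

Necessity: testing the inequality on boxes that are thin in chosen directions shows that, for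
orthonormal families e in the targets, every set S of the vectors `L₀ j`* e has total exponent at
most the dimension of its span (`rankCondition_of_localBrascampLiebConst_lt_top`).

Uniformity: a greedy choice of independent vectors turns the rank condition into det(1 + ∑ t v⊗v) ≥
c ∏ t^p for all t > 0. Here c lies below finitely many positive Gram determinants. These are
continuous in the maps and the families, and orthonormal families form a compact set, so one c
serves a neighbourhood of L⁰ (`RankCondition.exists_uniform_det_bound`). Taking e and 1/t from the
spectral decomposition of (L S)(L S)* gives the bound for Gaussians
(`RankCondition.exists_uniform_gaussian_bound`).

From Gaussians to functions: with exponents (1 - η)p the Gaussian functional det(S)² ∏ det((L S)(L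
S)*)^(-q) exp(-‖S‖²_HS) attains its maximum (`exists_isMax_gaussFunctional`). The critical point
equation (`critical_of_isMax`) does two things. It supplies the covariance hypothesis of a Gaussian
Hölder inequality E ∏ w^q ≤ ∏ (E w)^q (`integral_prod_rpow_le_of_isTame`). It also makes the
Gaussian weights cancel when that inequality is applied to the inputs multiplied by inverse Gaussian
densities (`lintegral_closedBall_prod_le`). The resulting constant is controlled by the maximum of
the functional and does not depend on η, so η → 0 together with approximation of the inputs gives
the theorem.

The Gaussian Hölder inequality is proved by running the heat flow in N steps of length h = N^(-1/2).
A step costs a factor 1 + O(h³), so the total loss tends to 1. -/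

lemma exists_abs_exp_sub_one_sub_le (T : ℝ) :
    ∃ K : ℝ, 0 ≤ K ∧ ∀ x : ℝ, |x| ≤ T → |Real.exp x - 1 - x| ≤ K * x ^ 2 := by
  refine ⟨1 + (Real.exp T + 1 + |T|), by positivity, fun x hx => ?_⟩
  have hE : 0 < Real.exp T := Real.exp_pos T
  rcases le_total |x| 1 with h | h
  · have := Real.abs_exp_sub_one_sub_id_le h
    have h2 : 0 ≤ (Real.exp T + 1 + |T|) * x ^ 2 := by positivity
    linarith
  · have h1 : |Real.exp x - 1 - x| ≤ Real.exp T + 1 + |T| := by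
      have h3 : Real.exp x ≤ Real.exp T := Real.exp_le_exp.2 ((le_abs_self x).trans hx)
      have h4 := Real.exp_pos x
      have h5 := hx.trans (le_abs_self T)
      have h6 := abs_le.1 h5
      rw [abs_le]; constructor <;> linarith [h6.1, h6.2]
    have h7 : 1 ≤ x ^ 2 := by rw [← sq_abs]; nlinarith
    have h8 : 0 ≤ Real.exp T + 1 + |T| := by positivity
    nlinarith

lemma exists_abs_exp_sub_quadratic_le (T : ℝ) :
    ∃ K : ℝ, 0 ≤ K ∧ ∀ x : ℝ, |x| ≤ T →
      |Real.exp x - 1 - x - x ^ 2 / 2| ≤ K * |x| ^ 3 := by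
  refine ⟨1 + (Real.exp T + 1 + |T| + T ^ 2 / 2), by positivity, fun x hx => ?_⟩
  have hE : 0 < Real.exp T := Real.exp_pos T
  have h8 : 0 ≤ Real.exp T + 1 + |T| + T ^ 2 / 2 := by positivity
  rcases le_total |x| 1 with h | h
  · have := Real.exp_bound h (n := 3) (by norm_num)
    norm_num [Finset.sum_range_succ, Nat.factorial] at this
    have h2 : 0 ≤ (Real.exp T + 1 + |T| + T ^ 2 / 2) * |x| ^ 3 := by positivity
    have h3 : 0 ≤ |x| ^ 3 := by positivity
    have h4 : Real.exp x - 1 - x - x ^ 2 / 2 = Real.exp x - (1 + x + x ^ 2 / 2) := by ring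
    rw [h4]
    linarith
  · have h1 : |Real.exp x - 1 - x - x ^ 2 / 2| ≤ Real.exp T + 1 + |T| + T ^ 2 / 2 := by
      have h3 : Real.exp x ≤ Real.exp T := Real.exp_le_exp.2 ((le_abs_self x).trans hx)
      have h4 := Real.exp_pos x
      have h5 := hx.trans (le_abs_self T)
      have h6 := abs_le.1 h5
      have h9 : x ^ 2 ≤ T ^ 2 := sq_le_sq.2 h5
      rw [abs_le]; constructor <;> nlinarith [h6.1, h6.2]
    have h7 : 1 ≤ |x| ^ 3 := one_le_pow₀ h
    nlinarith

/-- Here `θ j` is the logarithm of a ratio of function values, `l j` its linearisation and `t` the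
length of the displacement. The first-order part is kept as exp θ - 1, the exact relative increment,
so that its Gaussian mean is known exactly. Linearisation is used only in the quadratic terms, where
it costs O(t³). -/
lemma exists_exp_sum_le {ι : Type*} [Fintype ι] {q : ι → ℝ} (hq : ∀ j, 0 ≤ q j) (T C : ℝ)
    (hC : 0 ≤ C) :
    ∃ K : ℝ, 0 ≤ K ∧ ∀ (θ l : ι → ℝ) (t : ℝ), 0 ≤ t → (∀ j, |θ j| ≤ T) → (∀ j, |θ j| ≤ C * t) →
      (∀ j, |l j| ≤ C * t) → (∀ j, |θ j - l j| ≤ C * t ^ 2) →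
      Real.exp (∑ j, q j * θ j) ≤ 1 + ∑ j, q j * (Real.exp (θ j) - 1)
        + ((∑ j, q j * l j) ^ 2 - ∑ j, q j * l j ^ 2) / 2 + K * t ^ 3 := by
  set Q := ∑ j, q j with hQ
  have hQ0 : 0 ≤ Q := Finset.sum_nonneg fun j _ => hq j
  obtain ⟨K₁, hK₁, h₁⟩ := exists_abs_exp_sub_quadratic_le (Q * T)
  obtain ⟨K₂, hK₂, h₂⟩ := exists_abs_exp_sub_quadratic_le T
  have hsum : ∀ (a : ι → ℝ) (b : ℝ), (∀ j, |a j| ≤ b) → |∑ j, q j * a j| ≤ Q * b := by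
    intro a b hab
    calc |∑ j, q j * a j| ≤ ∑ j, |q j * a j| := Finset.abs_sum_le_sum_abs _ _
      _ ≤ ∑ j, q j * b := Finset.sum_le_sum fun j _ => by
          rw [abs_mul, abs_of_nonneg (hq j)]; exact mul_le_mul_of_nonneg_left (hab j) (hq j)
      _ = Q * b := by rw [hQ, Finset.sum_mul]
  refine ⟨K₁ * (Q * C) ^ 3 + Q * (K₂ * C ^ 3) + (Q * C) ^ 2 + Q * C ^ 2, by positivity, ?_⟩
  intro θ l t ht hT hCt hl hθl
  set σ := ∑ j, q j * θ j with hσ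
  have hs1 : |σ| ≤ Q * T := hsum _ _ hT
  have hs2 : |σ| ≤ Q * (C * t) := hsum _ _ hCt
  have hs3 : |∑ j, q j * l j| ≤ Q * (C * t) := hsum _ _ hl
  have hs4 : |σ - ∑ j, q j * l j| ≤ Q * (C * t ^ 2) := by
    have := hsum _ _ hθl
    simpa [mul_sub, Finset.sum_sub_distrib] using this
  have e1 : Real.exp σ ≤ 1 + σ + σ ^ 2 / 2 + K₁ * (Q * C) ^ 3 * t ^ 3 := by
    have := (abs_le.1 (h₁ σ hs1)).2
    have h3 : |σ| ^ 3 ≤ (Q * (C * t)) ^ 3 := pow_le_pow_left₀ (abs_nonneg _) hs2 3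
    have h4 := mul_le_mul_of_nonneg_left h3 hK₁
    nlinarith
  have e2 : σ ≤ ∑ j, q j * (Real.exp (θ j) - 1) - (∑ j, q j * θ j ^ 2) / 2
      + Q * (K₂ * C ^ 3) * t ^ 3 := by
    have : ∀ j, q j * θ j ≤ q j * (Real.exp (θ j) - 1) - q j * θ j ^ 2 / 2
        + q j * (K₂ * C ^ 3 * t ^ 3) := by
      intro j
      have h3 := (abs_le.1 (h₂ (θ j) (hT j))).1
      have h4 : |θ j| ^ 3 ≤ (C * t) ^ 3 := pow_le_pow_left₀ (abs_nonneg _) (hCt j) 3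
      have h5 := mul_le_mul_of_nonneg_left h4 hK₂
      have h6 : θ j ≤ Real.exp (θ j) - 1 - θ j ^ 2 / 2 + K₂ * C ^ 3 * t ^ 3 := by nlinarith
      have := mul_le_mul_of_nonneg_left h6 (hq j)
      nlinarith
    have := Finset.sum_le_sum (s := Finset.univ) fun j _ => this j
    rw [Finset.sum_add_distrib, Finset.sum_sub_distrib, ← Finset.sum_mul, ← Finset.sum_div] at this
    rw [hσ]; linarith
  have hdiff : ∀ x y c d : ℝ, |x| ≤ c → |y| ≤ c → |x - y| ≤ d → |x ^ 2 - y ^ 2| ≤ 2 * c * d := by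
    intro x y c d hx hy hxy
    have : x ^ 2 - y ^ 2 = (x + y) * (x - y) := by ring
    rw [this, abs_mul]
    have h3 : |x + y| ≤ 2 * c := (abs_add_le x y).trans (by linarith)
    exact mul_le_mul h3 hxy (abs_nonneg _) (le_trans (abs_nonneg _) h3)
  have e3 : σ ^ 2 ≤ (∑ j, q j * l j) ^ 2 + 2 * (Q * C) ^ 2 * t ^ 3 := by
    have := (abs_le.1 (hdiff _ _ _ _ hs2 hs3 hs4)).2
    nlinarith
  have e4 : ∑ j, q j * l j ^ 2 ≤ ∑ j, q j * θ j ^ 2 + 2 * Q * C ^ 2 * t ^ 3 := by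
    have := (abs_le.1 (hsum (fun j => θ j ^ 2 - l j ^ 2) _
      fun j => hdiff _ _ _ _ (hCt j) (hl j) (hθl j))).1
    simp only [mul_sub, Finset.sum_sub_distrib] at this
    nlinarith
  nlinarith

end BrascampLieb

/-! ### Functions with controlled gradients and their Gaussian averages. -/

namespace BrascampLieb
open ProbabilityTheory Filter Topology
open scoped RealInnerProductSpace

set_option linter.unusedSectionVars false

variable {E : Type*} [NormedAddCommGroup E] [InnerProductSpace ℝ E] [FiniteDimensional ℝ E]
  [MeasurableSpace E] [BorelSpace E]

/-- A continuous function `w` with values in `[a, b]` which has a bounded continuous gradient field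
with values in `V` and quadratically small first order Taylor remainder. -/
structure IsTame (V : Submodule ℝ E) (a b B K : ℝ) (w : E → ℝ) : Prop where
  continuous : Continuous w
  le_apply : ∀ x, a ≤ w x
  apply_le : ∀ x, w x ≤ b
  exists_gradient : ∃ g : E → V, Continuous g ∧ (∀ x, ‖g x‖ ≤ B) ∧
    ∀ x y, |w (x + y) - w x - ⟪(g x : E), y⟫| ≤ K * ‖y‖ ^ 2

/-- The average of `w` over a centred Gaussian of variance `h ^ 2` around a point. -/
noncomputable def gaussAvg (h : ℝ) (w : E → ℝ) (x : E) : ℝ := ∫ z, w (x + h • z) ∂(stdGaussian E)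

lemma integrable_of_continuous_of_bounded {w : E → ℝ} {μ : Measure E} [IsFiniteMeasure μ]
    (hw : Continuous w) {c : ℝ} (hc : ∀ x, |w x| ≤ c) : Integrable w μ :=
  Integrable.of_bound hw.aestronglyMeasurable c (Eventually.of_forall hc)

lemma integrable_norm_pow_stdGaussian (k : ℕ) :
    Integrable (fun z : E => ‖z‖ ^ k) (stdGaussian E) := by
  have := (IsGaussian.memLp_id (stdGaussian E) k (by simp)).integrable_norm_pow'
  simpa using this

namespace IsTame

variable {V : Submodule ℝ E} {a b B K : ℝ} {w : E → ℝ}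

lemma abs_le (hw : IsTame V a b B K w) (x : E) : |w x| ≤ |a| + |b| := by
  have h1 := hw.le_apply x
  have h2 := hw.apply_le x
  rw [_root_.abs_le]
  constructor <;> linarith [neg_abs_le a, le_abs_self b, abs_nonneg a, abs_nonneg b]

lemma integrable_shift (hw : IsTame V a b B K w) (h : ℝ) (x : E) :
    Integrable (fun z => w (x + h • z)) (stdGaussian E) :=
  integrable_of_continuous_of_bounded (hw.continuous.comp (by fun_prop)) fun z => hw.abs_le _

/-- All the conditions are convex and translation invariant, and the averaged gradient stays in the
subspace `V`. Since no constant deteriorates, one error bound serves every step of the iteration. -/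
lemma gaussAvg (hw : IsTame V a b B K w) (h : ℝ) :
    IsTame V a b B K (gaussAvg h w) := by
  obtain ⟨g, hg, hgB, hgK⟩ := hw.exists_gradient
  have hint : ∀ x, Integrable (fun z => g (x + h • z)) (stdGaussian E) := fun x =>
    Integrable.of_bound (hg.comp (by fun_prop)).aestronglyMeasurable B
      (Eventually.of_forall fun z => hgB _)
  refine ⟨?_, fun x => ?_, fun x => ?_, fun x => ∫ z, g (x + h • z) ∂(stdGaussian E), ?_, ?_, ?_⟩
  · refine continuous_of_dominated (bound := fun _ => |a| + |b|) (fun x => ?_) (fun x => ?_)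
      (integrable_const _) ?_
    · exact (hw.integrable_shift h x).aestronglyMeasurable
    · exact Eventually.of_forall fun z => hw.abs_le _
    · exact Eventually.of_forall fun z => hw.continuous.comp (by fun_prop)
  · have := integral_mono (integrable_const a) (hw.integrable_shift h x)
      fun z => hw.le_apply (x + h • z)
    simpa [BrascampLieb.gaussAvg] using this
  · have := integral_mono (hw.integrable_shift h x) (integrable_const b)
      fun z => hw.apply_le (x + h • z)
    simpa [BrascampLieb.gaussAvg] using this
  · refine continuous_of_dominated (bound := fun _ => B) (fun x => ?_) (fun x => ?_)
      (integrable_const _) ?_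
    · exact (hint x).aestronglyMeasurable
    · exact Eventually.of_forall fun z => hgB _
    · exact Eventually.of_forall fun z => hg.comp (by fun_prop)
  · intro x
    have := norm_integral_le_of_norm_le_const (μ := stdGaussian E) (f := fun z => g (x + h • z))
      (C := B) (Eventually.of_forall fun z => hgB _)
    simpa using this
  · intro x y
    have hi : ⟪((∫ z, g (x + h • z) ∂(stdGaussian E) : V) : E), y⟫
        = ∫ z, ⟪(g (x + h • z) : E), y⟫ ∂(stdGaussian E) := by
      have := ((innerSL ℝ y).comp V.subtypeL).integral_comp_comm (hint x)
      simp only [ContinuousLinearMap.comp_apply, Submodule.subtypeL_apply, innerSL_apply_apply]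
        at this
      rw [real_inner_comm, ← this]
      simp_rw [real_inner_comm]
    have hii : Integrable (fun z => ⟪(g (x + h • z) : E), y⟫) (stdGaussian E) := by
      have := ((innerSL ℝ y).comp V.subtypeL).integrable_comp (hint x)
      simp only [ContinuousLinearMap.comp_apply, Submodule.subtypeL_apply, innerSL_apply_apply]
        at this
      simpa only [real_inner_comm] using this
    unfold BrascampLieb.gaussAvg
    rw [hi, ← integral_sub (hw.integrable_shift h _) (hw.integrable_shift h _), ← integral_sub (f := fun z => w (x + y + h • z) - w (x + h • z))
      ((hw.integrable_shift h _).sub (hw.integrable_shift h _)) hii]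
    have := norm_integral_le_of_norm_le_const (μ := stdGaussian E)
      (f := fun z => w (x + y + h • z) - w (x + h • z) - ⟪(g (x + h • z) : E), y⟫)
      (C := K * ‖y‖ ^ 2) (Eventually.of_forall fun z => by
        have := hgK (x + h • z) y
        rwa [show x + h • z + y = x + y + h • z by abel] at this)
    simpa using this

end IsTame

lemma integral_inner_sq_stdGaussian (v : E) :
    ∫ z, ⟪v, z⟫ ^ 2 ∂(stdGaussian E) = ‖v‖ ^ 2 := by
  have h := variance_dual_stdGaussian (innerSL ℝ v)
  rw [variance_eq_integral (by fun_prop)] at h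
  rw [integral_strongDual_stdGaussian] at h
  simpa using h

lemma integrable_inner_sq_stdGaussian (v : E) :
    Integrable (fun z => ⟪v, z⟫ ^ 2) (stdGaussian E) := by
  refine ((integrable_norm_pow_stdGaussian (E := E) 2).const_mul (‖v‖ ^ 2)).mono'
    (by fun_prop) (Eventually.of_forall fun z => ?_)
  rw [Real.norm_eq_abs, abs_pow, ← mul_pow]
  exact pow_le_pow_left₀ (abs_nonneg _) (abs_real_inner_le_norm v z) 2

lemma stdGaussian_map_smul_conv (s t r : ℝ) (hr : r ^ 2 = s ^ 2 + t ^ 2) :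
    (stdGaussian E).map (s • ·) ∗ (stdGaussian E).map (t • ·) = (stdGaussian E).map (r • ·) := by
  have := Measure.isProbabilityMeasure_map (μ := stdGaussian E)
    (f := fun z : E => s • z) (by fun_prop)
  have := Measure.isProbabilityMeasure_map (μ := stdGaussian E)
    (f := fun z : E => t • z) (by fun_prop)
  have := Measure.isProbabilityMeasure_map (μ := stdGaussian E)
    (f := fun z : E => r • z) (by fun_prop)
  apply Measure.ext_of_charFun
  ext u
  rw [charFun_conv, charFun_map_smul, charFun_map_smul, charFun_map_smul, charFun_stdGaussian,
    charFun_stdGaussian, charFun_stdGaussian, ← Complex.exp_add]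
  congr 1
  simp only [norm_smul, Real.norm_eq_abs, mul_pow, ← Complex.ofReal_pow, Complex.ofReal_mul, sq_abs]
  rw [hr]
  push_cast
  ring

lemma gaussAvg_eq_integral_map {w : E → ℝ} (hw : Continuous w) (h : ℝ) (x : E) :
    gaussAvg h w x = ∫ z, w (x + z) ∂((stdGaussian E).map (h • ·)) := by
  rw [integral_map (by fun_prop) (by fun_prop)]
  rfl

/-- Composition of Gaussian averages. -/
lemma gaussAvg_gaussAvg {w : E → ℝ} (hw : Continuous w) {c : ℝ} (hc : ∀ x, |w x| ≤ c)
    (s t r : ℝ) (hr : r ^ 2 = s ^ 2 + t ^ 2) :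
    gaussAvg s (gaussAvg t w) = gaussAvg r w := by
  ext x
  have := Measure.isProbabilityMeasure_map (μ := stdGaussian E)
    (f := fun z : E => s • z) (by fun_prop)
  have := Measure.isProbabilityMeasure_map (μ := stdGaussian E)
    (f := fun z : E => t • z) (by fun_prop)
  have hc' : Continuous (gaussAvg t w) := by
    refine continuous_of_dominated (bound := fun _ => c) (fun x => ?_) (fun x => ?_)
      (integrable_const _) ?_
    · exact (hw.comp (by fun_prop)).aestronglyMeasurable
    · exact Eventually.of_forall fun z => hc _
    · exact Eventually.of_forall fun z => hw.comp (by fun_prop)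
  rw [gaussAvg_eq_integral_map hc', gaussAvg_eq_integral_map hw r,
    ← stdGaussian_map_smul_conv s t r hr, integral_conv]
  · simp_rw [gaussAvg_eq_integral_map hw t, add_assoc]
  · exact integrable_of_continuous_of_bounded (hw.comp (by fun_prop)) fun z => hc _

end BrascampLieb

/-! ### The Gaussian Hölder inequality for one short time step. -/

namespace BrascampLieb
open ProbabilityTheory Filter Topology
open scoped RealInnerProductSpace
set_option linter.unusedSectionVars false

variable {E : Type*} [NormedAddCommGroup E] [InnerProductSpace ℝ E] [FiniteDimensional ℝ E]
  [MeasurableSpace E] [BorelSpace E]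

lemma abs_log_le_log {r R : ℝ} (hr : R⁻¹ ≤ r) (hrR : r ≤ R) (hR : 1 ≤ R) :
    |Real.log r| ≤ Real.log R := by
  have hR0 : 0 < R := by linarith
  have hr0 : 0 < r := lt_of_lt_of_le (by positivity) hr
  rw [abs_le]
  refine ⟨?_, Real.log_le_log hr0 hrR⟩
  rw [← Real.log_inv]
  exact Real.log_le_log (by positivity) hr

lemma abs_log_le_mul {r R : ℝ} (hr : R⁻¹ ≤ r) (hR : 1 ≤ R) : |Real.log r| ≤ R * |r - 1| := by
  have hR0 : 0 < R := by linarith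
  have hr0 : 0 < r := lt_of_lt_of_le (by positivity) hr
  have h1 := Real.log_le_sub_one_of_pos hr0
  have h2 := Real.one_sub_inv_le_log_of_pos hr0
  have h3 : r⁻¹ ≤ R := by rw [inv_le_comm₀ hr0 hR0]; exact hr
  have h4 : r - 1 ≤ R * |r - 1| :=
    (le_abs_self _).trans (le_mul_of_one_le_left (abs_nonneg _) hR)
  have h5 : -(R * |r - 1|) ≤ 1 - r⁻¹ := by
    have : 1 - r⁻¹ = r⁻¹ * (r - 1) := by field_simp
    rw [this]
    have h6 : |r⁻¹ * (r - 1)| ≤ R * |r - 1| := by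
      rw [abs_mul, abs_of_pos (by positivity : 0 < r⁻¹)]
      exact mul_le_mul_of_nonneg_right h3 (abs_nonneg _)
    exact (abs_le.1 h6).1
  rw [abs_le]; constructor <;> linarith

namespace IsTame

variable {V : Submodule ℝ E} {a b B K : ℝ} {w : E → ℝ}

/-- First order expansion of `log w` for tame `w`. -/
lemma exists_log_expansion (ha : 0 < a) (hab : a ≤ b) (hB : 0 ≤ B) (hK : 0 ≤ K) :
    ∃ C : ℝ, 0 ≤ C ∧ ∀ (V : Submodule ℝ E) (w : E → ℝ), IsTame V a b B K w → ∀ x, ∃ l : V,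
      ∀ y, |w (x + y) / w x - 1 - ⟪(l : E), y⟫| ≤ C * ‖y‖ ^ 2 ∧
        |⟪(l : E), y⟫| ≤ C * ‖y‖ ∧ |Real.log (w (x + y) / w x)| ≤ C * ‖y‖ ∧
        |Real.log (w (x + y) / w x) - ⟪(l : E), y⟫| ≤ C * ‖y‖ ^ 2 := by
  have hb : 0 < b := ha.trans_le hab
  set R := b / a with hR
  have hR1 : 1 ≤ R := by rw [hR, le_div_iff₀ ha]; linarith
  have hRinv : R⁻¹ = a / b := by rw [hR, inv_div]
  obtain ⟨K₂, hK₂, h₂⟩ := exists_abs_exp_sub_one_sub_le (Real.log R)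
  set C₁ := R * ((B + K + b) / a)
  have hC₁ : 0 ≤ C₁ := by positivity
  refine ⟨C₁ + B / a + K₂ * C₁ ^ 2 + K / a, by positivity, fun V w hw x => ?_⟩
  obtain ⟨g, -, hgB, hgK⟩ := hw.exists_gradient
  have hpos : ∀ x, 0 < w x := fun x => ha.trans_le (hw.le_apply x)
  refine ⟨(w x)⁻¹ • g x, fun y => ?_⟩
  set r := w (x + y) / w x with hr
  have hr1 : R⁻¹ ≤ r := by
    rw [hRinv, hr]; exact div_le_div₀ (hpos _).le (hw.le_apply _) (hpos _) (hw.apply_le _)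
  have hr2 : r ≤ R := by
    rw [hR, hr]; exact div_le_div₀ hb.le (hw.apply_le _) ha (hw.le_apply _)
  have hr0 : 0 < r := div_pos (hpos _) (hpos _)
  have hinv : (w x)⁻¹ ≤ a⁻¹ := inv_anti₀ ha (hw.le_apply x)
  have hinv0 : 0 ≤ (w x)⁻¹ := (inv_pos.2 (hpos x)).le
  have hrdiff : r - 1 = (w x)⁻¹ * (w (x + y) - w x) := by
    rw [hr]; field_simp [(hpos x).ne']
  have hin : ⟪(((w x)⁻¹ • g x : V) : E), y⟫ = (w x)⁻¹ * ⟪(g x : E), y⟫ := by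
    rw [Submodule.coe_smul, real_inner_smul_left]
  have hgy : |⟪(g x : E), y⟫| ≤ B * ‖y‖ := (abs_real_inner_le_norm _ _).trans
    (mul_le_mul_of_nonneg_right (hgB x) (norm_nonneg _))
  have h1 : |r - 1 - ⟪(((w x)⁻¹ • g x : V) : E), y⟫| ≤ K / a * ‖y‖ ^ 2 := by
    rw [hin, hrdiff, ← mul_sub, abs_mul, abs_of_nonneg hinv0]
    calc _ ≤ a⁻¹ * (K * ‖y‖ ^ 2) := mul_le_mul hinv (hgK x y) (abs_nonneg _) (by positivity)
      _ = _ := by ring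
  have h2 : |⟪(((w x)⁻¹ • g x : V) : E), y⟫| ≤ B / a * ‖y‖ := by
    rw [hin, abs_mul, abs_of_nonneg hinv0]
    calc _ ≤ a⁻¹ * (B * ‖y‖) := mul_le_mul hinv hgy (abs_nonneg _) (by positivity)
      _ = _ := by ring
  have h3 : |w (x + y) - w x| ≤ (B + K + b) * ‖y‖ := by
    rcases le_total ‖y‖ 1 with hy | hy
    · have h4 : |w (x + y) - w x| ≤ |w (x + y) - w x - ⟪(g x : E), y⟫| + |⟪(g x : E), y⟫| := by
        have := abs_add_le (w (x + y) - w x - ⟪(g x : E), y⟫) ⟪(g x : E), y⟫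
        simpa using this
      have h5 := hgK x y
      have h6 : K * ‖y‖ ^ 2 ≤ K * ‖y‖ := by
        apply mul_le_mul_of_nonneg_left _ hK
        nlinarith [norm_nonneg y]
      nlinarith [norm_nonneg y]
    · have h4 : |w (x + y) - w x| ≤ b := by
        rw [_root_.abs_le]
        constructor <;> linarith [hw.apply_le x, hw.apply_le (x + y), hpos x, hpos (x + y)]
      nlinarith
  have h4 : |Real.log r| ≤ C₁ * ‖y‖ := by
    refine (abs_log_le_mul hr1 hR1).trans ?_
    rw [hrdiff, abs_mul, abs_of_nonneg hinv0]
    calc _ ≤ R * (a⁻¹ * ((B + K + b) * ‖y‖)) := by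
          gcongr
      _ = _ := by simp only [C₁]; ring
  have h5 : |Real.log r - ⟪(((w x)⁻¹ • g x : V) : E), y⟫| ≤ (K₂ * C₁ ^ 2 + K / a) * ‖y‖ ^ 2 := by
    have h6 := h₂ _ (abs_log_le_log hr1 hr2 hR1)
    rw [Real.exp_log hr0] at h6
    have h7 : (Real.log r) ^ 2 ≤ (C₁ * ‖y‖) ^ 2 := by
      rw [← sq_abs]; exact pow_le_pow_left₀ (abs_nonneg _) h4 2
    have h8 : |Real.log r - ⟪(((w x)⁻¹ • g x : V) : E), y⟫| ≤ |r - 1 - Real.log r| +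
        |r - 1 - ⟪(((w x)⁻¹ • g x : V) : E), y⟫| := by
      have := abs_sub (r - 1 - ⟪(((w x)⁻¹ • g x : V) : E), y⟫) (r - 1 - Real.log r)
      rw [show r - 1 - ⟪(((w x)⁻¹ • g x : V) : E), y⟫ - (r - 1 - Real.log r)
        = Real.log r - ⟪(((w x)⁻¹ • g x : V) : E), y⟫ by ring] at this
      linarith
    nlinarith [mul_le_mul_of_nonneg_left h7 hK₂]
  have hn := norm_nonneg y
  have p1 : 0 ≤ B / a := by positivity
  have p2 : 0 ≤ K₂ * C₁ ^ 2 := by positivity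
  have p3 : 0 ≤ K / a := by positivity
  have hy2 : 0 ≤ ‖y‖ ^ 2 := by positivity
  refine ⟨h1.trans ?_, h2.trans ?_, h4.trans ?_, h5.trans ?_⟩
  all_goals gcongr; linarith

end IsTame

set_option maxHeartbeats 1000000 in
/-- One step of the Gaussian Hölder inequality. -/
lemma exists_gaussAvg_prod_le {ι : Type*} [Fintype ι] {q : ι → ℝ} (hq : ∀ j, 0 ≤ q j)
    {V : ι → Submodule ℝ E}
    (hV : ∀ a : ∀ j, V j, ‖∑ j, q j • (a j : E)‖ ^ 2 ≤ ∑ j, q j * ‖a j‖ ^ 2)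
    {a b B K : ℝ} (ha : 0 < a) (hab : a ≤ b) (hB : 0 ≤ B) (hK : 0 ≤ K) :
    ∃ K' : ℝ, 0 ≤ K' ∧ ∀ h : ℝ, 0 ≤ h → h ≤ 1 → ∀ w : ι → E → ℝ,
      (∀ j, IsTame (V j) a b B K (w j)) → ∀ x,
        gaussAvg h (fun x => ∏ j, w j x ^ q j) x
          ≤ (1 + K' * h ^ 3) * ∏ j, gaussAvg h (w j) x ^ q j := by
  have hb : 0 < b := ha.trans_le hab
  set R := b / a with hR
  have hR1 : 1 ≤ R := by rw [hR, le_div_iff₀ ha]; linarith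
  have hRinv : R⁻¹ = a / b := by rw [hR, inv_div]
  set T := Real.log R with hT
  have hT0 : 0 ≤ T := Real.log_nonneg hR1
  set Q := ∑ j, q j with hQ
  have hQ0 : 0 ≤ Q := Finset.sum_nonneg fun j _ => hq j
  obtain ⟨C, hC, hexp⟩ := IsTame.exists_log_expansion (E := E) ha hab hB hK
  obtain ⟨K₁, hK₁, h₁⟩ := exists_exp_sum_le hq T C hC
  obtain ⟨K₂, hK₂, h₂⟩ := exists_abs_exp_sub_one_sub_le T
  set M₂ := ∫ z : E, ‖z‖ ^ 2 ∂(stdGaussian E) with hM₂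
  set M₃ := ∫ z : E, ‖z‖ ^ 3 ∂(stdGaussian E) with hM₃
  have hM₂0 : 0 ≤ M₂ := integral_nonneg fun z => by positivity
  have hM₃0 : 0 ≤ M₃ := integral_nonneg fun z => by positivity
  set K₃ := K₁ * M₃ + Q * (K₂ * (R * (C * M₂)) ^ 2)
  have hK₃ : 0 ≤ K₃ := by positivity
  refine ⟨K₃ * Real.exp (Q * T), by positivity, fun h h0 h1 w hw x => ?_⟩
  have hpos : ∀ j x, 0 < w j x := fun j x => ha.trans_le ((hw j).le_apply x)
  have hlb : ∀ {u v : ℝ}, a ≤ u → u ≤ b → a ≤ v → v ≤ b → R⁻¹ ≤ u / v ∧ u / v ≤ R := by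
    intro u v hu hu' hv hv'
    have : 0 < v := ha.trans_le hv
    rw [hRinv, hR]
    exact ⟨div_le_div₀ (ha.le.trans hu) hu this hv', div_le_div₀ hb.le hu' ha hv⟩
  choose l hl using fun j => hexp (V j) (w j) (hw j) x
  set r : ι → E → ℝ := fun j z => w j (x + h • z) / w j x with hr
  have hr0 : ∀ j z, 0 < r j z := fun j z => div_pos (hpos _ _) (hpos _ _)
  have hrR : ∀ j z, R⁻¹ ≤ r j z ∧ r j z ≤ R := fun j z =>
    hlb ((hw j).le_apply _) ((hw j).apply_le _) ((hw j).le_apply _) ((hw j).apply_le _)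
  have hri : ∀ j, Integrable (r j) (stdGaussian E) := fun j =>
    ((hw j).integrable_shift h x).div_const _
  set U : ℝ := ∏ j, w j x ^ q j with hU
  have hU0 : 0 < U := Finset.prod_pos fun j _ => Real.rpow_pos_of_pos (hpos j x) _
  have hprod : ∀ z, ∏ j, w j (x + h • z) ^ q j = U * Real.exp (∑ j, q j * Real.log (r j z)) := by
    intro z
    rw [Real.exp_sum, hU, ← Finset.prod_mul_distrib]
    refine Finset.prod_congr rfl fun j _ => ?_
    rw [mul_comm (q j), ← Real.rpow_def_of_pos (hr0 j z), ← Real.mul_rpow (hpos _ _).le (hr0 _ _).le,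
      hr, mul_div_cancel₀ _ (hpos j x).ne']
  have hpt : ∀ z, Real.exp (∑ j, q j * Real.log (r j z)) ≤ 1 + ∑ j, q j * (r j z - 1)
      + h ^ 2 * (⟪∑ j, q j • (l j : E), z⟫ ^ 2 - ∑ j, q j * ⟪(l j : E), z⟫ ^ 2) / 2
      + K₁ * h ^ 3 * ‖z‖ ^ 3 := by
    intro z
    have hnz : ‖h • z‖ = h * ‖z‖ := by rw [norm_smul, Real.norm_of_nonneg h0]
    have := h₁ (fun j => Real.log (r j z)) (fun j => ⟪(l j : E), h • z⟫) ‖h • z‖ (norm_nonneg _)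
      (fun j => abs_log_le_log (hrR j z).1 (hrR j z).2 hR1) (fun j => (hl j (h • z)).2.2.1)
      (fun j => (hl j (h • z)).2.1) (fun j => (hl j (h • z)).2.2.2)
    simp only [Real.exp_log (hr0 _ _)] at this
    refine this.trans (le_of_eq ?_)
    rw [hnz]
    simp only [inner_smul_right, sum_inner, real_inner_smul_left]
    have e1 : ∑ j, q j * (h * ⟪(l j : E), z⟫) = h * ∑ j, q j * ⟪(l j : E), z⟫ := by
      rw [Finset.mul_sum]; exact Finset.sum_congr rfl fun j _ => by ring
    have e2 : ∑ j, q j * (h * ⟪(l j : E), z⟫) ^ 2 = h ^ 2 * ∑ j, q j * ⟪(l j : E), z⟫ ^ 2 := by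
      rw [Finset.mul_sum]; exact Finset.sum_congr rfl fun j _ => by ring
    rw [e1, e2]
    ring
  -- The relative increment of `w j` under averaging. Both sides will be compared through 1 + ∑ q ρ.
  set ρ : ι → ℝ := fun j => gaussAvg h (w j) x / w j x - 1 with hρ
  have hρr : ∀ j, ∫ z, (r j z - 1) ∂(stdGaussian E) = ρ j := by
    intro j
    rw [integral_sub (hri j) (integrable_const _), integral_div]
    simp [hρ, gaussAvg]
  have hint1 : ∀ j, Integrable (fun z => q j * (r j z - 1)) (stdGaussian E) := fun j =>
    ((hri j).sub (integrable_const _)).const_mul _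
  have hint2 : Integrable (fun z => ∑ j, q j * (r j z - 1)) (stdGaussian E) :=
    integrable_finsetSum _ fun j _ => hint1 j
  have hint3 : Integrable (fun z => h ^ 2 * (⟪∑ j, q j • (l j : E), z⟫ ^ 2
      - ∑ j, q j * ⟪(l j : E), z⟫ ^ 2) / 2) (stdGaussian E) :=
    (((integrable_inner_sq_stdGaussian _).sub (integrable_finsetSum _ fun j _ =>
      (integrable_inner_sq_stdGaussian _).const_mul _)).const_mul _).div_const _
  have hint4 : Integrable (fun z : E => K₁ * h ^ 3 * ‖z‖ ^ 3) (stdGaussian E) :=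
    (integrable_norm_pow_stdGaussian 3).const_mul _
  -- The mean of ⟨v, z⟩² is ‖v‖², so the second-order term has the sign given by `hV`. This is where
  -- the geometric hypothesis enters.
  have hquad : ∫ z, h ^ 2 * (⟪∑ j, q j • (l j : E), z⟫ ^ 2
      - ∑ j, q j * ⟪(l j : E), z⟫ ^ 2) / 2 ∂(stdGaussian E) ≤ 0 := by
    rw [integral_div, integral_const_mul, integral_sub (integrable_inner_sq_stdGaussian _)
      (integrable_finsetSum _ fun j _ => (integrable_inner_sq_stdGaussian _).const_mul _),
      integral_finsetSum _ fun j _ => (integrable_inner_sq_stdGaussian _).const_mul _]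
    simp only [integral_const_mul, integral_inner_sq_stdGaussian]
    have := hV l
    simp only [Submodule.coe_norm] at this
    have h3 : 0 ≤ h ^ 2 := by positivity
    nlinarith [mul_nonneg h3 (sub_nonneg.2 this)]
  have hwc : Continuous fun z => ∏ j, w j (x + h • z) ^ q j :=
    continuous_finsetProd _ fun j _ => ((hw j).continuous.comp (by fun_prop)).rpow_const
      fun z => Or.inl (hpos _ _).ne'
  have hUint : Integrable (fun z => Real.exp (∑ j, q j * Real.log (r j z))) (stdGaussian E) := by
    have : (fun z => Real.exp (∑ j, q j * Real.log (r j z)))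
        = fun z => U⁻¹ * ∏ j, w j (x + h • z) ^ q j := by
      ext z; rw [hprod]; field_simp
    rw [this]
    refine integrable_of_continuous_of_bounded (continuous_const.mul hwc)
      (c := Real.exp (Q * T)) fun z => ?_
    have e : U⁻¹ * ∏ j, w j (x + h • z) ^ q j = Real.exp (∑ j, q j * Real.log (r j z)) := by
      rw [hprod]; field_simp
    rw [e, abs_of_pos (Real.exp_pos _), Real.exp_le_exp, hQ, Finset.sum_mul]
    exact Finset.sum_le_sum fun j _ => mul_le_mul_of_nonneg_left
      ((le_abs_self _).trans (abs_log_le_log (hrR j z).1 (hrR j z).2 hR1)) (hq j)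
  have hupper : ∫ z, Real.exp (∑ j, q j * Real.log (r j z)) ∂(stdGaussian E)
      ≤ 1 + ∑ j, q j * ρ j + K₁ * M₃ * h ^ 3 := by
    have hs := integral_mono hUint
      ((((integrable_const (1 : ℝ)).add hint2).add hint3).add hint4) hpt
    rw [integral_add' (((integrable_const (1 : ℝ)).add hint2).add hint3) hint4,
      integral_add' ((integrable_const (1 : ℝ)).add hint2) hint3,
      integral_add' (integrable_const (1 : ℝ)) hint2, integral_finsetSum _ fun j _ => hint1 j,
      integral_const_mul] at hs
    simp only [integral_const_mul, hρr, integral_const, probReal_univ, smul_eq_mul,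
      mul_one] at hs
    linarith
  have hρ1 : ∀ j, 1 + ρ j = gaussAvg h (w j) x / w j x := fun j => by simp [hρ]
  have hρR : ∀ j, R⁻¹ ≤ 1 + ρ j ∧ 1 + ρ j ≤ R := fun j => by
    rw [hρ1]
    exact hlb (((hw j).gaussAvg h).le_apply x) (((hw j).gaussAvg h).apply_le x)
      ((hw j).le_apply x) ((hw j).apply_le x)
  have hρ0 : ∀ j, 0 < 1 + ρ j := fun j =>
    lt_of_lt_of_le (inv_pos.2 (by linarith)) (hρR j).1
  -- The linear term has mean zero, so averaging changes `w j` only at order h².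
  have hρsmall : ∀ j, |ρ j| ≤ C * M₂ * h ^ 2 := by
    intro j
    have hli : Integrable (fun z => ⟪(l j : E), h • z⟫) (stdGaussian E) :=
      ((IsGaussian.integrable_dual (stdGaussian E) (innerSL ℝ (l j : E))).const_mul h).congr
        (Eventually.of_forall fun z => by simp [inner_smul_right])
    have hl0 : ∫ z, ⟪(l j : E), h • z⟫ ∂(stdGaussian E) = 0 := by
      simp only [inner_smul_right]
      rw [integral_const_mul]
      have := integral_strongDual_stdGaussian (innerSL ℝ (l j : E))
      simp only [innerSL_apply_apply] at this
      rw [this, mul_zero]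
    have e : ρ j = ∫ z, (r j z - 1 - ⟪(l j : E), h • z⟫) ∂(stdGaussian E) := by
      rw [integral_sub (f := fun z => r j z - 1) ((hri j).sub (integrable_const _)) hli, hl0, hρr, sub_zero]
    rw [e, ← Real.norm_eq_abs]
    calc _ ≤ ∫ z, C * h ^ 2 * ‖z‖ ^ 2 ∂(stdGaussian E) := by
          refine norm_integral_le_of_norm_le ((integrable_norm_pow_stdGaussian 2).const_mul _)
            (Eventually.of_forall fun z => ?_)
          have := (hl j (h • z)).1
          rw [norm_smul, Real.norm_of_nonneg h0] at this
          rw [Real.norm_eq_abs]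
          refine this.trans (le_of_eq (by ring))
      _ = C * M₂ * h ^ 2 := by rw [integral_const_mul]; ring
  have hτ : ∀ j, ρ j ≤ Real.log (1 + ρ j) + K₂ * (R * (C * M₂)) ^ 2 * h ^ 3 := by
    intro j
    have h3 := (abs_le.1 (h₂ _ (abs_log_le_log (hρR j).1 (hρR j).2 hR1))).2
    rw [Real.exp_log (hρ0 j)] at h3
    have h4 : |Real.log (1 + ρ j)| ≤ R * (C * M₂ * h ^ 2) := by
      refine (abs_log_le_mul (hρR j).1 hR1).trans ?_
      rw [add_sub_cancel_left]
      exact mul_le_mul_of_nonneg_left (hρsmall j) (by linarith)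
    have h5 : Real.log (1 + ρ j) ^ 2 ≤ (R * (C * M₂ * h ^ 2)) ^ 2 := by
      rw [← sq_abs]; exact pow_le_pow_left₀ (abs_nonneg _) h4 2
    have h6 : h ^ 4 ≤ h ^ 3 := pow_le_pow_of_le_one h0 h1 (by norm_num)
    have h7 : (R * (C * M₂ * h ^ 2)) ^ 2 ≤ (R * (C * M₂)) ^ 2 * h ^ 3 := by
      have : (R * (C * M₂ * h ^ 2)) ^ 2 = (R * (C * M₂)) ^ 2 * h ^ 4 := by ring
      rw [this]; exact mul_le_mul_of_nonneg_left h6 (by positivity)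
    nlinarith [mul_le_mul_of_nonneg_left (h5.trans h7) hK₂]
  set P := ∑ j, q j * Real.log (1 + ρ j) with hP
  have hsum : ∑ j, q j * ρ j ≤ P + Q * (K₂ * (R * (C * M₂)) ^ 2) * h ^ 3 := by
    have := Finset.sum_le_sum (s := Finset.univ) fun j _ =>
      mul_le_mul_of_nonneg_left (hτ j) (hq j)
    simp only [mul_add, Finset.sum_add_distrib, ← Finset.sum_mul] at this
    rw [hP]; linarith
  -- A lower bound on `P` lets the additive error K₃ h³ be absorbed as a multiple of exp P, which
  -- makes the error multiplicative.
  have hPlow : -(Q * T) ≤ P := by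
    rw [hP, hQ, Finset.sum_mul, ← Finset.sum_neg_distrib]
    refine Finset.sum_le_sum fun j _ => ?_
    have := (abs_le.1 (abs_log_le_log (hρR j).1 (hρR j).2 hR1)).1
    nlinarith [mul_le_mul_of_nonneg_left this (hq j)]
  have hfin : ∫ z, Real.exp (∑ j, q j * Real.log (r j z)) ∂(stdGaussian E)
      ≤ (1 + K₃ * Real.exp (Q * T) * h ^ 3) * Real.exp P := by
    have h3 := Real.add_one_le_exp P
    have h4 : 1 ≤ Real.exp (Q * T) * Real.exp P := by
      rw [← Real.exp_add]; exact Real.one_le_exp (by linarith)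
    have h5 : 0 ≤ K₃ * h ^ 3 := by positivity
    have h6 := mul_le_mul_of_nonneg_left h4 h5
    have h7 : ∫ z, Real.exp (∑ j, q j * Real.log (r j z)) ∂(stdGaussian E)
        ≤ 1 + P + K₃ * h ^ 3 := by
      simp only [K₃]; linarith
    nlinarith
  have hL : gaussAvg h (fun x => ∏ j, w j x ^ q j) x
      = U * ∫ z, Real.exp (∑ j, q j * Real.log (r j z)) ∂(stdGaussian E) := by
    rw [← integral_const_mul]
    exact integral_congr_ae (Eventually.of_forall hprod)
  have hRR : ∏ j, gaussAvg h (w j) x ^ q j = U * Real.exp P := by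
    rw [hP, Real.exp_sum, hU, ← Finset.prod_mul_distrib]
    refine Finset.prod_congr rfl fun j _ => ?_
    rw [mul_comm (q j), ← Real.rpow_def_of_pos (hρ0 j), ← Real.mul_rpow (hpos _ _).le (hρ0 _).le,
      hρ1, mul_div_cancel₀ _ (hpos j x).ne']
  rw [hL, hRR]
  nlinarith [mul_le_mul_of_nonneg_left hfin hU0.le]

end BrascampLieb

/-! ### Iteration of the time step. -/

namespace BrascampLieb
open ProbabilityTheory Filter Topology
open scoped RealInnerProductSpace
set_option linter.unusedSectionVars false

variable {E : Type*} [NormedAddCommGroup E] [InnerProductSpace ℝ E] [FiniteDimensional ℝ E]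
  [MeasurableSpace E] [BorelSpace E]

section
variable {ι : Type*} [Fintype ι] {q : ι → ℝ} {V : ι → Submodule ℝ E} {a b B K : ℝ}
  {w : ι → E → ℝ}

lemma continuous_prod_rpow (ha : 0 < a) (hw : ∀ j, IsTame (V j) a b B K (w j)) :
    Continuous fun x => ∏ j, w j x ^ q j :=
  continuous_finsetProd _ fun j _ => (hw j).continuous.rpow_const
    fun z => Or.inl (ha.trans_le ((hw j).le_apply z)).ne'

lemma abs_prod_rpow_le (hq : ∀ j, 0 ≤ q j) (ha : 0 < a)
    (hw : ∀ j, IsTame (V j) a b B K (w j)) (x : E) :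
    |∏ j, w j x ^ q j| ≤ ∏ j, b ^ q j := by
  have h0 : ∀ j, 0 ≤ w j x := fun j => ha.le.trans ((hw j).le_apply x)
  rw [abs_of_nonneg (Finset.prod_nonneg fun j _ => Real.rpow_nonneg (h0 j) _)]
  exact Finset.prod_le_prod (fun j _ => Real.rpow_nonneg (h0 j) _)
    fun j _ => Real.rpow_le_rpow (h0 j) ((hw j).apply_le x) (hq j)

/-- Variances add, so averaging at scale h and then at h√N is averaging at h√(N+1). The one-step
bound is applied inside, and the induction hypothesis to the averaged functions, which are tame with
the same constants. -/
lemma gaussAvg_iterate_le (hq : ∀ j, 0 ≤ q j) (ha : 0 < a) {h κ : ℝ} (hκ : 0 ≤ κ)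
    (hstep : ∀ w : ι → E → ℝ, (∀ j, IsTame (V j) a b B K (w j)) → ∀ x,
        gaussAvg h (fun x => ∏ j, w j x ^ q j) x
          ≤ (1 + κ) * ∏ j, gaussAvg h (w j) x ^ q j) (N : ℕ) :
    ∀ w : ι → E → ℝ, (∀ j, IsTame (V j) a b B K (w j)) → ∀ x,
      gaussAvg (h * √N) (fun x => ∏ j, w j x ^ q j) x
          ≤ (1 + κ) ^ N * ∏ j, gaussAvg (h * √N) (w j) x ^ q j := by
  induction N with
  | zero =>
    intro w hw x
    simp [gaussAvg]
  | succ N ih =>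
    intro w hw x
    have hr : (h * √(N + 1 : ℕ)) ^ 2 = (h * √N) ^ 2 + h ^ 2 := by
      rw [mul_pow, mul_pow, Real.sq_sqrt (by positivity), Real.sq_sqrt (by positivity)]
      push_cast; ring
    have hw' : ∀ j, IsTame (V j) a b B K (gaussAvg h (w j)) := fun j => (hw j).gaussAvg h
    rw [← gaussAvg_gaussAvg (continuous_prod_rpow ha hw) (abs_prod_rpow_le hq ha hw) _ _ _ hr]
    have e : ∀ j, gaussAvg (h * √(N + 1 : ℕ)) (w j) x = gaussAvg (h * √N) (gaussAvg h (w j)) x :=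
      fun j => by rw [gaussAvg_gaussAvg (hw j).continuous (hw j).abs_le _ _ _ hr]
    simp_rw [e]
    have hcont : Continuous (gaussAvg h fun x => ∏ j, w j x ^ q j) := by
      refine continuous_of_dominated (bound := fun _ => ∏ j, b ^ q j) (fun x => ?_) (fun x => ?_)
        (integrable_const _) ?_
      · exact ((continuous_prod_rpow ha hw).comp (by fun_prop)).aestronglyMeasurable
      · exact Eventually.of_forall fun z => abs_prod_rpow_le hq ha hw _
      · exact Eventually.of_forall fun z => (continuous_prod_rpow ha hw).comp (by fun_prop)
    calc gaussAvg (h * √N) (gaussAvg h fun x => ∏ j, w j x ^ q j) x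
        ≤ gaussAvg (h * √N) (fun x => (1 + κ) * ∏ j, gaussAvg h (w j) x ^ q j) x := by
          refine integral_mono ?_ ?_ fun z => hstep w hw _
          · refine integrable_of_continuous_of_bounded (hcont.comp (by fun_prop))
              (c := ∏ j, b ^ q j) fun z => ?_
            have := norm_integral_le_of_norm_le_const (μ := stdGaussian E)
              (f := fun y => ∏ j, w j (x + (h * √N) • z + h • y) ^ q j) (C := ∏ j, b ^ q j)
              (Eventually.of_forall fun y => abs_prod_rpow_le hq ha hw _)
            simpa [gaussAvg] using this
          · exact (integrable_of_continuous_of_bounded ((continuous_prod_rpow ha hw').comp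
              (by fun_prop)) fun z => abs_prod_rpow_le hq ha hw' _).const_mul _
      _ = (1 + κ) * gaussAvg (h * √N) (fun x => ∏ j, gaussAvg h (w j) x ^ q j) x :=
          integral_const_mul _ _
      _ ≤ (1 + κ) * ((1 + κ) ^ N * ∏ j, gaussAvg (h * √N) (gaussAvg h (w j)) x ^ q j) :=
          mul_le_mul_of_nonneg_left (ih _ hw' x) (by linarith)
      _ = _ := by ring

/-- The Gaussian Hölder inequality for tame functions. -/
theorem integral_prod_rpow_le_of_isTame (hq : ∀ j, 0 ≤ q j)
    (hV : ∀ a : ∀ j, V j, ‖∑ j, q j • (a j : E)‖ ^ 2 ≤ ∑ j, q j * ‖a j‖ ^ 2)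
    (ha : 0 < a) (hab : a ≤ b) (hB : 0 ≤ B) (hK : 0 ≤ K)
    (hw : ∀ j, IsTame (V j) a b B K (w j)) :
    ∫ z, ∏ j, w j z ^ q j ∂(stdGaussian E) ≤ ∏ j, (∫ z, w j z ∂(stdGaussian E)) ^ q j := by
  obtain ⟨K', hK', hstep⟩ := exists_gaussAvg_prod_le (E := E) hq hV ha hab hB hK
  -- With h = N^(-1/2), N steps reach time one, and (1 + K' N^(-3/2))^N ≤ exp(K' N^(-1/2)).
  have hN : ∀ N : ℕ, 1 ≤ N → ∫ z, ∏ j, w j z ^ q j ∂(stdGaussian E) ≤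
      Real.exp (K' * (√N)⁻¹) * ∏ j, (∫ z, w j z ∂(stdGaussian E)) ^ q j := by
    intro N hN
    have hN' : (1 : ℝ) ≤ N := by exact_mod_cast hN
    have hs : 1 ≤ √(N : ℝ) := Real.one_le_sqrt.2 hN'
    have hs0 : 0 < √(N : ℝ) := by linarith
    have h1 : (√(N : ℝ))⁻¹ ≤ 1 := inv_le_one_of_one_le₀ hs
    have := gaussAvg_iterate_le hq ha (h := (√(N : ℝ))⁻¹) (κ := K' * (√(N : ℝ))⁻¹ ^ 3)
      (by positivity) (hstep _ (by positivity) h1) N w hw 0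
    rw [inv_mul_cancel₀ hs0.ne'] at this
    simp only [gaussAvg, zero_add, one_smul] at this
    refine this.trans (mul_le_mul_of_nonneg_right ?_ ?_)
    · have h2 : 1 + K' * (√(N : ℝ))⁻¹ ^ 3 ≤ Real.exp (K' * (√(N : ℝ))⁻¹ ^ 3) := by
        linarith [Real.add_one_le_exp (K' * (√(N : ℝ))⁻¹ ^ 3)]
      refine (pow_le_pow_left₀ (by positivity) h2 N).trans (le_of_eq ?_)
      rw [← Real.exp_nat_mul]
      congr 1
      have h3 : (N : ℝ) = √N * √N := (Real.mul_self_sqrt (by positivity)).symm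
      nth_rewrite 1 [h3]
      field_simp
    · exact Finset.prod_nonneg fun j _ => Real.rpow_nonneg
        (integral_nonneg fun z => ha.le.trans ((hw j).le_apply z)) _
  have hlim : Tendsto (fun N : ℕ => Real.exp (K' * (√(N : ℝ))⁻¹) *
      ∏ j, (∫ z, w j z ∂(stdGaussian E)) ^ q j) atTop
      (𝓝 (Real.exp (K' * 0) * ∏ j, (∫ z, w j z ∂(stdGaussian E)) ^ q j)) := by
    refine Tendsto.mul_const _ ((Real.continuous_exp.tendsto _).comp (Tendsto.const_mul _ ?_))
    exact (Real.tendsto_sqrt_atTop.comp tendsto_natCast_atTop_atTop).inv_tendsto_atTop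
  have := ge_of_tendsto hlim (eventually_atTop.2 ⟨1, hN⟩)
  simpa using this

end

end BrascampLieb

/-! ### Gaussian Hölder for functions of linear images of a Gaussian vector. -/

namespace BrascampLieb
open ProbabilityTheory Filter Topology
open scoped RealInnerProductSpace
set_option linter.unusedSectionVars false

variable {E : Type*} [NormedAddCommGroup E] [InnerProductSpace ℝ E] [FiniteDimensional ℝ E]
  [MeasurableSpace E] [BorelSpace E]
  {F : Type*} [NormedAddCommGroup F] [InnerProductSpace ℝ F] [FiniteDimensional ℝ F]
  [MeasurableSpace F] [BorelSpace F]

lemma IsTame.mono {V : Submodule ℝ E} {a b B K b' B' K' : ℝ} {w : E → ℝ}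
    (hw : IsTame V a b B K w) (hb : b ≤ b') (hB : B ≤ B') (hK : K ≤ K') :
    IsTame V a b' B' K' w := by
  obtain ⟨g, hg, hgB, hgK⟩ := hw.exists_gradient
  exact ⟨hw.continuous, hw.le_apply, fun x => (hw.apply_le x).trans hb, g, hg,
    fun x => (hgB x).trans hB, fun x y => (hgK x y).trans (by gcongr)⟩

/-- The derivative is C¹ with compact support, hence Lipschitz. The mean value inequality on
segments then gives the quadratic remainder. -/
lemma exists_gradient_bounds {h : F → ℝ} (hh : ContDiff ℝ 2 h) (hc : HasCompactSupport h) :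
    ∃ b B K : ℝ, 0 ≤ b ∧ 0 ≤ B ∧ 0 ≤ K ∧ (∀ y, h y ≤ b) ∧ ∃ G : F → F, Continuous G ∧
      (∀ y, ‖G y‖ ≤ B) ∧ ∀ x y, |h (x + y) - h x - ⟪G x, y⟫| ≤ K * ‖y‖ ^ 2 := by
  obtain ⟨b, hb⟩ := hc.exists_bound_of_continuous hh.continuous
  have hd : ContDiff ℝ 1 (fderiv ℝ h) := hh.fderiv_right (by norm_num)
  have hdc : HasCompactSupport (fderiv ℝ h) := hc.fderiv ℝ
  obtain ⟨B, hB⟩ := hdc.exists_bound_of_continuous hd.continuous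
  obtain ⟨K, hK⟩ := hd.lipschitzWith_of_hasCompactSupport hdc (by simp)
  refine ⟨b, B, K, (norm_nonneg _).trans (hb 0), (norm_nonneg _).trans (hB 0), K.2,
    fun y => (le_abs_self _).trans (hb y),
    fun y => (InnerProductSpace.toDual ℝ F).symm (fderiv ℝ h y), ?_, ?_, ?_⟩
  · exact (LinearIsometryEquiv.continuous _).comp hd.continuous
  · intro y; simpa using hB y
  · intro x y
    have hseg : ∀ z ∈ segment ℝ x (x + y), ‖fderiv ℝ h z - fderiv ℝ h x‖ ≤ K * ‖y‖ := by
      intro z hz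
      have h1 := hK.dist_le_mul z x
      rw [dist_eq_norm, dist_eq_norm] at h1
      refine h1.trans (mul_le_mul_of_nonneg_left ?_ K.2)
      have := norm_sub_le_of_mem_segment hz
      simpa using this
    have := (convex_segment x (x + y)).norm_image_sub_le_of_norm_fderiv_le' (𝕜 := ℝ)
      (fun z _ => (hh.differentiable (by norm_num)).differentiableAt) hseg
      (left_mem_segment ℝ _ _) (right_mem_segment ℝ _ _)
    rw [InnerProductSpace.toDual_symm_apply]
    simpa [sq, mul_assoc] using this

/-- The shift `a` bounds the function below, and the gradient of h ∘ M lies in the range of M*. The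
constants do not depend on `a`. -/
lemma isTame_comp_add {h : F → ℝ} (hh : ContDiff ℝ 2 h) (hc : HasCompactSupport h)
    (h0 : ∀ y, 0 ≤ h y) (M : E →L[ℝ] F) :
    ∃ b B K : ℝ, 0 ≤ b ∧ 0 ≤ B ∧ 0 ≤ K ∧ ∀ a : ℝ, a ≤ 1 →
      IsTame (LinearMap.range (ContinuousLinearMap.adjoint M : F →ₗ[ℝ] E)) a (b + 1) B K
        (fun x => h (M x) + a) := by
  obtain ⟨b, B, K, hb0, hB0, hK0, hb, G, hG, hGB, hGK⟩ := exists_gradient_bounds hh hc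
  refine ⟨b, ‖ContinuousLinearMap.adjoint M‖ * B, K * ‖M‖ ^ 2, hb0, by positivity, by positivity,
    fun a ha => ⟨?_, fun x => ?_, fun x => ?_,
      fun x => ⟨ContinuousLinearMap.adjoint M (G (M x)), ⟨_, rfl⟩⟩, ?_, fun x => ?_,
      fun x y => ?_⟩⟩
  · exact (hh.continuous.comp M.continuous).add continuous_const
  · linarith [h0 (M x)]
  · linarith [hb (M x)]
  · exact Continuous.subtype_mk (by fun_prop) _
  · rw [Submodule.coe_norm]
    exact ((ContinuousLinearMap.adjoint M).le_opNorm _).trans (by gcongr; exact hGB _)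
  · have h1 := hGK (M x) (M y)
    rw [ContinuousLinearMap.adjoint_inner_left]
    rw [map_add]
    rw [show h (M x + M y) + a - (h (M x) + a) - ⟪G (M x), M y⟫
      = h (M x + M y) - h (M x) - ⟪G (M x), M y⟫ by ring]
    refine h1.trans ?_
    have := M.le_opNorm y
    calc K * ‖M y‖ ^ 2 ≤ K * (‖M‖ * ‖y‖) ^ 2 := by gcongr
      _ = _ := by ring

/-- The Gaussian Hölder inequality for compactly supported functions of Gaussian vectors. -/
theorem integral_prod_rpow_comp_le {ι : Type*} [Fintype ι] {F : ι → Type*}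
    [∀ j, NormedAddCommGroup (F j)] [∀ j, InnerProductSpace ℝ (F j)]
    [∀ j, FiniteDimensional ℝ (F j)] [∀ j, MeasurableSpace (F j)] [∀ j, BorelSpace (F j)]
    {q : ι → ℝ} (hq : ∀ j, 0 ≤ q j) (M : ∀ j, E →L[ℝ] F j)
    (hM : ∀ c : ∀ j, F j, ‖∑ j, q j • ContinuousLinearMap.adjoint (M j) (c j)‖ ^ 2
      ≤ ∑ j, q j * ‖ContinuousLinearMap.adjoint (M j) (c j)‖ ^ 2)
    {h : ∀ j, F j → ℝ} (hh : ∀ j, ContDiff ℝ 2 (h j)) (hc : ∀ j, HasCompactSupport (h j))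
    (h0 : ∀ j y, 0 ≤ h j y) :
    ∫ z, ∏ j, h j (M j z) ^ q j ∂(stdGaussian E)
      ≤ ∏ j, (∫ z, h j (M j z) ∂(stdGaussian E)) ^ q j := by
  choose b B K hb hB hK htame using fun j => isTame_comp_add (hh j) (hc j) (h0 j) (M j)
  have hint : ∀ j, Integrable (fun z => h j (M j z)) (stdGaussian E) := by
    intro j
    obtain ⟨c, hcb⟩ := (hc j).exists_bound_of_continuous (hh j).continuous
    exact integrable_of_continuous_of_bounded ((hh j).continuous.comp (M j).continuous)
      fun z => hcb _
  have hsum : ∀ (u : ι → ℝ), (∀ j, 0 ≤ u j) → ∀ j, u j ≤ ∑ i, u i := fun u hu j =>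
    Finset.single_le_sum (fun i _ => hu i) (Finset.mem_univ j)
  -- Compactly supported functions vanish somewhere, so the inequality is applied to h + a, and a
  -- decreases to 0 afterwards.
  have key : ∀ a : ℝ, 0 < a → a ≤ 1 → ∫ z, ∏ j, h j (M j z) ^ q j ∂(stdGaussian E)
      ≤ ∏ j, (∫ z, h j (M j z) ∂(stdGaussian E) + a) ^ q j := by
    intro a ha ha1
    have ht : ∀ j, IsTame (LinearMap.range (ContinuousLinearMap.adjoint (M j) : F j →ₗ[ℝ] E))
        a (∑ i, b i + 1) (∑ i, B i) (∑ i, K i) (fun x => h j (M j x) + a) := fun j =>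
      (htame j a ha1).mono (by linarith [hsum b hb j]) (hsum B hB j) (hsum K hK j)
    have hbs : 0 ≤ ∑ i, b i := Finset.sum_nonneg fun i _ => hb i
    have := integral_prod_rpow_le_of_isTame hq
      (V := fun j => LinearMap.range (ContinuousLinearMap.adjoint (M j) : F j →ₗ[ℝ] E)) (by
        intro v
        choose c hcv using fun j => (v j).2
        have := hM c
        simp only [Submodule.coe_norm]
        simp only [ContinuousLinearMap.coe_coe] at hcv
        simpa only [hcv] using this) ha (by linarith)
      (Finset.sum_nonneg fun i _ => hB i) (Finset.sum_nonneg fun i _ => hK i) ht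
    have e : ∀ j, ∫ z, (h j (M j z) + a) ∂(stdGaussian E)
        = ∫ z, h j (M j z) ∂(stdGaussian E) + a := fun j => by
      rw [integral_add (hint j) (integrable_const _)]; simp
    simp_rw [e] at this
    refine le_trans (integral_mono_of_nonneg ?_ ?_ ?_) this
    · exact Eventually.of_forall fun z => Finset.prod_nonneg fun j _ =>
        Real.rpow_nonneg (h0 j _) _
    · exact integrable_of_continuous_of_bounded (continuous_prod_rpow ha ht)
        (abs_prod_rpow_le hq ha ht)
    · exact Eventually.of_forall fun z => Finset.prod_le_prod
        (fun j _ => Real.rpow_nonneg (h0 j _) _)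
        fun j _ => Real.rpow_le_rpow (h0 j _) (by linarith) (hq j)
  have hlim : Tendsto (fun a : ℝ => ∏ j, (∫ z, h j (M j z) ∂(stdGaussian E) + a) ^ q j)
      (𝓝[>] 0) (𝓝 (∏ j, (∫ z, h j (M j z) ∂(stdGaussian E) + 0) ^ q j)) := by
    refine tendsto_nhdsWithin_of_tendsto_nhds (Continuous.tendsto ?_ 0)
    exact continuous_finsetProd _ fun j _ => (Real.continuous_rpow_const (hq j)).comp (by fun_prop)
  simp only [add_zero] at hlim
  refine ge_of_tendsto hlim ?_
  filter_upwards [Ioc_mem_nhdsGT (zero_lt_one' ℝ)] with a ha using key a ha.1 ha.2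

/-- A centred Gaussian law is determined by its covariance. Taking `R` invertible replaces a
Gaussian vector that comes from `E` by a linear change of variables on `F`. -/
lemma map_stdGaussian_eq (M : E →L[ℝ] F) (R : F →L[ℝ] F)
    (hR : R ∘L ContinuousLinearMap.adjoint R = M ∘L ContinuousLinearMap.adjoint M) :
    (stdGaussian E).map M = (stdGaussian F).map R := by
  have := Measure.isProbabilityMeasure_map (μ := stdGaussian E) (f := M) (by fun_prop)
  have := Measure.isProbabilityMeasure_map (μ := stdGaussian F) (f := R) (by fun_prop)
  have key : ∀ t, ‖ContinuousLinearMap.adjoint M t‖ ^ 2 = ‖ContinuousLinearMap.adjoint R t‖ ^ 2 := by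
    intro t
    rw [← real_inner_self_eq_norm_sq, ← real_inner_self_eq_norm_sq,
      ContinuousLinearMap.adjoint_inner_left, ContinuousLinearMap.adjoint_inner_left]
    have := congrArg (fun A : F →L[ℝ] F => ⟪t, A t⟫) hR
    simpa using this.symm
  apply Measure.ext_of_charFun
  ext t
  rw [charFun_apply, charFun_apply, integral_map (by fun_prop) (by fun_prop),
    integral_map (by fun_prop) (by fun_prop)]
  simp_rw [← ContinuousLinearMap.adjoint_inner_right]
  rw [← charFun_apply, ← charFun_apply, charFun_stdGaussian, charFun_stdGaussian]
  have := key t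
  rw [← Complex.ofReal_pow, ← Complex.ofReal_pow, this]

end BrascampLieb

/-! ### The Gaussian density, and the local inequality for test functions. -/

namespace BrascampLieb
open ProbabilityTheory Filter Topology
open scoped RealInnerProductSpace
set_option linter.unusedSectionVars false

variable {E : Type*} [NormedAddCommGroup E] [InnerProductSpace ℝ E] [FiniteDimensional ℝ E]
  [MeasurableSpace E] [BorelSpace E]
  {F : Type*} [NormedAddCommGroup F] [InnerProductSpace ℝ F] [FiniteDimensional ℝ F]
  [MeasurableSpace F] [BorelSpace F]

variable (E) in
/-- The normalising constant of the standard Gaussian density. -/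
noncomputable def gaussNorm : ℝ := (2 * Real.pi) ^ (Module.finrank ℝ E / 2 : ℝ)

lemma one_le_gaussNorm : 1 ≤ gaussNorm E :=
  Real.one_le_rpow (by nlinarith [Real.pi_gt_three]) (by positivity)

lemma gaussNorm_pos : 0 < gaussNorm E := one_pos.trans_le one_le_gaussNorm

lemma integral_exp_neg_sq_norm : ∫ x : E, Real.exp (-‖x‖ ^ 2 / 2) = gaussNorm E := by
  have := GaussianFourier.integral_rexp_neg_mul_sq_norm (V := E) (b := 1 / 2) (by norm_num)
  rw [show Real.pi / (1 / 2) = 2 * Real.pi by ring] at this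
  rw [gaussNorm, ← this]
  congr 1; ext x; congr 1; ring

lemma integrable_exp_neg_sq_norm : Integrable fun x : E => Real.exp (-‖x‖ ^ 2 / 2) := by
  by_contra h
  have := integral_undef h
  rw [integral_exp_neg_sq_norm] at this
  exact gaussNorm_pos.ne' this

/-- The standard Gaussian measure has the expected density. -/
lemma volume_withDensity_exp :
    (volume.withDensity fun x : E => ENNReal.ofReal (Real.exp (-‖x‖ ^ 2 / 2)))
      = ENNReal.ofReal (gaussNorm E) • stdGaussian E := by
  set ν := volume.withDensity fun x : E => ENNReal.ofReal (Real.exp (-‖x‖ ^ 2 / 2)) with hν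
  have hν_univ : ν univ = ENNReal.ofReal (gaussNorm E) := by
    rw [hν, withDensity_apply _ MeasurableSet.univ, Measure.restrict_univ,
      ← ofReal_integral_eq_lintegral_ofReal integrable_exp_neg_sq_norm
        (Eventually.of_forall fun x => (Real.exp_pos _).le), integral_exp_neg_sq_norm]
  have : IsFiniteMeasure ν := ⟨by rw [hν_univ]; exact ENNReal.ofReal_lt_top⟩
  have : IsFiniteMeasure (ENNReal.ofReal (gaussNorm E) • stdGaussian E) :=
    ⟨by simp⟩
  apply Measure.ext_of_charFun
  ext t
  rw [charFun_apply, charFun_apply, hν, integral_withDensity_eq_integral_toReal_smul (by fun_prop)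
    (Eventually.of_forall fun x => ENNReal.ofReal_lt_top), integral_smul_measure,
    ← charFun_apply, charFun_stdGaussian]
  have := GaussianFourier.integral_cexp_neg_mul_sq_norm_add (V := E) (b := 1 / 2) (by norm_num)
    Complex.I t
  rw [ENNReal.toReal_ofReal gaussNorm_pos.le]
  have e : ∀ x : E, (ENNReal.ofReal (Real.exp (-‖x‖ ^ 2 / 2))).toReal
      • Complex.exp (⟪x, t⟫ * Complex.I)
      = Complex.exp (-(1 / 2) * ‖x‖ ^ 2 + Complex.I * ⟪t, x⟫) := by
    intro x
    rw [ENNReal.toReal_ofReal (Real.exp_pos _).le, Complex.exp_add, real_inner_comm,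
      Complex.real_smul, Complex.ofReal_exp]
    congr 2
    · push_cast; ring
    · ring
  simp_rw [e]
  rw [this, Complex.real_smul]
  congr 1
  · rw [gaussNorm, Complex.ofReal_cpow (by positivity)]
    push_cast
    congr 1
    ring
  · congr 1
    rw [Complex.I_sq]
    ring

lemma lintegral_ofReal_exp_mul {G : E → ℝ≥0∞} (hG : Measurable G) :
    ∫⁻ x : E, ENNReal.ofReal (Real.exp (-‖x‖ ^ 2 / 2)) * G x
      = ENNReal.ofReal (gaussNorm E) * ∫⁻ x, G x ∂(stdGaussian E) := by
  have := congrArg (fun μ => ∫⁻ x, G x ∂μ) (volume_withDensity_exp (E := E))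
  simp only [lintegral_smul_measure] at this
  rw [lintegral_withDensity_eq_lintegral_mul _ (by fun_prop) hG] at this
  simpa using this

lemma lintegral_comp_linearMap {A : E →ₗ[ℝ] E} (hA : LinearMap.det A ≠ 0) {G : E → ℝ≥0∞}
    (hG : Measurable G) :
    ∫⁻ x, G x = ENNReal.ofReal |LinearMap.det A| * ∫⁻ z, G (A z) := by
  have hAc : Measurable A := A.continuous_of_finiteDimensional.measurable
  have := congrArg (fun μ => ∫⁻ x, G x ∂μ)
    (Measure.map_linearMap_addHaar_eq_smul_addHaar (volume : Measure E) hA)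
  simp only [lintegral_smul_measure] at this
  rw [lintegral_map hG hAc] at this
  rw [this, smul_eq_mul, ← mul_assoc, ← ENNReal.ofReal_mul (abs_nonneg _), ← abs_mul,
    mul_inv_cancel₀ hA]
  simp

/-- Expectation of a Gaussian-weighted function under a Gaussian vector. -/
lemma integral_stdGaussian_comp (M : E →L[ℝ] F) (R : F ≃L[ℝ] F)
    (hR : (R : F →L[ℝ] F) ∘L ContinuousLinearMap.adjoint (R : F →L[ℝ] F)
      = M ∘L ContinuousLinearMap.adjoint M) {f : F → ℝ} (hf : Continuous f) (h0 : ∀ y, 0 ≤ f y) :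
    ∫ z, f (M z) * Real.exp (‖R.symm (M z)‖ ^ 2 / 2) ∂(stdGaussian E)
      = (gaussNorm F)⁻¹ * (|LinearMap.det (R : F →ₗ[ℝ] F)|⁻¹ * ∫ y, f y) := by
  have hdet : LinearMap.det (R : F →ₗ[ℝ] F) ≠ 0 :=
    (LinearEquiv.isUnit_det' R.toLinearEquiv).ne_zero
  have hcont : Continuous fun y => f y * Real.exp (‖R.symm y‖ ^ 2 / 2) := by fun_prop
  have h1 : ∫ z, f (M z) * Real.exp (‖R.symm (M z)‖ ^ 2 / 2) ∂(stdGaussian E)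
      = ∫ z, f (R z) * Real.exp (‖z‖ ^ 2 / 2) ∂(stdGaussian F) := by
    have e1 := integral_map (μ := stdGaussian E) (φ := M) (by fun_prop)
      (hcont.aestronglyMeasurable)
    have e2 := integral_map (μ := stdGaussian F) (φ := (R : F →L[ℝ] F)) (by fun_prop)
      (hcont.aestronglyMeasurable)
    rw [map_stdGaussian_eq M R hR] at e1
    rw [← e1, e2]
    simp
  rw [h1, integral_eq_lintegral_of_nonneg_ae
    (Eventually.of_forall fun z => mul_nonneg (h0 _) (Real.exp_pos _).le)
    (by fun_prop), integral_eq_lintegral_of_nonneg_ae (Eventually.of_forall h0)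
    hf.aestronglyMeasurable]
  have h2 := lintegral_ofReal_exp_mul (E := F)
    (G := fun z => ENNReal.ofReal (f (R z) * Real.exp (‖z‖ ^ 2 / 2))) (by fun_prop)
  have h3 := lintegral_comp_linearMap hdet (G := fun y => ENNReal.ofReal (f y)) (by fun_prop)
  -- The weight is the inverse of the Gaussian density up to normalisation, so Lebesgue measure
  -- remains.
  have e : ∀ z : F, ENNReal.ofReal (Real.exp (-‖z‖ ^ 2 / 2)) *
      ENNReal.ofReal (f (R z) * Real.exp (‖z‖ ^ 2 / 2)) = ENNReal.ofReal (f (R z)) := by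
    intro z
    rw [← ENNReal.ofReal_mul (Real.exp_pos _).le]
    congr 1
    rw [mul_left_comm, ← Real.exp_add, neg_div, neg_add_cancel, Real.exp_zero, mul_one]
  simp_rw [e] at h2
  have h4 := congrArg ENNReal.toReal h3
  have h5 := congrArg ENNReal.toReal h2
  rw [ENNReal.toReal_mul, ENNReal.toReal_ofReal (abs_nonneg _)] at h4
  rw [ENNReal.toReal_mul, ENNReal.toReal_ofReal gaussNorm_pos.le] at h5
  have hg := (gaussNorm_pos (E := F)).ne'
  have hd : |LinearMap.det (R : F →ₗ[ℝ] F)| ≠ 0 := abs_ne_zero.2 hdet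
  have h6 : (∫⁻ z, ENNReal.ofReal (f ((R : F →ₗ[ℝ] F) z))) = ∫⁻ z, ENNReal.ofReal (f (R z)) := rfl
  rw [h4, h6, h5]
  field_simp

/-- The local Brascamp--Lieb inequality for test functions, from a critical Gaussian. -/
theorem lintegral_closedBall_prod_le {ι : Type*} [Fintype ι] {F : ι → Type*}
    [∀ j, NormedAddCommGroup (F j)] [∀ j, InnerProductSpace ℝ (F j)]
    [∀ j, FiniteDimensional ℝ (F j)] [∀ j, MeasurableSpace (F j)] [∀ j, BorelSpace (F j)]
    {q : ι → ℝ} (hq : ∀ j, 0 ≤ q j) (L : ∀ j, E →L[ℝ] F j) (S : E ≃L[ℝ] E)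
    (R : ∀ j, F j ≃L[ℝ] F j)
    (hR : ∀ j, (R j : F j →L[ℝ] F j) ∘L ContinuousLinearMap.adjoint (R j : F j →L[ℝ] F j)
      = (L j ∘L (S : E →L[ℝ] E)) ∘L ContinuousLinearMap.adjoint (L j ∘L (S : E →L[ℝ] E)))
    (hcrit : ∀ y, ‖y‖ ^ 2 = ‖S y‖ ^ 2 + ∑ j, q j * ‖(R j).symm (L j (S y))‖ ^ 2)
    {f : ∀ j, F j → ℝ} (hf : ∀ j, ContDiff ℝ 2 (f j)) (hc : ∀ j, HasCompactSupport (f j))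
    (h0 : ∀ j y, 0 ≤ f j y) :
    ∫⁻ x in Metric.closedBall (0 : E) 1, ENNReal.ofReal (∏ j, f j (L j x) ^ q j)
      ≤ ENNReal.ofReal (Real.exp (1 / 2) * gaussNorm E * |LinearMap.det (S : E →ₗ[ℝ] E)| *
        ∏ j, (|LinearMap.det (R j : F j →ₗ[ℝ] F j)|⁻¹ * ∫ y, f j y) ^ q j) := by
  have hdet : LinearMap.det (S : E →ₗ[ℝ] E) ≠ 0 :=
    (LinearEquiv.isUnit_det' S.toLinearEquiv).ne_zero
  set M : ∀ j, E →L[ℝ] F j := fun j => L j ∘L (S : E →L[ℝ] E) with hMdef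
  set h : ∀ j, F j → ℝ := fun j y => f j y * Real.exp (‖(R j).symm y‖ ^ 2 / 2) with hh
  have hh0 : ∀ j y, 0 ≤ h j y := fun j y => mul_nonneg (h0 j y) (Real.exp_pos _).le
  have hhd : ∀ j, ContDiff ℝ 2 (h j) := fun j => by
    refine (hf j).mul (Real.contDiff_exp.comp (ContDiff.div_const ?_ _))
    exact ((R j).symm.contDiff).norm_sq ℝ
  have hhc : ∀ j, HasCompactSupport (h j) := fun j => (hc j).mul_right
  -- With s the sum on the left, ‖s‖² = ∑ q ⟨M* c, s⟩ = ∑ q ⟨R* c, R⁻¹ M s⟩ and ‖R* c‖ = ‖M* c‖. By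
  -- the arithmetic-geometric mean inequality and `hcrit`, ‖s‖² is at most half of ∑ q ‖M* c‖² plus
  -- half of ‖s‖².
  have hM : ∀ c : ∀ j, F j, ‖∑ j, q j • ContinuousLinearMap.adjoint (M j) (c j)‖ ^ 2
      ≤ ∑ j, q j * ‖ContinuousLinearMap.adjoint (M j) (c j)‖ ^ 2 := by
    intro c
    set s := ∑ j, q j • ContinuousLinearMap.adjoint (M j) (c j) with hs
    have hj : ∀ j, ⟪ContinuousLinearMap.adjoint (M j) (c j), s⟫ ≤
        (‖ContinuousLinearMap.adjoint (M j) (c j)‖ ^ 2 + ‖(R j).symm (M j s)‖ ^ 2) / 2 := by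
      intro j
      have e1 : ⟪ContinuousLinearMap.adjoint (M j) (c j), s⟫
          = ⟪ContinuousLinearMap.adjoint (R j : F j →L[ℝ] F j) (c j), (R j).symm (M j s)⟫ := by
        rw [ContinuousLinearMap.adjoint_inner_left, ContinuousLinearMap.adjoint_inner_left]
        simp
      have e2 : ‖ContinuousLinearMap.adjoint (M j) (c j)‖ ^ 2
          = ‖ContinuousLinearMap.adjoint (R j : F j →L[ℝ] F j) (c j)‖ ^ 2 := by
        rw [← real_inner_self_eq_norm_sq, ← real_inner_self_eq_norm_sq,
          ContinuousLinearMap.adjoint_inner_left, ContinuousLinearMap.adjoint_inner_left]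
        exact (congrArg (fun A : F j →L[ℝ] F j => ⟪c j, A (c j)⟫) (hR j)).symm
      rw [e1, e2]
      have h3 := real_inner_le_norm (ContinuousLinearMap.adjoint (R j : F j →L[ℝ] F j) (c j))
        ((R j).symm (M j s))
      nlinarith [sq_nonneg (‖ContinuousLinearMap.adjoint (R j : F j →L[ℝ] F j) (c j)‖
        - ‖(R j).symm (M j s)‖)]
    have h1 : ‖s‖ ^ 2 = ∑ j, q j * ⟪ContinuousLinearMap.adjoint (M j) (c j), s⟫ := by
      rw [← real_inner_self_eq_norm_sq]
      nth_rewrite 1 [hs]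
      simp only [sum_inner, real_inner_smul_left]
    have h2 : ‖s‖ ^ 2 ≤ ∑ j, q j * ((‖ContinuousLinearMap.adjoint (M j) (c j)‖ ^ 2
        + ‖(R j).symm (M j s)‖ ^ 2) / 2) := by
      rw [h1]
      exact Finset.sum_le_sum fun j _ => mul_le_mul_of_nonneg_left (hj j) (hq j)
    have h3 := hcrit s
    have h4 : ∑ j, q j * ((‖ContinuousLinearMap.adjoint (M j) (c j)‖ ^ 2
        + ‖(R j).symm (M j s)‖ ^ 2) / 2) =
        (∑ j, q j * ‖ContinuousLinearMap.adjoint (M j) (c j)‖ ^ 2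
        + ∑ j, q j * ‖(R j).symm (M j s)‖ ^ 2) / 2 := by
      rw [← Finset.sum_add_distrib, Finset.sum_div]
      exact Finset.sum_congr rfl fun j _ => by ring
    have h5 : ∑ j, q j * ‖(R j).symm (M j s)‖ ^ 2
        = ∑ j, q j * ‖(R j).symm (L j (S s))‖ ^ 2 := rfl
    nlinarith [sq_nonneg ‖S s‖]
  have hGH := integral_prod_rpow_comp_le hq M hM hhd hhc hh0
  have hE : ∀ j, ∫ z, h j (M j z) ∂(stdGaussian E)
      ≤ |LinearMap.det (R j : F j →ₗ[ℝ] F j)|⁻¹ * ∫ y, f j y := by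
    intro j
    rw [integral_stdGaussian_comp (M j) (R j) (hR j) (hf j).continuous (h0 j)]
    refine mul_le_of_le_one_left ?_ (inv_le_one_of_one_le₀ one_le_gaussNorm)
    exact mul_nonneg (by positivity) (integral_nonneg (h0 j))
  -- By `hcrit` the Gaussian density at z times all the weights is exp(-‖S z‖²/2), which on the unit
  -- ball is at least exp(-1/2). This gives the factor exp(1/2) in the constant.
  have hpw : ∀ z, S z ∈ Metric.closedBall (0 : E) 1 → ∏ j, f j (L j (S z)) ^ q j
      ≤ Real.exp (1 / 2) * (Real.exp (-‖z‖ ^ 2 / 2) * ∏ j, h j (M j z) ^ q j) := by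
    intro z hz
    have hz1 : ‖S z‖ ≤ 1 := by simpa using hz
    have e : ∏ j, h j (M j z) ^ q j = (∏ j, f j (L j (S z)) ^ q j) *
        Real.exp ((∑ j, q j * ‖(R j).symm (L j (S z))‖ ^ 2) / 2) := by
      rw [Finset.sum_div, Real.exp_sum, ← Finset.prod_mul_distrib]
      refine Finset.prod_congr rfl fun j _ => ?_
      simp only [hh, hMdef, ContinuousLinearMap.comp_apply, ContinuousLinearEquiv.coe_coe]
      rw [Real.mul_rpow (h0 j _) (Real.exp_pos _).le, ← Real.exp_mul]
      congr 2; ring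
    rw [e]
    have h1 : 0 ≤ ∏ j, f j (L j (S z)) ^ q j :=
      Finset.prod_nonneg fun j _ => Real.rpow_nonneg (h0 j _) _
    have h2 := hcrit z
    have h3 : Real.exp (1 / 2) * (Real.exp (-‖z‖ ^ 2 / 2) * ((∏ j, f j (L j (S z)) ^ q j) *
        Real.exp ((∑ j, q j * ‖(R j).symm (L j (S z))‖ ^ 2) / 2)))
        = (∏ j, f j (L j (S z)) ^ q j) * Real.exp ((1 - ‖S z‖ ^ 2) / 2) := by
      rw [show (1 - ‖S z‖ ^ 2) / 2 = 1 / 2 + (-‖z‖ ^ 2 / 2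
        + (∑ j, q j * ‖(R j).symm (L j (S z))‖ ^ 2) / 2) by linarith, Real.exp_add, Real.exp_add]
      ring
    rw [h3]
    refine le_mul_of_one_le_right h1 (Real.one_le_exp ?_)
    nlinarith [norm_nonneg (S z)]
  have hcontP : Continuous fun x => ∏ j, f j (L j x) ^ q j :=
    continuous_finsetProd _ fun j _ =>
      (Real.continuous_rpow_const (hq j)).comp ((hf j).continuous.comp (L j).continuous)
  have hcontH : Continuous fun z => ∏ j, h j (M j z) ^ q j :=
    continuous_finsetProd _ fun j _ =>
      (Real.continuous_rpow_const (hq j)).comp ((hhd j).continuous.comp (M j).continuous)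
  have hHint : Integrable (fun z => ∏ j, h j (M j z) ^ q j) (stdGaussian E) := by
    choose c hcb using fun j => (hhc j).exists_bound_of_continuous (hhd j).continuous
    refine integrable_of_continuous_of_bounded hcontH (c := ∏ j, c j ^ q j) fun z => ?_
    rw [abs_of_nonneg (Finset.prod_nonneg fun j _ => Real.rpow_nonneg (hh0 j _) _)]
    exact Finset.prod_le_prod (fun j _ => Real.rpow_nonneg (hh0 j _) _)
      fun j _ => Real.rpow_le_rpow (hh0 j _) ((le_abs_self _).trans (hcb j _)) (hq j)
  rw [← lintegral_indicator Metric.isClosed_closedBall.measurableSet,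
    lintegral_comp_linearMap hdet
      (hcontP.measurable.ennreal_ofReal.indicator Metric.isClosed_closedBall.measurableSet)]
  calc _ ≤ ENNReal.ofReal |LinearMap.det (S : E →ₗ[ℝ] E)| * ∫⁻ z,
        ENNReal.ofReal (Real.exp (1 / 2)) * (ENNReal.ofReal (Real.exp (-‖z‖ ^ 2 / 2))
          * ENNReal.ofReal (∏ j, h j (M j z) ^ q j)) := by
        gcongr with z
        by_cases hz : S z ∈ Metric.closedBall (0 : E) 1
        · refine (indicator_of_mem hz _).le.trans ?_
          rw [← ENNReal.ofReal_mul (Real.exp_pos _).le, ← ENNReal.ofReal_mul (Real.exp_pos _).le]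
          exact ENNReal.ofReal_le_ofReal (hpw z hz)
        · exact (indicator_of_notMem hz _).le.trans zero_le
    _ ≤ ENNReal.ofReal |LinearMap.det (S : E →ₗ[ℝ] E)| * (ENNReal.ofReal (Real.exp (1 / 2)) *
        (ENNReal.ofReal (gaussNorm E) * ENNReal.ofReal
          (∏ j, (|LinearMap.det (R j : F j →ₗ[ℝ] F j)|⁻¹ * ∫ y, f j y) ^ q j))) := by
        rw [lintegral_const_mul' _ _ ENNReal.ofReal_ne_top,
          lintegral_ofReal_exp_mul hcontH.measurable.ennreal_ofReal,
          ← ofReal_integral_eq_lintegral_ofReal hHint (Eventually.of_forall fun z =>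
            Finset.prod_nonneg fun j _ => Real.rpow_nonneg (hh0 j _) _)]
        gcongr
        refine hGH.trans (Finset.prod_le_prod (fun j _ => Real.rpow_nonneg
          (integral_nonneg fun z => hh0 j _) _) fun j _ => ?_)
        exact Real.rpow_le_rpow (integral_nonneg fun z => hh0 j _) (hE j) (hq j)
    _ = _ := by
        rw [← ENNReal.ofReal_mul gaussNorm_pos.le, ← ENNReal.ofReal_mul (Real.exp_pos _).le,
          ← ENNReal.ofReal_mul (abs_nonneg _)]
        congr 1; ring

end BrascampLieb

namespace BrascampLieb
open Filter Topology Module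
open scoped RealInnerProductSpace
set_option linter.unusedSectionVars false

/-! ### Greedy selection of independent subfamilies -/

section Greedy

variable {E : Type*} [AddCommGroup E] [Module ℝ E] [FiniteDimensional ℝ E]
  {ι : Type*} [DecidableEq ι]

lemma finrank_span_image_eq_card {v : ι → E} {I : Finset ι} (hI : LinearIndepOn ℝ v (I : Set ι)) :
    finrank ℝ (Submodule.span ℝ (v '' I)) = I.card := by
  have := finrank_span_eq_card (R := ℝ) hI.linearIndependent
  rw [Set.image_eq_range]
  simpa using this

/-- Indices are taken in decreasing order of `l`, each kept when its vector is independent of those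
before. A free base level `c` makes the induction an Abel summation: lowering the base from `l a` to
`c` adds (l a - c) ∑ p on the left and (l a - c) · |I'| on the right, and `hrank` compares these. -/
lemma exists_linearIndepOn_sum_le (v : ι → E) {p : ι → ℝ}
    (hrank : ∀ S : Finset ι, ∑ s ∈ S, p s ≤ finrank ℝ (Submodule.span ℝ (v '' S)))
    (l : ι → ℝ) (S : Finset ι) :
    ∃ I ⊆ S, LinearIndepOn ℝ v (I : Set ι) ∧
      Submodule.span ℝ (v '' I) = Submodule.span ℝ (v '' S) ∧
      ∀ c : ℝ, (∀ s ∈ S, c ≤ l s) → ∑ s ∈ S, p s * (l s - c) ≤ ∑ i ∈ I, (l i - c) := by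
  induction S using Finset.induction_on_min_value l with
  | empty => exact ⟨∅, by simp, by simp, by simp, by simp⟩
  | insert a S ha hmin ih =>
    obtain ⟨I, hIS, hind, hspan, hsum⟩ := ih
    have haI : a ∉ I := fun h => ha (hIS h)
    obtain ⟨I', hI'S, hind', hspan', hI'⟩ : ∃ I' ⊆ insert a S, LinearIndepOn ℝ v (I' : Set ι) ∧
        Submodule.span ℝ (v '' I') = Submodule.span ℝ (v '' (insert a S : Finset ι)) ∧
        ∑ i ∈ I', (l i - l a) = ∑ i ∈ I, (l i - l a) := by
      by_cases hmem : v a ∈ Submodule.span ℝ (v '' I)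
      · refine ⟨I, hIS.trans (Finset.subset_insert _ _), hind, ?_, rfl⟩
        rw [Finset.coe_insert, Set.image_insert_eq, Submodule.span_insert_eq_span (hspan ▸ hmem),
          hspan]
      · refine ⟨insert a I, Finset.insert_subset_insert _ hIS, ?_, ?_, ?_⟩
        · rw [Finset.coe_insert]; exact hind.insert hmem
        · rw [Finset.coe_insert, Finset.coe_insert, Set.image_insert_eq, Set.image_insert_eq,
            Submodule.span_insert, Submodule.span_insert, hspan]
        · rw [Finset.sum_insert haI]; simp
    refine ⟨I', hI'S, hind', hspan', fun c hc => ?_⟩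
    have hca : c ≤ l a := hc a (Finset.mem_insert_self _ _)
    have h1 := hsum (l a) hmin
    have h2 := hrank (insert a S)
    rw [← hspan', finrank_span_image_eq_card hind'] at h2
    have h3 : ∑ s ∈ insert a S, p s * (l s - c) = ∑ s ∈ S, p s * (l s - l a)
        + (l a - c) * ∑ s ∈ insert a S, p s := by
      have : ∑ s ∈ S, p s * (l s - l a) = ∑ s ∈ insert a S, p s * (l s - l a) := by
        rw [Finset.sum_insert ha]; simp
      rw [this, Finset.mul_sum, ← Finset.sum_add_distrib]
      exact Finset.sum_congr rfl fun s _ => by ring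
    have h4 : ∑ i ∈ I', (l i - c) = ∑ i ∈ I, (l i - l a) + (l a - c) * I'.card := by
      rw [← hI', mul_comm, ← nsmul_eq_mul, ← Finset.sum_const, ← Finset.sum_add_distrib]
      exact Finset.sum_congr rfl fun s _ => by ring
    rw [h3, h4]
    have := mul_le_mul_of_nonneg_left h2 (sub_nonneg.2 hca)
    linarith

/-- Factors with t < 1 are at most 1 and are dropped. The others fall under the greedy choice with l
= log t and base level 0. -/
lemma exists_linearIndepOn_prod_rpow_le [Fintype ι] (v : ι → E) {p : ι → ℝ} (hp : ∀ s, 0 ≤ p s)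
    (hrank : ∀ S : Finset ι, ∑ s ∈ S, p s ≤ finrank ℝ (Submodule.span ℝ (v '' S)))
    {t : ι → ℝ} (ht : ∀ s, 0 < t s) :
    ∃ I : Finset ι, LinearIndepOn ℝ v (I : Set ι) ∧ ∏ s, t s ^ p s ≤ ∏ i ∈ I, t i := by
  obtain ⟨I, -, hind, -, hsum⟩ := exists_linearIndepOn_sum_le v hrank (fun s => Real.log (t s))
    {s | 1 ≤ t s}
  refine ⟨I, hind, ?_⟩
  have h1 := hsum 0 fun s hs => Real.log_nonneg (by simpa using hs)
  simp only [sub_zero] at h1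
  have h2 : ∑ s, p s * Real.log (t s) ≤ ∑ s with 1 ≤ t s, p s * Real.log (t s) := by
    rw [← Finset.sum_filter_add_sum_filter_not Finset.univ (fun s => 1 ≤ t s)]
    have : ∑ s with ¬ 1 ≤ t s, p s * Real.log (t s) ≤ 0 := by
      refine Finset.sum_nonpos fun s hs => mul_nonpos_of_nonneg_of_nonpos (hp s) ?_
      have : t s < 1 := by simpa using hs
      exact Real.log_nonpos (ht s).le this.le
    linarith
  have h3 := Real.exp_le_exp.2 (h2.trans h1)
  rw [Real.exp_sum, Real.exp_sum] at h3
  refine (le_of_eq ?_).trans (h3.trans (le_of_eq ?_))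
  · exact Finset.prod_congr rfl fun s _ => by rw [Real.rpow_def_of_pos (ht s), mul_comm]
  · exact Finset.prod_congr rfl fun s _ => Real.exp_log (ht s)

end Greedy

/-! ### Determinant bounds -/

section Det

open Matrix

/-- Each rank-one update multiplies the determinant by 1 + xᵀ Q⁻¹ x ≥ 1. -/
lemma det_le_det_add_sum_vecMulVec {n κ : Type*} [Fintype n] [DecidableEq n] [DecidableEq κ]
    {P : Matrix n n ℝ} (hP : P.PosDef) (t : Finset κ) (x : κ → n → ℝ) :
    P.det ≤ (P + ∑ s ∈ t, vecMulVec (x s) (x s)).det := by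
  have hpos : ∀ t : Finset κ, (P + ∑ s ∈ t, vecMulVec (x s) (x s)).PosDef := fun t =>
    hP.add_posSemidef (posSemidef_sum _ fun s _ => by
      simpa using posSemidef_vecMulVec_self_star (x s))
  induction t using Finset.induction_on with
  | empty => simp
  | insert a t ha ih =>
    refine ih.trans ?_
    set Q := P + ∑ s ∈ t, vecMulVec (x s) (x s) with hQ
    have hQpos : Q.PosDef := hpos t
    rw [Finset.sum_insert ha, add_comm (vecMulVec _ _), ← add_assoc, ← hQ,
      vecMulVec_eq Unit, det_add_replicateCol_mul_replicateRow hQpos.det_pos.ne'.isUnit]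
    refine le_mul_of_one_le_right hQpos.det_pos.le ?_
    rw [det_unique]
    have h1 := hQpos.inv.posSemidef.dotProduct_mulVec_nonneg (x a)
    have h2 : (replicateRow Unit (x a) * Q⁻¹ * replicateCol Unit (x a)) default default
        = x a ⬝ᵥ (Q⁻¹ *ᵥ x a) := by
      rw [Matrix.mul_assoc]
      simp [Matrix.mul_apply, dotProduct, mulVec]
    rw [Matrix.add_apply, Matrix.one_apply_eq, h2]
    simpa using h1

variable {E : Type*} [NormedAddCommGroup E] [InnerProductSpace ℝ E] [FiniteDimensional ℝ E]
  {ι : Type*} [Fintype ι] [DecidableEq ι]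

/-- The determinant of `1 + ∑ uₛ ⊗ uₛ` dominates the Gram determinants of all subfamilies of `u`. -/
lemma det_gram_le_det_one_add_sum_rankOne (u : ι → E) (I : Finset ι)
    (hI : LinearIndepOn ℝ u (I : Set ι)) :
    (gram ℝ fun i : I => u i).det
      ≤ LinearMap.det ((1 + ∑ s, InnerProductSpace.rankOne ℝ (u s) (u s) : E →L[ℝ] E) : E →ₗ[ℝ] E)
      := by
  set b := stdOrthonormalBasis ℝ E
  set x : ι → Fin (finrank ℝ E) → ℝ := fun s k => ⟪b k, u s⟫ with hx
  have h1 : LinearMap.toMatrix b.toBasis b.toBasis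
      ((1 + ∑ s, InnerProductSpace.rankOne ℝ (u s) (u s) : E →L[ℝ] E) : E →ₗ[ℝ] E)
      = 1 + ∑ s, vecMulVec (x s) (x s) := by
    ext k l
    simp only [ContinuousLinearMap.toLinearMap_add, map_add, Matrix.add_apply]
    congr 1
    · simp
    · simp [LinearMap.toMatrix_apply, Matrix.sum_apply, vecMulVec_apply, hx, b.repr_apply_apply,
        real_inner_comm, mul_comm]
  have h2 : (gram ℝ fun i : I => u i).PosDef := posDef_gram_of_linearIndependent hI
  have h3 : (gram ℝ fun i : I => u i).det ≤ (1 + gram ℝ fun i : I => u i).det := by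
    have := det_le_det_add_sum_vecMulVec h2 Finset.univ fun i : I => Pi.single i 1
    convert this using 2
    rw [add_comm]
    congr 1
    ext i j
    simp [Matrix.sum_apply, vecMulVec_apply, Pi.single_apply, Matrix.one_apply]
  -- Sylvester's identity det(1 + XᵀX) = det(1 + XXᵀ) passes from the Gram matrix to the operator.
  have h4 : (1 + gram ℝ fun i : I => u i).det = (1 + ∑ s ∈ I, vecMulVec (x s) (x s)).det := by
    set X : Matrix (Fin (finrank ℝ E)) I ℝ := Matrix.of fun k i => x i k with hX
    have e1 : 1 + ∑ s ∈ I, vecMulVec (x s) (x s) = 1 + X * Xᵀ := by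
      congr 1
      ext k l
      rw [Matrix.sum_apply, ← Finset.sum_coe_sort I, Matrix.mul_apply]
      simp [hX, vecMulVec_apply]
    have e2 : (gram ℝ fun i : I => u i) = Xᵀ * X := by
      ext i j
      rw [Matrix.mul_apply, gram_apply, ← b.sum_inner_mul_inner]
      simp [hX, hx, real_inner_comm]
    rw [e1, e2, det_one_add_mul_comm]
  have h5 : (1 + ∑ s ∈ I, vecMulVec (x s) (x s)).det ≤ (1 + ∑ s, vecMulVec (x s) (x s)).det := by
    have hpos : (1 + ∑ s ∈ I, vecMulVec (x s) (x s)).PosDef :=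
      PosDef.one.add_posSemidef (posSemidef_sum _ fun s _ => by
        simpa using posSemidef_vecMulVec_self_star (x s))
    have := det_le_det_add_sum_vecMulVec hpos Iᶜ x
    rwa [add_assoc, Finset.sum_add_sum_compl] at this
  rw [← LinearMap.det_toMatrix b.toBasis, h1]
  linarith

end Det

end BrascampLieb

/-! ### Determinant bounds uniform near a datum that satisfies the rank condition. -/

namespace BrascampLieb
open Filter Topology Module Matrix
open scoped RealInnerProductSpace
set_option linter.unusedSectionVars false

variable {E : Type*} [NormedAddCommGroup E] [InnerProductSpace ℝ E] [FiniteDimensional ℝ E]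

lemma det_gram_sqrt_smul {κ : Type*} [Fintype κ] [DecidableEq κ] {t : κ → ℝ} (ht : ∀ s, 0 < t s)
    (v : κ → E) :
    (gram ℝ fun s => √(t s) • v s).det = (∏ s, t s) * (gram ℝ v).det := by
  have h1 : (gram ℝ fun s => √(t s) • v s)
      = Matrix.of fun i j => √(t j) * (Matrix.of fun i j => √(t i) * gram ℝ v i j) i j := by
    ext i j
    simp [inner_smul_left, inner_smul_right]
  rw [h1, det_mul_row, det_mul_column, ← mul_assoc, ← Finset.prod_mul_distrib]
  congr 1
  exact Finset.prod_congr rfl fun s _ => Real.mul_self_sqrt (ht s).le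

/-- The independent set `I` depends on `t`, but it is chosen at `x₀` from finitely many candidates.
Their Gram determinants exceed a common c > 0 at `x₀`, hence nearby, so neither c nor the
neighbourhood depends on `t`, and the rank condition is needed only at `x₀`. -/
lemma exists_uniform_det_bound_local {X ι : Type*} [TopologicalSpace X] [Fintype ι]
    [DecidableEq ι] {v : X → ι → E} (hv : ∀ s, Continuous fun x => v x s) {p : ι → ℝ}
    (hp : ∀ s, 0 ≤ p s) (x₀ : X)
    (hrank : ∀ S : Finset ι, ∑ s ∈ S, p s ≤ finrank ℝ (Submodule.span ℝ (v x₀ '' S))) :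
    ∃ c : ℝ, 0 < c ∧ ∀ᶠ x in 𝓝 x₀, ∀ t : ι → ℝ, (∀ s, 0 < t s) →
      c * ∏ s, t s ^ p s ≤ LinearMap.det
        ((1 + ∑ s, t s • InnerProductSpace.rankOne ℝ (v x s) (v x s) : E →L[ℝ] E) : E →ₗ[ℝ] E) := by
  set G : Finset ι → X → ℝ := fun I x => (gram ℝ fun i : I => v x i).det with hG
  have hGc : ∀ I, Continuous (G I) := fun I => by
    refine Continuous.matrix_det ?_
    exact continuous_matrix fun i j => (hv i).inner (hv j)
  have hpos : ∀ I : Finset ι, LinearIndepOn ℝ (v x₀) (I : Set ι) → 0 < G I x₀ := fun I hI =>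
    (posDef_gram_of_linearIndependent (v := fun i : I => v x₀ i) hI).det_pos
  obtain ⟨c, hcI, hc0⟩ : ∃ c : ℝ, (∀ I : Finset ι, LinearIndepOn ℝ (v x₀) (I : Set ι) → c < G I x₀)
      ∧ 0 < c := by
    have h1 : ∀ᶠ c : ℝ in 𝓝[>] 0, ∀ I : Finset ι,
        LinearIndepOn ℝ (v x₀) (I : Set ι) → c < G I x₀ := by
      refine eventually_all.2 fun I => ?_
      by_cases hI : LinearIndepOn ℝ (v x₀) (I : Set ι)
      · filter_upwards [mem_nhdsWithin_of_mem_nhds (Iio_mem_nhds (hpos I hI))] with c hc _ using hc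
      · exact Eventually.of_forall fun c h => absurd h hI
    exact (h1.and self_mem_nhdsWithin).exists
  refine ⟨c, hc0, ?_⟩
  have h2 : ∀ᶠ x in 𝓝 x₀, ∀ I : Finset ι, LinearIndepOn ℝ (v x₀) (I : Set ι) → c < G I x := by
    refine eventually_all.2 fun I => ?_
    by_cases hI : LinearIndepOn ℝ (v x₀) (I : Set ι)
    · filter_upwards [(hGc I).continuousAt.eventually_const_lt (hcI I hI)] with x hx _ using hx
    · exact Eventually.of_forall fun c h => absurd h hI
  filter_upwards [h2] with x hx t ht
  obtain ⟨I, hI, hle⟩ := exists_linearIndepOn_prod_rpow_le (v x₀) hp hrank ht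
  have hGI := hx I hI
  have hgram : (gram ℝ fun i : I => √(t i) • v x i).det = (∏ i ∈ I, t i) * G I x := by
    rw [det_gram_sqrt_smul (fun s : I => ht s) (fun i : I => v x i), Finset.prod_coe_sort I t]
  have hprod : 0 < ∏ i ∈ I, t i := Finset.prod_pos fun i _ => ht i
  have hind : LinearIndepOn ℝ (fun s => √(t s) • v x s) (I : Set ι) := by
    apply linearIndependent_of_det_gram_ne_zero (𝕜 := ℝ) (v := fun i : I => √(t i) • v x i)
    rw [hgram]
    exact (mul_pos hprod (hc0.trans hGI)).ne'
  have h3 := det_gram_le_det_one_add_sum_rankOne (fun s => √(t s) • v x s) I hind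
  rw [hgram] at h3
  have h4 : ∀ s, InnerProductSpace.rankOne ℝ (√(t s) • v x s) (√(t s) • v x s)
      = t s • InnerProductSpace.rankOne ℝ (v x s) (v x s) := by
    intro s
    ext z
    simp only [InnerProductSpace.rankOne_apply, real_inner_smul_left, smul_smul,
      _root_.smul_apply]
    congr 1
    rw [mul_right_comm, Real.mul_self_sqrt (ht s).le]
  simp_rw [h4] at h3
  refine le_trans ?_ h3
  rw [mul_comm]
  exact mul_le_mul hle hGI.le hc0.le hprod.le

variable {m : Type*} [Fintype m] [DecidableEq m] {F : m → Type*}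
  [∀ j, NormedAddCommGroup (F j)] [∀ j, InnerProductSpace ℝ (F j)]
  [∀ j, FiniteDimensional ℝ (F j)]

/-- The vectors `Lⱼ* eⱼₖ` attached to families `eⱼ` of vectors in the target spaces. -/
noncomputable def pullbackVec (L : ∀ j, E →L[ℝ] F j) (e : ∀ j, Fin (finrank ℝ (F j)) → F j)
    (s : Σ j, Fin (finrank ℝ (F j))) : E :=
  ContinuousLinearMap.adjoint (L s.1) (e s.1 s.2)

/-- The rank condition for Brascamp--Lieb data, tested on orthonormal families. -/
def RankCondition (L : ∀ j, E →L[ℝ] F j) (p : m → ℝ) : Prop :=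
  ∀ e : ∀ j, Fin (finrank ℝ (F j)) → F j, (∀ j, Orthonormal ℝ (e j)) →
    ∀ S : Finset (Σ j, Fin (finrank ℝ (F j))),
      ∑ s ∈ S, p s.1 ≤ finrank ℝ (Submodule.span ℝ (pullbackVec L e '' S))

lemma isCompact_setOf_orthonormal :
    IsCompact {e : ∀ j, Fin (finrank ℝ (F j)) → F j | ∀ j, Orthonormal ℝ (e j)} := by
  refine Metric.isCompact_of_isClosed_isBounded ?_ ?_
  · simp only [orthonormal_iff_ite, Set.ofPred_forall]
    refine isClosed_iInter fun j => isClosed_iInter fun i => isClosed_iInter fun k => ?_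
    exact isClosed_eq (by fun_prop) continuous_const
  · refine isBounded_iff_forall_norm_le.2 ⟨1, fun e he => ?_⟩
    refine (pi_norm_le_iff_of_nonneg zero_le_one).2 fun j =>
      (pi_norm_le_iff_of_nonneg zero_le_one).2 fun k => ((he j).1 k).le

/-- The local bound is applied at each point (L₀, e₀) of the product, and compactness of the set of
orthonormal families leaves a single c and a single neighbourhood of `L₀`. -/
theorem RankCondition.exists_uniform_det_bound {L₀ : ∀ j, E →L[ℝ] F j} {p : m → ℝ}
    (hrank : RankCondition L₀ p) (hp : ∀ j, 0 ≤ p j) :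
    ∃ c : ℝ, 0 < c ∧ ∀ᶠ L in 𝓝 L₀, ∀ e : ∀ j, Fin (finrank ℝ (F j)) → F j,
      (∀ j, Orthonormal ℝ (e j)) → ∀ t : (Σ j, Fin (finrank ℝ (F j))) → ℝ, (∀ s, 0 < t s) →
      c * ∏ s, t s ^ p s.1 ≤ LinearMap.det ((1 + ∑ s, t s • InnerProductSpace.rankOne ℝ
        (pullbackVec L e s) (pullbackVec L e s) : E →L[ℝ] E) : E →ₗ[ℝ] E) := by
  refine isCompact_setOf_orthonormal.induction_on (p := fun A => ∃ c : ℝ, 0 < c ∧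
    ∀ᶠ L in 𝓝 L₀, ∀ e ∈ A, ∀ t : (Σ j, Fin (finrank ℝ (F j))) → ℝ, (∀ s, 0 < t s) →
      c * ∏ s, t s ^ p s.1 ≤ LinearMap.det ((1 + ∑ s, t s • InnerProductSpace.rankOne ℝ
        (pullbackVec L e s) (pullbackVec L e s) : E →L[ℝ] E) : E →ₗ[ℝ] E)) ?_ ?_ ?_ ?_
  · exact ⟨1, one_pos, by simp⟩
  · rintro A B hAB ⟨c, hc, h⟩
    exact ⟨c, hc, h.mono fun L hL e he => hL e (hAB he)⟩
  · rintro A B ⟨c, hc, h⟩ ⟨c', hc', h'⟩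
    refine ⟨min c c', lt_min hc hc', ?_⟩
    filter_upwards [h, h'] with L hL hL' e he t ht
    have hP : 0 ≤ ∏ s, t s ^ p s.1 := Finset.prod_nonneg fun s _ => Real.rpow_nonneg (ht s).le _
    rcases he with he | he
    · exact (mul_le_mul_of_nonneg_right (min_le_left _ _) hP).trans (hL e he t ht)
    · exact (mul_le_mul_of_nonneg_right (min_le_right _ _) hP).trans (hL' e he t ht)
  · intro e₀ he₀
    have hcont : ∀ s, Continuous fun x : (∀ j, E →L[ℝ] F j) ×
        (∀ j, Fin (finrank ℝ (F j)) → F j) => pullbackVec x.1 x.2 s := by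
      intro s
      have h1 : Continuous fun x : (∀ j, E →L[ℝ] F j) × (∀ j, Fin (finrank ℝ (F j)) → F j) =>
          ContinuousLinearMap.adjoint (x.1 s.1) :=
        (LinearIsometryEquiv.continuous _).comp (by fun_prop)
      exact h1.clm_apply (by fun_prop)
    obtain ⟨c, hc, h⟩ := exists_uniform_det_bound_local hcont (p := fun s => p s.1)
      (fun s => hp s.1) (L₀, e₀) (hrank e₀ he₀)
    rw [nhds_prod_eq] at h
    obtain ⟨P, hP, Q, hQ, hPQ⟩ := eventually_prod_iff.1 h
    exact ⟨{e | Q e}, mem_nhdsWithin_of_mem_nhds hQ, c, hc, hP.mono fun L hL e he => hPQ hL he⟩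

end BrascampLieb

/-! ### Covariance operators and the uniform Gaussian bound. -/

namespace BrascampLieb
open Filter Topology Module
open scoped RealInnerProductSpace
set_option linter.unusedSectionVars false

variable {E : Type*} [NormedAddCommGroup E] [InnerProductSpace ℝ E] [FiniteDimensional ℝ E]
  {F : Type*} [NormedAddCommGroup F] [InnerProductSpace ℝ F] [FiniteDimensional ℝ F]

lemma det_adjoint (A : E →L[ℝ] E) : (ContinuousLinearMap.adjoint A).det = A.det := by
  set b := stdOrthonormalBasis ℝ E
  rw [ContinuousLinearMap.det, ContinuousLinearMap.det, ← LinearMap.det_toMatrix b.toBasis,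
    ← LinearMap.det_toMatrix b.toBasis (A : E →ₗ[ℝ] E), ← Matrix.det_transpose]
  congr 1
  ext i j
  simp [LinearMap.toMatrix_apply, b.repr_apply_apply, ContinuousLinearMap.adjoint_inner_right,
    real_inner_comm]

lemma det_comp (A B : E →L[ℝ] E) : (A ∘L B).det = A.det * B.det :=
  LinearMap.det_comp _ _

/-- The operator `A A*`, i.e. the covariance of the image of a standard Gaussian under `A`. -/
noncomputable def covOp (A : E →L[ℝ] F) : F →L[ℝ] F := A ∘L ContinuousLinearMap.adjoint A

lemma isPositive_covOp (A : E →L[ℝ] F) : (covOp A).IsPositive :=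
  ContinuousLinearMap.isPositive_self_comp_adjoint A

lemma inner_covOp (A : E →L[ℝ] F) (y : F) :
    ⟪covOp A y, y⟫ = ‖ContinuousLinearMap.adjoint A y‖ ^ 2 := by
  rw [covOp, ContinuousLinearMap.comp_apply, ← ContinuousLinearMap.adjoint_inner_right,
    real_inner_self_eq_norm_sq]

lemma det_nonneg_of_isPositive {T : E →L[ℝ] E} (hT : T.IsPositive) : 0 ≤ T.det := by
  rw [ContinuousLinearMap.det, hT.isSymmetric.det_eq_prod_eigenvalues rfl]
  exact Finset.prod_nonneg fun i _ => hT.toLinearMap.nonneg_eigenvalues rfl i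

lemma eigenvalues_pos_of_det_ne_zero {T : E →L[ℝ] E} (hT : T.IsPositive) (h : T.det ≠ 0)
    (i : Fin (finrank ℝ E)) : 0 < hT.isSymmetric.eigenvalues rfl i := by
  refine lt_of_le_of_ne (hT.toLinearMap.nonneg_eigenvalues rfl i) fun h0 => h ?_
  rw [ContinuousLinearMap.det, hT.isSymmetric.det_eq_prod_eigenvalues rfl]
  exact Finset.prod_eq_zero (Finset.mem_univ i) (by simpa using h0.symm)

/-- The squared Hilbert--Schmidt norm. -/
noncomputable def hsSq (S : E →L[ℝ] E) : ℝ := ∑ i, ‖S (stdOrthonormalBasis ℝ E i)‖ ^ 2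

lemma hsSq_nonneg (S : E →L[ℝ] E) : 0 ≤ hsSq S := Finset.sum_nonneg fun i _ => by positivity

/-- Each eigenvalue satisfies μ ≤ 2 exp(μ/2). The factor 1/2 in the exponent leaves room for decay
against the weight exp(-`hsSq`) of the Gaussian functional. -/
lemma det_le_exp_trace {T : E →L[ℝ] E} (hT : T.IsPositive) :
    T.det ≤ 2 ^ finrank ℝ E * Real.exp ((∑ i, ⟪stdOrthonormalBasis ℝ E i,
      T (stdOrthonormalBasis ℝ E i)⟫) / 2) := by
  have h1 := LinearMap.trace_eq_sum_inner (T : E →ₗ[ℝ] E) (stdOrthonormalBasis ℝ E)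
  have h2 := hT.isSymmetric.trace_eq_sum_eigenvalues rfl
  have h3 : ∑ i, ⟪stdOrthonormalBasis ℝ E i, T (stdOrthonormalBasis ℝ E i)⟫
      = ∑ i, hT.isSymmetric.eigenvalues rfl i := by
    rw [h1] at h2; exact_mod_cast h2
  rw [h3, Finset.sum_div, Real.exp_sum, ContinuousLinearMap.det,
    hT.isSymmetric.det_eq_prod_eigenvalues rfl]
  have h4 : (2 : ℝ) ^ finrank ℝ E = ∏ _i : Fin (finrank ℝ E), (2 : ℝ) := by simp
  rw [h4, ← Finset.prod_mul_distrib]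
  refine Finset.prod_le_prod (fun i _ => hT.toLinearMap.nonneg_eigenvalues rfl i) fun i _ => ?_
  have := Real.add_one_le_exp (hT.isSymmetric.eigenvalues rfl i / 2)
  simp only [RCLike.ofReal_real_eq_id, id_eq]
  linarith

/-- A positive definite operator is of the form `R R*` with `R` invertible. -/
lemma exists_comp_adjoint_eq {T : E →L[ℝ] E} (hT : T.IsPositive) (h : T.det ≠ 0) :
    ∃ R : E ≃L[ℝ] E, (R : E →L[ℝ] E) ∘L ContinuousLinearMap.adjoint (R : E →L[ℝ] E) = T := by
  set e := hT.isSymmetric.eigenvectorBasis rfl with he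
  set μ := hT.isSymmetric.eigenvalues rfl with hμ
  set R₀ : E →L[ℝ] E := ∑ k, √(μ k) • InnerProductSpace.rankOne ℝ (e k) (e k) with hR₀
  have hadj : ContinuousLinearMap.adjoint R₀ = R₀ := by
    simp [hR₀, map_sum]
  have hRe : ∀ k, R₀ (e k) = √(μ k) • e k := by
    intro k
    simp only [hR₀, _root_.sum_apply, smul_apply,
      InnerProductSpace.rankOne_apply]
    rw [Finset.sum_eq_single k]
    · simp
    · intro i _ hik
      simp [e.inner_eq_zero hik]
    · simp
  have hRR : R₀ ∘L ContinuousLinearMap.adjoint R₀ = T := by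
    rw [hadj]
    apply ContinuousLinearMap.coe_injective
    refine e.toBasis.ext fun k => ?_
    have h1 := hT.isSymmetric.apply_eigenvectorBasis rfl k
    simp only [OrthonormalBasis.coe_toBasis, ContinuousLinearMap.coe_coe,
      ContinuousLinearMap.comp_apply, hRe, map_smul, smul_smul] at h1 ⊢
    rw [Real.mul_self_sqrt (hT.toLinearMap.nonneg_eigenvalues rfl k)]
    exact h1.symm
  have hdet : LinearMap.det (R₀ : E →ₗ[ℝ] E) ≠ 0 := by
    intro h0
    apply h
    rw [← hRR, det_comp, ContinuousLinearMap.det, h0, zero_mul]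
  refine ⟨((R₀ : E →ₗ[ℝ] E).equivOfDetNeZero hdet).toContinuousLinearEquiv, ?_⟩
  have : ((((R₀ : E →ₗ[ℝ] E).equivOfDetNeZero hdet).toContinuousLinearEquiv : E ≃L[ℝ] E)
      : E →L[ℝ] E) = R₀ := by ext x; rfl
  rw [this, hRR]

lemma det_covOp_ne_zero_iff (A : E →L[ℝ] F) :
    (covOp A).det ≠ 0 ↔ Function.Surjective A := by
  constructor
  · intro h y
    obtain ⟨x, hx⟩ := ((covOp A : F →ₗ[ℝ] F).equivOfDetNeZero h).surjective y
    exact ⟨ContinuousLinearMap.adjoint A x, hx⟩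
  · intro h h0
    obtain ⟨y, hy, hy0⟩ := Submodule.exists_mem_ne_zero_of_ne_bot
      (LinearMap.bot_lt_ker_of_det_eq_zero h0).ne'
    have h1 : ContinuousLinearMap.adjoint A y = 0 := by
      have := inner_covOp A y
      have h2 : covOp A y = 0 := hy
      rw [h2, inner_zero_left] at this
      exact norm_eq_zero.1 (pow_eq_zero_iff (two_ne_zero)|>.1 this.symm)
    obtain ⟨x, rfl⟩ := h y
    apply hy0
    rw [← inner_self_eq_zero (𝕜 := ℝ), ← ContinuousLinearMap.adjoint_inner_right, h1,
      inner_zero_right]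

variable {m : Type*} [Fintype m] [DecidableEq m] {F : m → Type*}
  [∀ j, NormedAddCommGroup (F j)] [∀ j, InnerProductSpace ℝ (F j)]
  [∀ j, FiniteDimensional ℝ (F j)]

/-- The uniform bound for the Gaussian Brascamp--Lieb functional. -/
theorem RankCondition.exists_uniform_gaussian_bound {L₀ : ∀ j, E →L[ℝ] F j} {p : m → ℝ}
    (hrank : RankCondition L₀ p) (hp : ∀ j, 0 ≤ p j) :
    ∃ C : ℝ, 0 < C ∧ ∀ᶠ L in 𝓝 L₀, ∀ S : E →L[ℝ] E, (∀ j, (covOp (L j ∘L S)).det ≠ 0) →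
      S.det ^ 2 ≤ C * (∏ j, (covOp (L j ∘L S)).det ^ p j) * Real.exp (hsSq S / 2) := by
  obtain ⟨c, hc, h⟩ := hrank.exists_uniform_det_bound hp
  refine ⟨c⁻¹ * (2 ^ finrank ℝ E *
    Real.exp (Fintype.card (Σ j, Fin (finrank ℝ (F j))) / 2)), by positivity, ?_⟩
  filter_upwards [h] with L hL S hS
  have hpos := fun j => isPositive_covOp (L j ∘L S)
  set e : ∀ j, Fin (finrank ℝ (F j)) → F j := fun j k =>
    (hpos j).isSymmetric.eigenvectorBasis rfl k with he
  set μ : (Σ j, Fin (finrank ℝ (F j))) → ℝ := fun s =>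
    (hpos s.1).isSymmetric.eigenvalues rfl s.2 with hμ
  have hμ0 : ∀ s, 0 < μ s := fun s => eigenvalues_pos_of_det_ne_zero (hpos s.1) (hS s.1) s.2
  have horth : ∀ j, Orthonormal ℝ (e j) := fun j =>
    ((hpos j).isSymmetric.eigenvectorBasis rfl).orthonormal
  -- Eigenvectors and inverse eigenvalues of the covariances make ∏ t^p the inverse of ∏ det^p.
  set t : (Σ j, Fin (finrank ℝ (F j))) → ℝ := fun s => (μ s)⁻¹ with ht
  have ht0 : ∀ s, 0 < t s := fun s => inv_pos.2 (hμ0 s)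
  have h1 := hL e horth t ht0
  set v := pullbackVec L e with hv
  set T : E →L[ℝ] E := 1 + ∑ s, t s • InnerProductSpace.rankOne ℝ (v s) (v s) with hT
  have hTpos : T.IsPositive := by
    refine ContinuousLinearMap.isPositive_one.add ?_
    refine ContinuousLinearMap.isPositive_sum _ fun s _ => ?_
    exact (InnerProductSpace.isPositive_rankOne_self (v s)).smul_of_nonneg (ht0 s).le
  have hprod : ∏ s, t s ^ p s.1 = (∏ j, (covOp (L j ∘L S)).det ^ p j)⁻¹ := by
    rw [← Finset.prod_inv_distrib, Fintype.prod_sigma]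
    refine Finset.prod_congr rfl fun j _ => ?_
    rw [ContinuousLinearMap.det, (hpos j).isSymmetric.det_eq_prod_eigenvalues rfl]
    simp only [RCLike.ofReal_real_eq_id, id_eq]
    rw [← Real.finsetProd_rpow _ _ fun k _ => (hμ0 ⟨j, k⟩).le, ← Finset.prod_inv_distrib]
    refine Finset.prod_congr rfl fun k _ => ?_
    exact Real.inv_rpow (hμ0 ⟨j, k⟩).le _
  have hD : 0 < ∏ j, (covOp (L j ∘L S)).det ^ p j := Finset.prod_pos fun j _ =>
    Real.rpow_pos_of_pos (lt_of_le_of_ne (det_nonneg_of_isPositive (hpos j)) (hS j).symm) _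
  set b := stdOrthonormalBasis ℝ E with hb
  have hPpos : (ContinuousLinearMap.adjoint S ∘L T ∘L S).IsPositive := hTpos.adjoint_conj S
  have h2 := det_le_exp_trace hPpos
  rw [det_comp, det_comp, det_adjoint] at h2
  -- Each index contributes t ‖S* v‖² = μ⁻¹ μ = 1 to the trace of S* T S, so only `hsSq S` depends
  -- on `S`.
  have htr : ∑ i, ⟪b i, (ContinuousLinearMap.adjoint S ∘L T ∘L S) (b i)⟫
      = hsSq S + Fintype.card (Σ j, Fin (finrank ℝ (F j))) := by
    have e1 : ∀ i, ⟪b i, (ContinuousLinearMap.adjoint S ∘L T ∘L S) (b i)⟫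
        = ‖S (b i)‖ ^ 2 + ∑ s, t s * ⟪ContinuousLinearMap.adjoint S (v s), b i⟫ ^ 2 := by
      intro i
      simp only [ContinuousLinearMap.comp_apply, ContinuousLinearMap.adjoint_inner_right,
        ContinuousLinearMap.adjoint_inner_left, hT, add_apply, one_apply_eq_self,
        _root_.sum_apply, smul_apply, InnerProductSpace.rankOne_apply, inner_add_right,
        inner_sum, inner_smul_right, real_inner_self_eq_norm_sq]
      congr 1
      refine Finset.sum_congr rfl fun s _ => ?_
      rw [real_inner_comm (v s), sq]
    have e2 : ∀ s, ∑ i, ⟪ContinuousLinearMap.adjoint S (v s), b i⟫ ^ 2 = μ s := by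
      intro s
      rw [b.sum_sq_inner_left]
      have e3 : ContinuousLinearMap.adjoint S (v s)
          = ContinuousLinearMap.adjoint (L s.1 ∘L S) (e s.1 s.2) := by
        rw [ContinuousLinearMap.adjoint_comp]; rfl
      have e4 := (hpos s.1).isSymmetric.apply_eigenvectorBasis rfl s.2
      have e5 := (horth s.1).1 s.2
      rw [e3, ← inner_covOp]
      rw [ContinuousLinearMap.coe_coe] at e4
      simp only [he] at e5 ⊢
      rw [e4, real_inner_smul_left, real_inner_self_eq_norm_sq, e5]
      simp [hμ]
    simp_rw [e1]
    rw [Finset.sum_add_distrib, Finset.sum_comm]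
    simp_rw [← Finset.mul_sum, e2]
    congr 1
    simp [ht, (hμ0 _).ne']
  rw [htr, add_div, Real.exp_add] at h2
  rw [hprod] at h1
  change c * _ ≤ T.det at h1
  have h3 : S.det ^ 2 * (c * (∏ j, (covOp (L j ∘L S)).det ^ p j)⁻¹) ≤ S.det ^ 2 * T.det :=
    mul_le_mul_of_nonneg_left h1 (sq_nonneg _)
  have h4 := h3.trans (le_trans (le_of_eq (by ring)) h2)
  have h5 : S.det ^ 2 = (S.det ^ 2 * (c * (∏ j, (covOp (L j ∘L S)).det ^ p j)⁻¹)) *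
      (c⁻¹ * (∏ j, (covOp (L j ∘L S)).det ^ p j)) := by
    field_simp
  rw [h5]
  refine (mul_le_mul_of_nonneg_right h4 (by positivity)).trans (le_of_eq ?_)
  ring

end BrascampLieb

/-! ### The Gaussian functional and its variations. -/

namespace BrascampLieb
open Filter Topology Module
open scoped RealInnerProductSpace
set_option linter.unusedSectionVars false

variable {E : Type*} [NormedAddCommGroup E] [InnerProductSpace ℝ E] [FiniteDimensional ℝ E]

lemma det_one_add_smul_rankOne (τ : ℝ) (z : E) :
    (1 + τ • InnerProductSpace.rankOne ℝ z z : E →L[ℝ] E).det = 1 + τ * ‖z‖ ^ 2 := by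
  set b := stdOrthonormalBasis ℝ E
  set x : Fin (finrank ℝ E) → ℝ := fun k => ⟪b k, z⟫ with hx
  rw [ContinuousLinearMap.det, ← LinearMap.det_toMatrix b.toBasis]
  have h1 : LinearMap.toMatrix b.toBasis b.toBasis
      ((1 + τ • InnerProductSpace.rankOne ℝ z z : E →L[ℝ] E) : E →ₗ[ℝ] E)
      = 1 + Matrix.replicateCol Unit (τ • x) * Matrix.replicateRow Unit x := by
    ext k l
    simp only [ContinuousLinearMap.toLinearMap_add, map_add, Matrix.add_apply]
    congr 1
    · simp
    · simp [LinearMap.toMatrix_apply, Matrix.mul_apply, hx, b.repr_apply_apply,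
        real_inner_comm]
      ring
  rw [h1, Matrix.det_one_add_replicateCol_mul_replicateRow]
  have h2 : x ⬝ᵥ (τ • x) = τ * ‖z‖ ^ 2 := by
    rw [← b.sum_sq_inner_right z, Finset.mul_sum]
    exact Finset.sum_congr rfl fun k _ => by simp [hx]; ring
  rw [h2]

lemma continuous_hsSq : Continuous (hsSq : (E →L[ℝ] E) → ℝ) := by
  unfold hsSq; fun_prop

lemma norm_sq_le_hsSq (S : E →L[ℝ] E) (i : Fin (finrank ℝ E)) :
    ‖S (stdOrthonormalBasis ℝ E i)‖ ^ 2 ≤ hsSq S :=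
  Finset.single_le_sum (f := fun i => ‖S (stdOrthonormalBasis ℝ E i)‖ ^ 2)
    (fun i _ => by positivity) (Finset.mem_univ i)

lemma norm_le_of_hsSq_le {S : E →L[ℝ] E} {r : ℝ} (hr : hsSq S ≤ r) :
    ‖S‖ ≤ finrank ℝ E * √r := by
  set b := stdOrthonormalBasis ℝ E
  refine S.opNorm_le_bound (by positivity) fun x => ?_
  calc ‖S x‖ = ‖∑ i, ⟪b i, x⟫ • S (b i)‖ := by
        conv_lhs => rw [← b.sum_repr' x, map_sum]
        simp only [map_smul]
    _ ≤ ∑ _i : Fin (finrank ℝ E), √r * ‖x‖ := by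
        refine norm_sum_le_of_le _ fun i _ => ?_
        rw [norm_smul, mul_comm]
        refine mul_le_mul ?_ ?_ (norm_nonneg _) (Real.sqrt_nonneg _)
        · exact Real.le_sqrt_of_sq_le ((norm_sq_le_hsSq S i).trans hr)
        · simpa using norm_inner_le_norm (𝕜 := ℝ) (b i) x
    _ = _ := by simp; ring

lemma det_sq_le_exp_hsSq (S : E →L[ℝ] E) :
    S.det ^ 2 ≤ 2 ^ finrank ℝ E * Real.exp (hsSq S / 2) := by
  have h := det_le_exp_trace (ContinuousLinearMap.isPositive_adjoint_comp_self S)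
  rw [det_comp, det_adjoint, ← sq] at h
  simpa [ContinuousLinearMap.adjoint_inner_right, hsSq, real_inner_self_eq_norm_sq] using h

/-- The variations S(1 + t y⊗y) suffice for the critical point equation. Along them every factor of
the functional is explicit, through (1 + t y⊗y)² = 1 + (2t + t²‖y‖²) y⊗y. -/
lemma hsSq_comp_one_add_rankOne (S : E →L[ℝ] E) (t : ℝ) (y : E) :
    hsSq (S ∘L (1 + t • InnerProductSpace.rankOne ℝ y y))
      = hsSq S + (2 * t + t ^ 2 * ‖y‖ ^ 2) * ‖S y‖ ^ 2 := by
  set b := stdOrthonormalBasis ℝ E with hb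
  have h1 : ∀ i, ‖(S ∘L (1 + t • InnerProductSpace.rankOne ℝ y y)) (b i)‖ ^ 2
      = ‖S (b i)‖ ^ 2 + 2 * t * (⟪y, b i⟫ * ⟪S (b i), S y⟫)
        + t ^ 2 * ‖S y‖ ^ 2 * ⟪y, b i⟫ ^ 2 := by
    intro i
    simp only [ContinuousLinearMap.comp_apply, add_apply, one_apply_eq_self, smul_apply,
      InnerProductSpace.rankOne_apply, map_add, map_smul, smul_smul]
    rw [norm_add_sq_real, norm_smul, mul_pow, Real.norm_eq_abs, sq_abs, inner_smul_right]
    ring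
  have h2 : ∑ i, ⟪y, b i⟫ * ⟪S (b i), S y⟫ = ‖S y‖ ^ 2 := by
    rw [← real_inner_self_eq_norm_sq]
    conv_rhs => rw [← ContinuousLinearMap.adjoint_inner_right, ← b.sum_inner_mul_inner]
    exact Finset.sum_congr rfl fun i _ => by rw [ContinuousLinearMap.adjoint_inner_right]
  unfold hsSq
  simp_rw [← hb, h1]
  rw [Finset.sum_add_distrib, Finset.sum_add_distrib, ← Finset.mul_sum, ← Finset.mul_sum, h2,
    b.sum_sq_inner_left]
  ring

lemma one_add_rankOne_comp_adjoint (t : ℝ) (y : E) :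
    covOp (1 + t • InnerProductSpace.rankOne ℝ y y : E →L[ℝ] E)
      = 1 + (2 * t + t ^ 2 * ‖y‖ ^ 2) • InnerProductSpace.rankOne ℝ y y := by
  have hadj : ContinuousLinearMap.adjoint (1 + t • InnerProductSpace.rankOne ℝ y y : E →L[ℝ] E)
      = 1 + t • InnerProductSpace.rankOne ℝ y y := by
    rw [map_add, map_smulₛₗ, InnerProductSpace.adjoint_rankOne,
      ContinuousLinearMap.isPositive_one.isSelfAdjoint.adjoint_eq]
    simp
  rw [covOp, hadj]
  ext x
  simp only [ContinuousLinearMap.comp_apply, add_apply, one_apply_eq_self, smul_apply,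
    InnerProductSpace.rankOne_apply, inner_add_right, inner_smul_right,
    real_inner_self_eq_norm_sq]
  module

lemma det_covOp_comp_one_add_rankOne {F : Type*} [NormedAddCommGroup F] [InnerProductSpace ℝ F]
    [FiniteDimensional ℝ F] (M : E →L[ℝ] F) (R : F ≃L[ℝ] F)
    (hR : (R : F →L[ℝ] F) ∘L ContinuousLinearMap.adjoint (R : F →L[ℝ] F) = covOp M) (t : ℝ)
    (y : E) :
    (covOp (M ∘L (1 + t • InnerProductSpace.rankOne ℝ y y))).det
      = (covOp M).det * (1 + (2 * t + t ^ 2 * ‖y‖ ^ 2) * ‖R.symm (M y)‖ ^ 2) := by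
  set τ := 2 * t + t ^ 2 * ‖y‖ ^ 2 with hτ
  have h1 : covOp (M ∘L (1 + t • InnerProductSpace.rankOne ℝ y y))
      = (R : F →L[ℝ] F) ∘L ((1 + τ • InnerProductSpace.rankOne ℝ (R.symm (M y)) (R.symm (M y))) ∘L
        ContinuousLinearMap.adjoint (R : F →L[ℝ] F)) := by
    have e1 : covOp (M ∘L (1 + t • InnerProductSpace.rankOne ℝ y y))
        = M ∘L (covOp (1 + t • InnerProductSpace.rankOne ℝ y y)) ∘L ContinuousLinearMap.adjoint M := by
      rw [covOp, covOp, ContinuousLinearMap.adjoint_comp]; rfl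
    rw [e1, one_add_rankOne_comp_adjoint, ← hτ]
    ext x
    have e2 := congrArg (fun A : F →L[ℝ] F => A x) hR
    simp only [ContinuousLinearMap.comp_apply, ContinuousLinearEquiv.coe_coe, covOp] at e2
    simp only [ContinuousLinearMap.comp_apply, add_apply, one_apply_eq_self, smul_apply,
      InnerProductSpace.rankOne_apply, map_add, map_smul, ContinuousLinearEquiv.coe_coe,
      ContinuousLinearEquiv.apply_symm_apply, e2, ContinuousLinearMap.adjoint_inner_right]
  rw [h1, det_comp, det_comp, det_one_add_smul_rankOne, ← hR, det_comp]
  ring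

variable {m : Type*} [Fintype m] [DecidableEq m] {F : m → Type*}
  [∀ j, NormedAddCommGroup (F j)] [∀ j, InnerProductSpace ℝ (F j)]
  [∀ j, FiniteDimensional ℝ (F j)]

/-- The Gaussian Brascamp--Lieb functional, evaluated at the Gaussian of covariance `S S*`. -/
noncomputable def gaussFunctional (L : ∀ j, E →L[ℝ] F j) (q : m → ℝ) (S : E →L[ℝ] E) : ℝ :=
  S.det ^ 2 * (∏ j, (covOp (L j ∘L S)).det ^ (-q j)) * Real.exp (-hsSq S)

lemma covOp_comp_det_pos {F : Type*} [NormedAddCommGroup F] [InnerProductSpace ℝ F]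
    [FiniteDimensional ℝ F] {L : E →L[ℝ] F} (hL : Function.Surjective L) {S : E →L[ℝ] E}
    (hS : S.det ≠ 0) : 0 < (covOp (L ∘L S)).det := by
  refine lt_of_le_of_ne (det_nonneg_of_isPositive (isPositive_covOp _)) (Ne.symm ?_)
  rw [det_covOp_ne_zero_iff]
  exact hL.comp ((S : E →ₗ[ℝ] E).equivOfDetNeZero hS).surjective

/-- Raising `hbound` to the power 1 - η leaves a surplus (det²)^η. It makes the functional small for
nearly singular `S`, while the exponential makes it small for large `S`. -/
lemma gaussFunctional_le {L : ∀ j, E →L[ℝ] F j} {p : m → ℝ}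
    (hL : ∀ j, Function.Surjective (L j)) {C : ℝ} (hC : 1 ≤ C)
    (hbound : ∀ S : E →L[ℝ] E, (∀ j, (covOp (L j ∘L S)).det ≠ 0) →
      S.det ^ 2 ≤ C * (∏ j, (covOp (L j ∘L S)).det ^ p j) * Real.exp (hsSq S / 2))
    {η : ℝ} (hη : 0 < η) (hη1 : η ≤ 1) {S : E →L[ℝ] E} (hS : S.det ≠ 0) :
    gaussFunctional L (fun j => (1 - η) * p j) S
      ≤ C * (S.det ^ 2) ^ η * Real.exp (-((1 + η) * hsSq S / 2)) := by
  have hpos := fun j => covOp_comp_det_pos (hL j) hS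
  have hb := hbound S fun j => (hpos j).ne'
  set D := ∏ j, (covOp (L j ∘L S)).det ^ p j with hD
  have hD0 : 0 < D := Finset.prod_pos fun j _ => Real.rpow_pos_of_pos (hpos j) _
  have hS2 : 0 < S.det ^ 2 := by positivity
  have h1 : ∏ j, (covOp (L j ∘L S)).det ^ (-((1 - η) * p j)) = (D⁻¹) ^ (1 - η) := by
    rw [hD, ← Finset.prod_inv_distrib, ← Real.finsetProd_rpow _ _ fun j _ => by
      have := hpos j; positivity]
    refine Finset.prod_congr rfl fun j _ => ?_
    rw [← Real.rpow_neg (hpos j).le, ← Real.rpow_mul (hpos j).le]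
    congr 1; ring
  have h2 : D⁻¹ ≤ C * Real.exp (hsSq S / 2) * (S.det ^ 2)⁻¹ := by
    rw [← div_eq_mul_inv, le_div_iff₀ hS2, inv_mul_le_iff₀ hD0]
    linarith
  have h3 : (D⁻¹) ^ (1 - η) ≤ (C * Real.exp (hsSq S / 2) * (S.det ^ 2)⁻¹) ^ (1 - η) :=
    Real.rpow_le_rpow (by positivity) h2 (by linarith)
  have h4 : (C * Real.exp (hsSq S / 2) * (S.det ^ 2)⁻¹) ^ (1 - η)
      ≤ C * Real.exp ((1 - η) * hsSq S / 2) * ((S.det ^ 2)⁻¹ * (S.det ^ 2) ^ η) := by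
    rw [Real.mul_rpow (by positivity) (by positivity), Real.mul_rpow (by positivity) (by positivity)]
    have e1 : C ^ (1 - η) ≤ C := by
      conv_rhs => rw [← Real.rpow_one C]
      exact Real.rpow_le_rpow_of_exponent_le hC (by linarith)
    have e2 : Real.exp (hsSq S / 2) ^ (1 - η) = Real.exp ((1 - η) * hsSq S / 2) := by
      rw [← Real.exp_mul]; congr 1; ring
    have e3 : ((S.det ^ 2)⁻¹) ^ (1 - η) = (S.det ^ 2)⁻¹ * (S.det ^ 2) ^ η := by
      rw [Real.inv_rpow hS2.le, ← Real.rpow_neg hS2.le, neg_sub, sub_eq_add_neg, add_comm,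
        Real.rpow_add hS2, Real.rpow_neg hS2.le, Real.rpow_one]
    rw [e2, e3]
    gcongr
  rw [gaussFunctional, h1]
  calc S.det ^ 2 * (D⁻¹) ^ (1 - η) * Real.exp (-hsSq S)
      ≤ S.det ^ 2 * (C * Real.exp ((1 - η) * hsSq S / 2) * ((S.det ^ 2)⁻¹ * (S.det ^ 2) ^ η))
        * Real.exp (-hsSq S) := by
        gcongr; exact h3.trans h4
    _ = C * (S.det ^ 2) ^ η * (Real.exp ((1 - η) * hsSq S / 2) * Real.exp (-hsSq S)) := by
        field_simp
    _ = _ := by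
        rw [← Real.exp_add]; congr 2; ring

/-- Critical point equation at a maximiser of the Gaussian functional. -/
lemma critical_of_isMax {L : ∀ j, E →L[ℝ] F j} {q : m → ℝ}
    (hL : ∀ j, Function.Surjective (L j)) {S : E →L[ℝ] E} (hS : S.det ≠ 0)
    (hmax : ∀ S' : E →L[ℝ] E, S'.det ≠ 0 → gaussFunctional L q S' ≤ gaussFunctional L q S)
    (R : ∀ j, F j ≃L[ℝ] F j)
    (hR : ∀ j, (R j : F j →L[ℝ] F j) ∘L ContinuousLinearMap.adjoint (R j : F j →L[ℝ] F j)
      = covOp (L j ∘L S)) (y : E) :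
    ‖y‖ ^ 2 = ‖S y‖ ^ 2 + ∑ j, q j * ‖(R j).symm (L j (S y))‖ ^ 2 := by
  set a : m → ℝ := fun j => ‖(R j).symm (L j (S y))‖ ^ 2 with ha
  set τ : ℝ → ℝ := fun t => 2 * t + t ^ 2 * ‖y‖ ^ 2 with hτ
  have hτd : HasDerivAt τ 2 0 := by
    have h1 : HasDerivAt (fun t : ℝ => 2 * t) 2 0 := by
      simpa using (hasDerivAt_id (0 : ℝ)).const_mul 2
    have h2 : HasDerivAt (fun t : ℝ => t ^ 2 * ‖y‖ ^ 2) 0 0 := by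
      simpa using (hasDerivAt_pow 2 (0 : ℝ)).mul_const (‖y‖ ^ 2)
    have h3 := h1.add h2
    rw [add_zero] at h3
    exact h3
  have hτ0 : τ 0 = 0 := by simp [hτ]
  -- The logarithm of the ratio of the functional at S(1 + t y⊗y) to its value at `S`. Its
  -- derivative at 0 is twice the difference of the two sides of the goal.
  set g : ℝ → ℝ := fun t => 2 * Real.log (1 + t * ‖y‖ ^ 2)
    - ∑ j, q j * Real.log (1 + τ t * a j) - τ t * ‖S y‖ ^ 2 with hg
  have hgd : HasDerivAt g (2 * ‖y‖ ^ 2 - ∑ j, q j * (2 * a j) - 2 * ‖S y‖ ^ 2) 0 := by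
    refine HasDerivAt.sub (HasDerivAt.sub ?_ ?_) (hτd.mul_const _)
    · have h1 : HasDerivAt (fun t : ℝ => 1 + t * ‖y‖ ^ 2) (‖y‖ ^ 2) 0 := by
        simpa using ((hasDerivAt_id (0 : ℝ)).mul_const (‖y‖ ^ 2)).const_add 1
      have h2 := (h1.log (by simp)).const_mul 2
      simpa using h2
    · refine HasDerivAt.fun_sum fun j _ => ?_
      have h1 : HasDerivAt (fun t : ℝ => 1 + τ t * a j) (2 * a j) 0 :=
        (hτd.mul_const (a j)).const_add 1
      have h2 := (h1.log (by simp [hτ0])).const_mul (q j)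
      simpa [hτ0] using h2
  have hτc : ContinuousAt τ 0 := hτd.continuousAt
  have hmaxg : IsLocalMax g 0 := by
    have hev1 : ∀ᶠ t : ℝ in 𝓝 0, 0 < 1 + t * ‖y‖ ^ 2 :=
      (by fun_prop : ContinuousAt (fun t : ℝ => 1 + t * ‖y‖ ^ 2) 0).eventually_const_lt (by simp)
    have hev2 : ∀ᶠ t : ℝ in 𝓝 0, ∀ j, 0 < 1 + τ t * a j := eventually_all.2 fun j =>
      ((hτc.mul continuousAt_const).const_add 1).eventually_const_lt (by simp [hτ0])
    filter_upwards [hev1, hev2] with t ht1 ht2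
    have hg0 : g 0 = 0 := by simp [hg, hτ0]
    rw [hg0]
    set S' := S ∘L (1 + t • InnerProductSpace.rankOne ℝ y y) with hS'
    have hdet : S'.det = S.det * (1 + t * ‖y‖ ^ 2) := by
      rw [hS', det_comp, det_one_add_smul_rankOne]
    have hS'0 : S'.det ≠ 0 := by rw [hdet]; exact mul_ne_zero hS ht1.ne'
    have hcov : ∀ j, (covOp (L j ∘L S')).det = (covOp (L j ∘L S)).det * (1 + τ t * a j) :=
      fun j => det_covOp_comp_one_add_rankOne (L j ∘L S) (R j) (hR j) t y
    have hpos := fun j => covOp_comp_det_pos (hL j) hS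
    have hle := hmax S' hS'0
    have hexp : gaussFunctional L q S' = gaussFunctional L q S * Real.exp (g t) := by
      have e1 : Real.exp (g t) = (1 + t * ‖y‖ ^ 2) ^ 2 * (∏ j, (1 + τ t * a j) ^ (-q j))
          * Real.exp (-(τ t * ‖S y‖ ^ 2)) := by
        have e2 : g t = 2 * Real.log (1 + t * ‖y‖ ^ 2)
            + ∑ j, Real.log (1 + τ t * a j) * (-q j) + (-(τ t * ‖S y‖ ^ 2)) := by
          simp only [hg, sub_eq_add_neg, ← Finset.sum_neg_distrib]
          congr 2
          exact Finset.sum_congr rfl fun j _ => by ring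
        rw [e2, Real.exp_add, Real.exp_add, Real.exp_sum]
        congr 2
        · rw [two_mul, Real.exp_add, Real.exp_log ht1, ← sq]
        · exact Finset.prod_congr rfl fun j _ => (Real.rpow_def_of_pos (ht2 j) _).symm
      rw [e1, gaussFunctional, gaussFunctional, hdet, hS', hsSq_comp_one_add_rankOne, ← hS']
      have e3 : ∏ j, (covOp (L j ∘L S')).det ^ (-q j)
          = (∏ j, (covOp (L j ∘L S)).det ^ (-q j)) * ∏ j, (1 + τ t * a j) ^ (-q j) := by
        rw [← Finset.prod_mul_distrib]
        exact Finset.prod_congr rfl fun j _ => by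
          rw [hcov, Real.mul_rpow (hpos j).le (ht2 j).le]
      rw [e3, neg_add, Real.exp_add]
      ring
    have hΦ : 0 < gaussFunctional L q S := by
      have : 0 < ∏ j, (covOp (L j ∘L S)).det ^ (-q j) :=
        Finset.prod_pos fun j _ => Real.rpow_pos_of_pos (hpos j) _
      unfold gaussFunctional
      positivity
    rw [hexp] at hle
    have : Real.exp (g t) ≤ 1 := le_of_mul_le_mul_left (by linarith) hΦ
    exact Real.exp_le_one_iff.1 this
  have hz := hmaxg.hasDerivAt_eq_zero hgd
  have e : ∑ j, q j * (2 * a j) = 2 * ∑ j, q j * a j := by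
    rw [Finset.mul_sum]; exact Finset.sum_congr rfl fun j _ => by ring
  rw [e] at hz
  linarith

end BrascampLieb

/-! ### Maximisers and critical Gaussians. -/

namespace BrascampLieb
open Filter Topology Module
open scoped RealInnerProductSpace
set_option linter.unusedSectionVars false

variable {E : Type*} [NormedAddCommGroup E] [InnerProductSpace ℝ E] [FiniteDimensional ℝ E]
variable {m : Type*} [Fintype m] [DecidableEq m] {F : m → Type*}
  [∀ j, NormedAddCommGroup (F j)] [∀ j, InnerProductSpace ℝ (F j)]
  [∀ j, FiniteDimensional ℝ (F j)]

lemma gaussFunctional_pos {L : ∀ j, E →L[ℝ] F j} (hL : ∀ j, Function.Surjective (L j))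
    (q : m → ℝ) {S : E →L[ℝ] E} (hS : S.det ≠ 0) : 0 < gaussFunctional L q S := by
  have : 0 < ∏ j, (covOp (L j ∘L S)).det ^ (-q j) :=
    Finset.prod_pos fun j _ => Real.rpow_pos_of_pos (covOp_comp_det_pos (hL j) hS) _
  unfold gaussFunctional
  positivity

lemma continuous_det_covOp {F : Type*} [NormedAddCommGroup F] [InnerProductSpace ℝ F]
    [FiniteDimensional ℝ F] (L : E →L[ℝ] F) :
    Continuous fun S : E →L[ℝ] E => (covOp (L ∘L S)).det := by
  refine ContinuousLinearMap.continuous_det.comp ?_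
  have h1 : Continuous fun S : E →L[ℝ] E => ContinuousLinearMap.adjoint (L ∘L S) :=
    (LinearIsometryEquiv.continuous _).comp (continuous_const.clm_comp continuous_id)
  exact (continuous_const.clm_comp continuous_id).clm_comp h1

/-- The Gaussian functional with subcritical exponents has a maximiser. -/
lemma exists_isMax_gaussFunctional {L : ∀ j, E →L[ℝ] F j} {p : m → ℝ}
    (hL : ∀ j, Function.Surjective (L j)) {C : ℝ} (hC : 1 ≤ C)
    (hbound : ∀ S : E →L[ℝ] E, (∀ j, (covOp (L j ∘L S)).det ≠ 0) →
      S.det ^ 2 ≤ C * (∏ j, (covOp (L j ∘L S)).det ^ p j) * Real.exp (hsSq S / 2))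
    {η : ℝ} (hη : 0 < η) (hη1 : η ≤ 1) :
    ∃ S : E →L[ℝ] E, S.det ≠ 0 ∧
      gaussFunctional L (fun j => (1 - η) * p j) S ≤ C * 2 ^ finrank ℝ E ∧
      ∀ S' : E →L[ℝ] E, S'.det ≠ 0 → gaussFunctional L (fun j => (1 - η) * p j) S'
        ≤ gaussFunctional L (fun j => (1 - η) * p j) S := by
  have hdet1 : (1 : E →L[ℝ] E).det = 1 := LinearMap.det_id
  have hdet1' : (1 : E →L[ℝ] E).det ≠ 0 := by rw [hdet1]; exact one_ne_zero
  set Φ := gaussFunctional L (fun j => (1 - η) * p j) with hΦ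
  have hC0 : 0 < C := by linarith
  have b1 : ∀ S : E →L[ℝ] E, S.det ≠ 0 → Φ S ≤ C * 2 ^ finrank ℝ E * Real.exp (-(hsSq S / 2)) := by
    intro S hS
    refine (gaussFunctional_le hL hC hbound hη hη1 hS).trans ?_
    have h1 : (S.det ^ 2) ^ η ≤ 2 ^ finrank ℝ E * Real.exp (η * hsSq S / 2) := by
      refine (Real.rpow_le_rpow (sq_nonneg _) (det_sq_le_exp_hsSq S) hη.le).trans ?_
      rw [Real.mul_rpow (by positivity) (by positivity), ← Real.exp_mul]
      have e1 : ((2 : ℝ) ^ finrank ℝ E) ^ η ≤ 2 ^ finrank ℝ E := by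
        conv_rhs => rw [← Real.rpow_one ((2 : ℝ) ^ finrank ℝ E)]
        exact Real.rpow_le_rpow_of_exponent_le (one_le_pow₀ one_le_two) hη1
      refine mul_le_mul e1 (le_of_eq ?_) (Real.exp_pos _).le (by positivity)
      congr 1; ring
    calc C * (S.det ^ 2) ^ η * Real.exp (-((1 + η) * hsSq S / 2))
        ≤ C * (2 ^ finrank ℝ E * Real.exp (η * hsSq S / 2))
          * Real.exp (-((1 + η) * hsSq S / 2)) := by gcongr
      _ = C * 2 ^ finrank ℝ E * (Real.exp (η * hsSq S / 2)
          * Real.exp (-((1 + η) * hsSq S / 2))) := by ring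
      _ = _ := by rw [← Real.exp_add]; congr 2; ring
  have b2 : ∀ S : E →L[ℝ] E, S.det ≠ 0 → Φ S ≤ C * (S.det ^ 2) ^ η := by
    intro S hS
    refine (gaussFunctional_le hL hC hbound hη hη1 hS).trans ?_
    refine mul_le_of_le_one_right (by positivity) (Real.exp_le_one_iff.2 ?_)
    have := hsSq_nonneg S
    have : 0 ≤ (1 + η) * hsSq S / 2 := by positivity
    linarith
  have hΦ1 : 0 < Φ 1 := gaussFunctional_pos hL _ hdet1'
  obtain ⟨r, hr⟩ : ∃ r : ℝ, C * 2 ^ finrank ℝ E * Real.exp (-(r / 2)) < Φ 1 := by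
    have h1 : Tendsto (fun r : ℝ => C * 2 ^ finrank ℝ E * Real.exp (-(r / 2))) atTop
        (𝓝 (C * 2 ^ finrank ℝ E * 0)) :=
      (Real.tendsto_exp_neg_atTop_nhds_zero.comp (tendsto_id.atTop_div_const two_pos)).const_mul _
    rw [mul_zero] at h1
    exact (h1.eventually_lt_const hΦ1).exists
  obtain ⟨κ, hκ, hκ0⟩ : ∃ κ : ℝ, C * κ ^ η < Φ 1 ∧ 0 < κ := by
    have h1 : Tendsto (fun κ : ℝ => C * κ ^ η) (𝓝[>] 0) (𝓝 (C * 0 ^ η)) :=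
      ((Real.continuous_rpow_const hη.le).tendsto 0 |>.mono_left nhdsWithin_le_nhds).const_mul _
    rw [Real.zero_rpow hη.ne', mul_zero] at h1
    exact ((h1.eventually_lt_const hΦ1).and self_mem_nhdsWithin).exists
  -- By `b1` and `b2` the functional is below `Φ 1` at invertible operators outside `K`, so a
  -- maximum over this compact set is global. The choice of `κ` relies on η > 0.
  set K : Set (E →L[ℝ] E) := {S | hsSq S ≤ r ∧ κ ≤ S.det ^ 2} with hK
  have hKdet : ∀ S ∈ K, S.det ≠ 0 := fun S hS h0 => by
    have := hS.2; rw [h0] at this; norm_num at this; linarith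
  have hout : ∀ S : E →L[ℝ] E, S.det ≠ 0 → S ∉ K → Φ S < Φ 1 := by
    intro S hS hSK
    by_cases h : hsSq S ≤ r
    · have h2 : S.det ^ 2 < κ := not_le.1 fun h' => hSK ⟨h, h'⟩
      refine (b2 S hS).trans_lt (lt_of_le_of_lt ?_ hκ)
      gcongr
    · refine (b1 S hS).trans_lt (lt_of_le_of_lt ?_ hr)
      have := not_le.1 h
      gcongr
  have h1K : (1 : E →L[ℝ] E) ∈ K := by
    by_contra h; exact lt_irrefl _ (hout 1 hdet1' h)
  have hKc : IsCompact K := by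
    refine Metric.isCompact_of_isClosed_isBounded ?_ ?_
    · exact (isClosed_le continuous_hsSq continuous_const).inter
        (isClosed_le continuous_const (ContinuousLinearMap.continuous_det.pow 2))
    · exact isBounded_iff_forall_norm_le.2 ⟨_, fun S hS => norm_le_of_hsSq_le hS.1⟩
  have hΦc : ContinuousOn Φ K := by
    refine ContinuousOn.mul (ContinuousOn.mul
      (ContinuousLinearMap.continuous_det.pow 2).continuousOn ?_)
      (Real.continuous_exp.comp continuous_hsSq.neg).continuousOn
    exact continuousOn_finsetProd _ fun j _ => (continuous_det_covOp (L j)).continuousOn.rpow_const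
      fun S hS => Or.inl (covOp_comp_det_pos (hL j) (hKdet S hS)).ne'
  obtain ⟨S, hSK, hSmax⟩ := hKc.exists_isMaxOn ⟨1, h1K⟩ hΦc
  refine ⟨S, hKdet S hSK, (b1 S (hKdet S hSK)).trans ?_, fun S' hS' => ?_⟩
  · refine mul_le_of_le_one_right (by positivity) (Real.exp_le_one_iff.2 ?_)
    linarith [hsSq_nonneg S]
  · by_cases h : S' ∈ K
    · exact hSmax h
    · exact (hout S' hS' h).le.trans (hSmax h1K)

/-- Existence of critical Gaussians with uniformly bounded Brascamp--Lieb ratio. -/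
theorem exists_critical_gaussian {L : ∀ j, E →L[ℝ] F j} {p : m → ℝ} (hp : ∀ j, 0 ≤ p j)
    (hL : ∀ j, Function.Surjective (L j)) {C : ℝ} (hC : 1 ≤ C)
    (hbound : ∀ S : E →L[ℝ] E, (∀ j, (covOp (L j ∘L S)).det ≠ 0) →
      S.det ^ 2 ≤ C * (∏ j, (covOp (L j ∘L S)).det ^ p j) * Real.exp (hsSq S / 2))
    {η : ℝ} (hη : 0 < η) (hη1 : η ≤ 1) :
    ∃ (S : E ≃L[ℝ] E) (R : ∀ j, F j ≃L[ℝ] F j),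
      (∀ j, (R j : F j →L[ℝ] F j) ∘L ContinuousLinearMap.adjoint (R j : F j →L[ℝ] F j)
        = (L j ∘L (S : E →L[ℝ] E)) ∘L ContinuousLinearMap.adjoint (L j ∘L (S : E →L[ℝ] E))) ∧
      (∀ y, ‖y‖ ^ 2 = ‖S y‖ ^ 2 + ∑ j, (1 - η) * p j * ‖(R j).symm (L j (S y))‖ ^ 2) ∧
      |LinearMap.det (S : E →ₗ[ℝ] E)| *
        ∏ j, (|LinearMap.det (R j : F j →ₗ[ℝ] F j)|⁻¹) ^ ((1 - η) * p j)
        ≤ C * 2 ^ finrank ℝ E * Real.exp (finrank ℝ E) := by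
  obtain ⟨S₀, hS₀, hval, hmax⟩ := exists_isMax_gaussFunctional hL hC hbound hη hη1
  choose R hR using fun j => exists_comp_adjoint_eq (isPositive_covOp (L j ∘L S₀))
    (covOp_comp_det_pos (hL j) hS₀).ne'
  have hcrit := critical_of_isMax hL hS₀ hmax R hR
  set S : E ≃L[ℝ] E := ((S₀ : E →ₗ[ℝ] E).equivOfDetNeZero hS₀).toContinuousLinearEquiv with hS
  have hSS : (S : E →L[ℝ] E) = S₀ := by ext x; rfl
  refine ⟨S, R, fun j => by rw [hSS]; exact hR j, hcrit, ?_⟩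
  -- The critical point equation makes the maximiser a contraction, which removes the exponential
  -- weight at bounded cost.
  have hhs : hsSq S₀ ≤ finrank ℝ E := by
    have : ∀ i, ‖S₀ (stdOrthonormalBasis ℝ E i)‖ ^ 2 ≤ 1 := by
      intro i
      have h1 := hcrit (stdOrthonormalBasis ℝ E i)
      rw [(stdOrthonormalBasis ℝ E).orthonormal.1 i, one_pow] at h1
      have h2 : 0 ≤ ∑ j, (1 - η) * p j
          * ‖(R j).symm (L j (S₀ (stdOrthonormalBasis ℝ E i)))‖ ^ 2 :=
        Finset.sum_nonneg fun j _ => mul_nonneg (mul_nonneg (by linarith) (hp j)) (sq_nonneg _)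
      linarith
    calc hsSq S₀ ≤ ∑ _i : Fin (finrank ℝ E), (1 : ℝ) := Finset.sum_le_sum fun i _ => this i
      _ = _ := by simp
  set X := |LinearMap.det (S : E →ₗ[ℝ] E)| *
        ∏ j, (|LinearMap.det (R j : F j →ₗ[ℝ] F j)|⁻¹) ^ ((1 - η) * p j) with hX
  have hX2 : X ^ 2 = gaussFunctional L (fun j => (1 - η) * p j) S₀ * Real.exp (hsSq S₀) := by
    have e1 : LinearMap.det (S : E →ₗ[ℝ] E) = S₀.det := rfl
    have e2 : ∀ j, (covOp (L j ∘L S₀)).det = |LinearMap.det (R j : F j →ₗ[ℝ] F j)| ^ 2 := by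
      intro j
      rw [← hR j, det_comp, det_adjoint, sq_abs, sq]
      rfl
    rw [gaussFunctional, mul_assoc _ (Real.exp _), ← Real.exp_add, neg_add_cancel, Real.exp_zero,
      mul_one, hX, mul_pow, e1, sq_abs, ← Finset.prod_pow]
    congr 1
    refine Finset.prod_congr rfl fun j _ => ?_
    rw [e2, Real.rpow_neg (by positivity), Real.inv_rpow (abs_nonneg _), inv_pow,
      ← Real.rpow_natCast, ← Real.rpow_natCast, ← Real.rpow_mul (abs_nonneg _),
      ← Real.rpow_mul (abs_nonneg _), mul_comm]
  set A := C * 2 ^ finrank ℝ E * Real.exp (finrank ℝ E) with hA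
  -- From X² ≤ A and A ≥ 1 follows X ≤ A, which avoids a square root in the constant.
  have hA1 : 1 ≤ A := by
    have h1 : (1 : ℝ) ≤ 2 ^ finrank ℝ E := one_le_pow₀ one_le_two
    have h2 : (1 : ℝ) ≤ Real.exp (finrank ℝ E) := Real.one_le_exp (by positivity)
    exact one_le_mul_of_one_le_of_one_le (one_le_mul_of_one_le_of_one_le hC h1) h2
  have hXA : X ^ 2 ≤ A := by
    rw [hX2, hA]
    exact mul_le_mul hval (Real.exp_le_exp.2 hhs) (Real.exp_pos _).le (by positivity)
  by_contra h
  push Not at h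
  nlinarith

end BrascampLieb

namespace BrascampLieb
open Filter Topology Module
open scoped RealInnerProductSpace
set_option linter.unusedSectionVars false

/-! ### Necessity of the rank condition -/

variable {E : Type*} [NormedAddCommGroup E] [InnerProductSpace ℝ E] [FiniteDimensional ℝ E]

/-- The linear map which multiplies by `ε` on `W` and is the identity on its orthogonal
complement. -/
noncomputable def squeeze (W : Submodule ℝ E) (ε : ℝ) : E →L[ℝ] E :=
  1 + (ε - 1) • W.starProjection

lemma squeeze_apply (W : Submodule ℝ E) (ε : ℝ) (x : E) :
    squeeze W ε x = x + (ε - 1) • W.starProjection x := by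
  simp [squeeze]

lemma det_squeeze (W : Submodule ℝ E) (ε : ℝ) :
    LinearMap.det (squeeze W ε : E →ₗ[ℝ] E) = ε ^ finrank ℝ W := by
  have hW : W ≤ W.comap (squeeze W ε : E →ₗ[ℝ] E) := by
    intro x hx
    have : squeeze W ε x ∈ W := by
      rw [squeeze_apply]
      exact W.add_mem hx (W.smul_mem _ (Submodule.starProjection_apply_mem W x))
    exact this
  rw [LinearMap.det_eq_det_mul_det W _ hW]
  have h1 : (squeeze W ε : E →ₗ[ℝ] E).restrict hW = ε • LinearMap.id := by
    ext x
    have : squeeze W ε (x : E) = ε • (x : E) := by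
      rw [squeeze_apply, Submodule.starProjection_eq_self_iff.2 x.2]
      module
    simpa using this
  have h2 : W.mapQ W (squeeze W ε : E →ₗ[ℝ] E) hW = LinearMap.id := by
    ext x
    have : squeeze W ε x - x ∈ W := by
      rw [squeeze_apply, add_sub_cancel_left]
      exact W.smul_mem _ (Submodule.starProjection_apply_mem W x)
    simpa [Submodule.Quotient.eq] using this
  rw [h1, h2]
  simp

lemma inner_squeeze_of_mem {W : Submodule ℝ E} {v : E} (hv : v ∈ W) (ε : ℝ) (x : E) :
    ⟪v, squeeze W ε x⟫ = ε * ⟪v, x⟫ := by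
  have : ⟪v, W.starProjection x⟫ = ⟪v, x⟫ := by
    rw [← Submodule.inner_starProjection_left_eq_right, Submodule.starProjection_eq_self_iff.2 hv]
  rw [squeeze_apply, inner_add_right, inner_smul_right, this]
  ring

lemma norm_squeeze_le (W : Submodule ℝ E) {ε : ℝ} (h0 : 0 ≤ ε) (h1 : ε ≤ 1) (x : E) :
    ‖squeeze W ε x‖ ≤ ‖x‖ := by
  have h2 : squeeze W ε x = (1 - ε) • (x - W.starProjection x) + ε • x := by
    rw [squeeze_apply]; module
  have h3 : ‖x - W.starProjection x‖ ≤ ‖x‖ := by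
    have := Submodule.norm_starProjection_apply_le (Wᗮ) x
    rwa [Submodule.starProjection_orthogonal_val] at this
  rw [h2]
  refine (norm_add_le _ _).trans ?_
  rw [norm_smul, norm_smul, Real.norm_of_nonneg h0, Real.norm_of_nonneg (by linarith)]
  nlinarith [norm_nonneg x]

lemma volume_setOf_abs_inner_le [MeasurableSpace E] [BorelSpace E] {ι : Type*} [Fintype ι]
    (b : OrthonormalBasis ι ℝ E) (r : ι → ℝ) :
    volume {y : E | ∀ k, |⟪b k, y⟫| ≤ r k} = ∏ k, ENNReal.ofReal (2 * r k) := by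
  have hmp : MeasurePreserving (fun y : E => (b.repr y).ofLp) volume volume :=
    (PiLp.volume_preserving_ofLp ι).comp b.measurePreserving_repr
  have hset : {y : E | ∀ k, |⟪b k, y⟫| ≤ r k}
      = (fun y : E => (b.repr y).ofLp) ⁻¹' Set.Icc (fun k => -r k) r := by
    ext y
    simp only [mem_ofPred_eq, mem_preimage, mem_Icc, Pi.le_def, ← forall_and, abs_le,
      b.repr_apply_apply]
  rw [hset, hmp.measure_preimage measurableSet_Icc.nullMeasurableSet, Real.volume_Icc_pi]
  refine Finset.prod_congr rfl fun k _ => ?_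
  congr 1
  ring

variable [MeasurableSpace E] [BorelSpace E]
  {m : ℕ} {F : Fin m → Type*}
  [∀ j, NormedAddCommGroup (F j)] [∀ j, InnerProductSpace ℝ (F j)]
  [∀ j, FiniteDimensional ℝ (F j)] [∀ j, MeasurableSpace (F j)] [∀ j, BorelSpace (F j)]

/-- Testing the localised inequality on boxes adapted to orthonormal families. -/
lemma rpow_le_of_localBrascampLiebInequality {L : ∀ j, E →L[ℝ] F j} {p : Fin m → ℝ} {C : ℝ≥0}
    (hC : LocalBrascampLiebInequality L p C) {e : ∀ j, Fin (finrank ℝ (F j)) → F j}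
    (he : ∀ j, Orthonormal ℝ (e j)) (S : Finset (Σ j, Fin (finrank ℝ (F j)))) :
    ∃ A : ℝ, ∀ ε : ℝ, 0 < ε → ε ≤ 1 →
      ε ^ (finrank ℝ (Submodule.span ℝ (pullbackVec L e '' S)) : ℝ) ≤ A * ε ^ ∑ s ∈ S, p s.1 := by
  set W := Submodule.span ℝ (pullbackVec L e '' S) with hW
  obtain ⟨K, hK0, hK⟩ : ∃ K : ℝ, 0 < K ∧ ∀ s, ‖pullbackVec L e s‖ ≤ K := by
    refine ⟨1 + ∑ s, ‖pullbackVec L e s‖, by positivity, fun s => ?_⟩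
    have := Finset.single_le_sum (f := fun s => ‖pullbackVec L e s‖)
      (fun i _ => norm_nonneg _) (Finset.mem_univ s)
    linarith
  have hb : ∀ j, ∃ b : OrthonormalBasis (Fin (finrank ℝ (F j))) ℝ (F j), ⇑b = e j := by
    intro j
    refine ⟨OrthonormalBasis.mk (he j) ?_, OrthonormalBasis.coe_mk _ _⟩
    exact ((he j).linearIndependent.span_eq_top_of_card_eq_finrank' (by simp)).ge
  choose b hb using hb
  set V := volume.real (Metric.closedBall (0 : E) 1) with hV
  have hV0 : 0 < V := by
    refine ENNReal.toReal_pos (Metric.measure_closedBall_pos _ _ one_pos).ne' ?_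
    exact measure_closedBall_lt_top.ne
  set B : ℝ := ∏ s : Σ j, Fin (finrank ℝ (F j)), (2 * K) ^ p s.1
  refine ⟨C * B / V, fun ε hε hε1 => ?_⟩
  -- The boxes are thin in the directions of `S` only. `K` bounds all pulled-back vectors, so the
  -- unit ball squeezed by ε along `W` is mapped into every box.
  set r : (Σ j, Fin (finrank ℝ (F j))) → ℝ := fun s => K * if s ∈ S then ε else 1 with hr
  have hr0 : ∀ s, 0 ≤ r s := fun s => by simp only [hr]; split_ifs <;> positivity
  set box : ∀ j, Set (F j) := fun j => {y | ∀ k, |⟪b j k, y⟫| ≤ r ⟨j, k⟩} with hbox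
  have hvol : ∀ j, volume (box j) = ∏ k, ENNReal.ofReal (2 * r ⟨j, k⟩) := fun j =>
    volume_setOf_abs_inner_le (b j) _
  have hmeas : ∀ j, MeasurableSet (box j) := fun j => by
    simp only [hbox, ofPred_forall]
    exact MeasurableSet.iInter fun k => measurableSet_le (by fun_prop) measurable_const
  have hreal : ∀ j, volume.real (box j) = ∏ k, (2 * r ⟨j, k⟩) := fun j => by
    rw [Measure.real, hvol, ENNReal.toReal_prod]
    exact Finset.prod_congr rfl fun k _ =>
      ENNReal.toReal_ofReal (mul_nonneg zero_le_two (hr0 _))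
  have hfin : ∀ j, volume (box j) ≠ ∞ := fun j => by
    rw [hvol]; exact ENNReal.prod_ne_top fun k _ => ENNReal.ofReal_ne_top
  have key := hC (fun j => (box j).indicator 1)
    (fun j y => indicator_nonneg (fun _ _ => zero_le_one) y)
    (fun j => (integrable_indicator_iff (hmeas j)).2 (integrableOn_const (hfin j)))
  have hint : ∀ j, ∫ y, (box j).indicator (1 : F j → ℝ) y = ∏ k, (2 * r ⟨j, k⟩) := fun j => by
    rw [integral_indicator_one (hmeas j), hreal]
  simp only [hint] at key
  set D := squeeze W ε '' Metric.closedBall (0 : E) 1 with hD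
  have hDmem : ∀ x ∈ D, x ∈ Metric.closedBall (0 : E) 1 ∧ ∀ j, L j x ∈ box j := by
    rintro _ ⟨z, hz, rfl⟩
    rw [mem_closedBall_zero_iff] at hz
    refine ⟨mem_closedBall_zero_iff.2 ((norm_squeeze_le W hε.le hε1 z).trans hz), fun j k => ?_⟩
    have h1 : ⟪b j k, L j (squeeze W ε z)⟫ = ⟪pullbackVec L e ⟨j, k⟩, squeeze W ε z⟫ := by
      rw [hb, pullbackVec, ContinuousLinearMap.adjoint_inner_left]
    rw [h1]
    by_cases hs : (⟨j, k⟩ : Σ j, Fin (finrank ℝ (F j))) ∈ S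
    · have h2 : pullbackVec L e ⟨j, k⟩ ∈ W :=
        Submodule.subset_span (mem_image_of_mem _ hs)
      rw [inner_squeeze_of_mem h2, abs_mul, abs_of_pos hε]
      simp only [hr, hs, if_true]
      have h3 := (abs_real_inner_le_norm (pullbackVec L e ⟨j, k⟩) z).trans
        (mul_le_mul (hK _) hz (norm_nonneg _) hK0.le)
      nlinarith
    · simp only [hr, hs, if_false]
      exact (abs_real_inner_le_norm _ _).trans
        (mul_le_mul (hK _) ((norm_squeeze_le W hε.le hε1 z).trans hz) (norm_nonneg _) hK0.le)
  have hDmeas : MeasurableSet D :=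
    ((isCompact_closedBall (0 : E) 1).image (squeeze W ε).continuous).measurableSet
  have hlow : volume D ≤ ∫⁻ x in Metric.closedBall (0 : E) 1,
      ENNReal.ofReal (∏ j, (box j).indicator (1 : F j → ℝ) (L j x) ^ p j) := by
    calc volume D = ∫⁻ x in D, 1 := by simp
      _ ≤ ∫⁻ x in D, ENNReal.ofReal (∏ j, (box j).indicator (1 : F j → ℝ) (L j x) ^ p j) := by
        refine setLIntegral_mono' hDmeas fun x hx => ?_
        simp [indicator_of_mem ((hDmem x hx).2 _)]
      _ ≤ _ := lintegral_mono_set fun x hx => (hDmem x hx).1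
  have hvolD : volume D = ENNReal.ofReal (ε ^ finrank ℝ W * V) := by
    rw [hD, Measure.addHaar_image_continuousLinearMap, det_squeeze, abs_of_pos (by positivity),
      ENNReal.ofReal_mul (by positivity), hV, Measure.real,
      ENNReal.ofReal_toReal measure_closedBall_lt_top.ne]
  have hprod : ∏ j, (∏ k, (2 * r ⟨j, k⟩)) ^ p j = B * ε ^ ∑ s ∈ S, p s.1 := by
    have h1 : ∀ j, (∏ k, (2 * r ⟨j, k⟩)) ^ p j = ∏ k, (2 * r ⟨j, k⟩) ^ p j := fun j =>
      (Real.finsetProd_rpow _ _ (fun k _ => mul_nonneg zero_le_two (hr0 _)) _).symm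
    simp_rw [h1]
    rw [← Fintype.prod_sigma (fun s : Σ j, Fin (finrank ℝ (F j)) => (2 * r s) ^ p s.1),
      Real.rpow_sum_of_pos hε, ← Fintype.prod_ite_mem S, ← Finset.prod_mul_distrib]
    refine Finset.prod_congr rfl fun s _ => ?_
    rw [hr, ← mul_assoc, Real.mul_rpow (by positivity) (by split_ifs <;> positivity)]
    split_ifs <;> simp
  have h4 := hlow.trans key
  rw [hvolD, hprod, ← ENNReal.ofReal_coe_nnreal, ← ENNReal.ofReal_mul C.coe_nonneg,
    ENNReal.ofReal_le_ofReal_iff (by positivity)] at h4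
  rw [Real.rpow_natCast, div_mul_eq_mul_div, le_div_iff₀ hV0, mul_assoc]
  exact h4

/-- The squeezed ball has volume of order ε^(dim W), and the boxes give ε^(∑ p). As ε → 0, ∑ p > dim
W is impossible. -/
theorem rankCondition_of_localBrascampLiebConst_lt_top {L : ∀ j, E →L[ℝ] F j} {p : Fin m → ℝ}
    (h : localBrascampLiebConst L p < ∞) : RankCondition L p := by
  obtain ⟨C, hC, hlt⟩ := sInf_lt_iff.1 h
  lift C to ℝ≥0 using hlt.ne
  intro e he S
  obtain ⟨A, hA⟩ := rpow_le_of_localBrascampLiebInequality hC he S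
  by_contra! hlt
  set d : ℝ := ∑ s ∈ S, p s.1 - finrank ℝ (Submodule.span ℝ (pullbackVec L e '' S)) with hd
  have hd0 : 0 < d := sub_pos.2 hlt
  have h1 : Tendsto (fun ε : ℝ => A * ε ^ d) (𝓝[>] 0) (𝓝 0) := by
    have : Tendsto (fun ε : ℝ => A * ε ^ d) (𝓝 0) (𝓝 (A * 0 ^ d)) :=
      ((Real.continuous_rpow_const hd0.le).tendsto 0).const_mul A
    rw [Real.zero_rpow hd0.ne', mul_zero] at this
    exact this.mono_left nhdsWithin_le_nhds
  have h2 : ∀ᶠ ε : ℝ in 𝓝[>] 0, 1 ≤ A * ε ^ d := by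
    filter_upwards [Ioc_mem_nhdsGT (zero_lt_one' ℝ)] with ε hε
    have h3 := hA ε hε.1 hε.2
    rw [hd, Real.rpow_sub hε.1, ← mul_div_assoc, le_div_iff₀ (Real.rpow_pos_of_pos hε.1 _), one_mul]
    exact h3
  exact absurd (ge_of_tendsto h1 h2) (by norm_num)

end BrascampLieb

namespace BrascampLieb
open Filter Topology Module

/-! ### From smooth inputs to integrable inputs -/

section Approximation

variable {F : Type*} [NormedAddCommGroup F] [InnerProductSpace ℝ F] [FiniteDimensional ℝ F]
  [MeasurableSpace F] [BorelSpace F]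

lemma integral_sq_eq_toReal_eLpNorm_sq {h : F → ℝ} (hh : MemLp h 2 volume) :
    ∫ y, h y ^ 2 = (eLpNorm h 2 volume).toReal ^ 2 := by
  rw [hh.eLpNorm_eq_integral_rpow_norm two_ne_zero ENNReal.ofNat_ne_top]
  have h0 : 0 ≤ ∫ y, h y ^ 2 := integral_nonneg fun y => sq_nonneg _
  have h1 : ∫ y, ‖h y‖ ^ (2 : ℝ≥0∞).toReal = ∫ y, h y ^ 2 :=
    integral_congr_ae (Eventually.of_forall fun y => by simp)
  rw [h1, ENNReal.toReal_ofReal (Real.rpow_nonneg h0 _), ← Real.rpow_natCast, ← Real.rpow_mul h0]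
  simp

/-- Nonnegative integrable functions are limits, almost everywhere and in integral, of nonnegative
smooth compactly supported functions. -/
theorem exists_contDiff_tendsto {f : F → ℝ} (h0 : ∀ y, 0 ≤ f y) (hf : Integrable f volume) :
    ∃ g : ℕ → F → ℝ, (∀ k, ContDiff ℝ 2 (g k)) ∧ (∀ k, HasCompactSupport (g k)) ∧
      (∀ k y, 0 ≤ g k y) ∧ (∀ᵐ y, Tendsto (fun k => g k y) atTop (𝓝 (f y))) ∧
      Tendsto (fun k => ∫ y, g k y) atTop (𝓝 (∫ y, f y)) := by
  -- Approximating √f in L² and squaring keeps nonnegativity and smoothness. Convergence of L² norms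
  -- is convergence of the integrals, and a subsequence converges almost everywhere.
  have hsq : ∀ y, √(f y) ^ 2 = f y := fun y => Real.sq_sqrt (h0 y)
  have hm : AEStronglyMeasurable (fun y => √(f y)) volume :=
    Real.continuous_sqrt.comp_aestronglyMeasurable hf.aestronglyMeasurable
  have hL2 : MemLp (fun y => √(f y)) 2 volume := by
    rw [memLp_two_iff_integrable_sq hm]
    simpa only [hsq] using hf
  have happ : ∀ k : ℕ, ∃ g : F → ℝ, HasCompactSupport g ∧ ContDiff ℝ (⊤ : ℕ∞) g ∧
      eLpNorm ((fun y => √(f y)) - g) 2 volume ≤ ENNReal.ofReal (1 / ((k : ℝ) + 1)) := fun k =>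
    hL2.exist_eLpNorm_sub_le ENNReal.ofNat_ne_top one_le_two (by positivity)
  choose g hgc hgs hg using happ
  have hgL2 : ∀ k, MemLp (g k) 2 volume := fun k =>
    (hgs k).continuous.memLp_of_hasCompactSupport (hgc k)
  have hlim : Tendsto (fun k => eLpNorm (g k - fun y => √(f y)) 2 volume) atTop (𝓝 0) := by
    refine tendsto_of_tendsto_of_tendsto_of_le_of_le tendsto_const_nhds
      (h := fun k : ℕ => ENNReal.ofReal (1 / ((k : ℝ) + 1))) ?_ (fun k => zero_le) fun k => ?_
    · rw [← ENNReal.ofReal_zero]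
      exact ENNReal.tendsto_ofReal tendsto_one_div_add_atTop_nhds_zero_nat
    · rw [eLpNorm_sub_comm]; exact hg k
  have hnorm : Tendsto (fun k => (eLpNorm (g k) 2 volume).toReal) atTop
      (𝓝 (eLpNorm (fun y => √(f y)) 2 volume).toReal) := by
    have h1 : Tendsto (fun k => (hgL2 k).toLp (g k)) atTop (𝓝 (hL2.toLp _)) :=
      (Lp.tendsto_Lp_iff_tendsto_eLpNorm'' _ hgL2 _ hL2).2 hlim
    simpa only [Lp.norm_toLp] using h1.norm
  obtain ⟨ns, hns, hae⟩ := (tendstoInMeasure_of_tendsto_eLpNorm two_ne_zero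
    (fun k => (hgL2 k).aestronglyMeasurable) hL2.aestronglyMeasurable hlim).exists_seq_tendsto_ae
  refine ⟨fun k y => g (ns k) y ^ 2, fun k => ?_, fun k => ?_, fun k y => sq_nonneg _, ?_, ?_⟩
  · exact ((hgs _).of_le (WithTop.coe_le_coe.2 (le_top : (2 : ℕ∞) ≤ ⊤))).pow 2
  · exact (hgc _).comp_left (g := fun t : ℝ => t ^ 2) (by simp)
  · filter_upwards [hae] with y hy
    simpa only [hsq] using hy.pow 2
  · have h2 := (hnorm.comp hns.tendsto_atTop).pow 2
    rw [← integral_sq_eq_toReal_eLpNorm_sq hL2] at h2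
    simp only [hsq] at h2
    refine h2.congr fun k => ?_
    exact (integral_sq_eq_toReal_eLpNorm_sq (hgL2 _)).symm

end Approximation

/-- The power is discontinuous at (0, 0). Exponents (1 - η)p vanish identically when p = 0, and this
agrees with 0⁰ = 1. -/
lemma tendsto_rpow_of_nonneg {x q : ℕ → ℝ} {x₀ q₀ : ℝ} (hx : Tendsto x atTop (𝓝 x₀))
    (hq : Tendsto q atTop (𝓝 q₀)) (hq₀ : 0 ≤ q₀) (hqz : q₀ = 0 → ∀ k, q k = 0) :
    Tendsto (fun k => x k ^ q k) atTop (𝓝 (x₀ ^ q₀)) := by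
  rcases hq₀.eq_or_lt with h | h
  · have := hqz h.symm
    simp only [this, ← h, Real.rpow_zero]
    exact tendsto_const_nhds
  · exact hx.rpow hq (Or.inr h)

variable {E : Type*} [NormedAddCommGroup E] [InnerProductSpace ℝ E] [FiniteDimensional ℝ E]
  [MeasurableSpace E] [BorelSpace E]
  {m : ℕ} {F : Fin m → Type*}
  [∀ j, NormedAddCommGroup (F j)] [∀ j, InnerProductSpace ℝ (F j)]
  [∀ j, FiniteDimensional ℝ (F j)] [∀ j, MeasurableSpace (F j)] [∀ j, BorelSpace (F j)]

/-- The inputs are approximated while η = 1/(k+1) tends to 0, and Fatou's lemma passes to the limit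
because `M` does not depend on η. -/
theorem localBrascampLiebInequality_of_contDiff {L : ∀ j, E →L[ℝ] F j} {p : Fin m → ℝ} {M : ℝ≥0}
    (hp : ∀ j, 0 ≤ p j) (hL : ∀ j, Function.Surjective (L j))
    (h : ∀ η : ℝ, 0 < η → η ≤ 1 → ∀ f : ∀ j, F j → ℝ, (∀ j, ContDiff ℝ 2 (f j)) →
      (∀ j, HasCompactSupport (f j)) → (∀ j y, 0 ≤ f j y) →
      ∫⁻ x in Metric.closedBall (0 : E) 1, ENNReal.ofReal (∏ j, f j (L j x) ^ ((1 - η) * p j))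
        ≤ M * ENNReal.ofReal (∏ j, (∫ y, f j y) ^ ((1 - η) * p j))) :
    LocalBrascampLiebInequality L p M := by
  intro f h0 hf
  choose g hgs hgc hg0 hgae hgint using fun j => exists_contDiff_tendsto (h0 j) (hf j)
  set η : ℕ → ℝ := fun k => 1 / ((k : ℝ) + 1) with hη
  have hη0 : ∀ k, 0 < η k := fun k => by simp only [hη]; positivity
  have hη1 : ∀ k, η k ≤ 1 := fun k => by
    simp only [hη]; rw [div_le_one (by positivity)]; linarith [(Nat.cast_nonneg k : (0 : ℝ) ≤ k)]
  have hq : ∀ j, Tendsto (fun k => (1 - η k) * p j) atTop (𝓝 (p j)) := fun j => by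
    have := (tendsto_one_div_add_atTop_nhds_zero_nat (𝕜 := ℝ)).const_sub 1 |>.mul_const (p j)
    simpa [hη] using this
  have hqz : ∀ j, p j = 0 → ∀ k, (1 - η k) * p j = 0 := fun j hj k => by simp [hj]
  -- Preimages of null sets under a surjective linear map are null.
  have hae : ∀ᵐ x : E, ∀ j, Tendsto (fun k => g j k (L j x)) atTop (𝓝 (f j (L j x))) := by
    refine ae_all_iff.2 fun j => ?_
    obtain ⟨s, hs, hsm, hsub⟩ := (hgae j).exists_measurable_mem
    exact ((ae_comp_linearMap_mem_iff (L j : E →ₗ[ℝ] F j) volume volume (hL j) hsm).2 hs).mono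
      fun x hx => hsub _ hx
  calc ∫⁻ x in Metric.closedBall (0 : E) 1, ENNReal.ofReal (∏ j, f j (L j x) ^ p j)
      = ∫⁻ x in Metric.closedBall (0 : E) 1,
          liminf (fun k => ENNReal.ofReal (∏ j, g j k (L j x) ^ ((1 - η k) * p j))) atTop := by
        refine lintegral_congr_ae (ae_restrict_of_ae ?_)
        filter_upwards [hae] with x hx
        exact (ENNReal.tendsto_ofReal (tendsto_finsetProd _ fun j _ =>
          tendsto_rpow_of_nonneg (hx j) (hq j) (hp j) (hqz j))).liminf_eq.symm
    _ ≤ liminf (fun k => ∫⁻ x in Metric.closedBall (0 : E) 1,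
          ENNReal.ofReal (∏ j, g j k (L j x) ^ ((1 - η k) * p j))) atTop := by
        refine lintegral_liminf_le fun k => ENNReal.measurable_ofReal.comp ?_
        refine (continuous_finsetProd _ fun j _ => ?_).measurable
        exact ((hgs j k).continuous.comp (L j).continuous).rpow_const fun x =>
          Or.inr (mul_nonneg (by linarith [hη1 k]) (hp j))
    _ ≤ liminf (fun k => M * ENNReal.ofReal (∏ j, (∫ y, g j k y) ^ ((1 - η k) * p j))) atTop :=
        liminf_le_liminf (Eventually.of_forall fun k =>
          h (η k) (hη0 k) (hη1 k) _ (fun j => hgs j k) (fun j => hgc j k) fun j => hg0 j k)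
    _ = M * ENNReal.ofReal (∏ j, (∫ y, f j y) ^ p j) := by
        refine (ENNReal.Tendsto.const_mul (ENNReal.tendsto_ofReal (tendsto_finsetProd _ fun j _ =>
          tendsto_rpow_of_nonneg (hgint j) (hq j) (hp j) (hqz j))) ?_).liminf_eq
        exact Or.inr ENNReal.coe_ne_top

end BrascampLieb

namespace BrascampLieb
open Filter Topology Module

/-! ### Local boundedness -/

section

variable {E : Type*} [NormedAddCommGroup E] [InnerProductSpace ℝ E] [FiniteDimensional ℝ E]

/-- Surjectivity of L means det(L L*) ≠ 0, an open condition. -/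
lemma eventually_surjective {m : Type*} [Fintype m] {F : m → Type*}
    [∀ j, NormedAddCommGroup (F j)] [∀ j, InnerProductSpace ℝ (F j)]
    [∀ j, FiniteDimensional ℝ (F j)] {L₀ : ∀ j, E →L[ℝ] F j}
    (hL₀ : ∀ j, Function.Surjective (L₀ j)) :
    ∀ᶠ L in 𝓝 L₀, ∀ j, Function.Surjective (L j) := by
  refine eventually_all.2 fun j => ?_
  have hc : Continuous fun L : ∀ j, E →L[ℝ] F j => (covOp (L j)).det := by
    have h1 : Continuous fun L : ∀ j, E →L[ℝ] F j => ContinuousLinearMap.adjoint (L j) :=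
      (LinearIsometryEquiv.continuous _).comp (continuous_apply j)
    exact ContinuousLinearMap.continuous_det.comp ((continuous_apply j).clm_comp h1)
  filter_upwards [hc.continuousAt.eventually_ne ((det_covOp_ne_zero_iff _).2 (hL₀ j))] with L hL
  exact (det_covOp_ne_zero_iff _).1 hL

variable [MeasurableSpace E] [BorelSpace E]
  {m : ℕ} {F : Fin m → Type*}
  [∀ j, NormedAddCommGroup (F j)] [∀ j, InnerProductSpace ℝ (F j)]
  [∀ j, FiniteDimensional ℝ (F j)] [∀ j, MeasurableSpace (F j)] [∀ j, BorelSpace (F j)]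

theorem localBrascampLiebInequality_of_gaussian_bound {L : ∀ j, E →L[ℝ] F j} {p : Fin m → ℝ}
    (hp : ∀ j, 0 ≤ p j) (hL : ∀ j, Function.Surjective (L j)) {C : ℝ} (hC : 1 ≤ C)
    (hbound : ∀ S : E →L[ℝ] E, (∀ j, (covOp (L j ∘L S)).det ≠ 0) →
      S.det ^ 2 ≤ C * (∏ j, (covOp (L j ∘L S)).det ^ p j) * Real.exp (hsSq S / 2)) :
    LocalBrascampLiebInequality L p (Real.toNNReal (Real.exp (1 / 2) * gaussNorm E *
      (C * 2 ^ finrank ℝ E * Real.exp (finrank ℝ E)))) := by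
  refine localBrascampLiebInequality_of_contDiff hp hL fun η hη hη1 f hf hc h0 => ?_
  obtain ⟨S, R, hR, hcrit, hle⟩ := exists_critical_gaussian hp hL hC hbound hη hη1
  have hq : ∀ j, 0 ≤ (1 - η) * p j := fun j => mul_nonneg (by linarith) (hp j)
  refine (lintegral_closedBall_prod_le hq L S R hR hcrit hf hc h0).trans ?_
  have hM : 0 ≤ Real.exp (1 / 2) * gaussNorm E := by
    have := gaussNorm_pos (E := E); positivity
  have hI : ∀ j, 0 ≤ ∫ y, f j y := fun j => integral_nonneg (h0 j)
  change _ ≤ ENNReal.ofReal _ * _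
  rw [← ENNReal.ofReal_mul (by positivity)]
  refine ENNReal.ofReal_le_ofReal ?_
  simp_rw [Real.mul_rpow (inv_nonneg.2 (abs_nonneg _)) (hI _)]
  rw [Finset.prod_mul_distrib]
  calc _ = Real.exp (1 / 2) * gaussNorm E * (|LinearMap.det (S : E →ₗ[ℝ] E)| *
        ∏ j, (|LinearMap.det (R j : F j →ₗ[ℝ] F j)|⁻¹) ^ ((1 - η) * p j)) *
        ∏ j, (∫ y, f j y) ^ ((1 - η) * p j) := by ring
    _ ≤ _ := mul_le_mul_of_nonneg_right (mul_le_mul_of_nonneg_left hle hM)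
        (Finset.prod_nonneg fun j _ => Real.rpow_nonneg (hI j) _)

end

end BrascampLieb

theorem theorem2p1 {m : ℕ} {H : Type*} {H' : Fin m → Type*}
    [NormedAddCommGroup H] [InnerProductSpace ℝ H] [FiniteDimensional ℝ H]
    [MeasurableSpace H] [BorelSpace H]
    [∀ j, NormedAddCommGroup (H' j)] [∀ j, InnerProductSpace ℝ (H' j)]
    [∀ j, FiniteDimensional ℝ (H' j)]
    [∀ j, MeasurableSpace (H' j)] [∀ j, BorelSpace (H' j)]
    (L₀ : ∀ j, H →L[ℝ] H' j) (p : Fin m → ℝ)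
    (hdatum : IsBrascampLiebDatum L₀ p)
    (hfin : localBrascampLiebConst L₀ p < ∞) :
    ∃ δ : ℝ, 0 < δ ∧ ∃ C : ℝ≥0, ∀ L : ∀ j, H →L[ℝ] H' j,
      ‖L - L₀‖ < δ → localBrascampLiebConst L p ≤ (C : ℝ≥0∞) := by
  have hrank := BrascampLieb.rankCondition_of_localBrascampLiebConst_lt_top hfin
  obtain ⟨C, -, hC⟩ := hrank.exists_uniform_gaussian_bound hdatum.exponent_nonneg
  obtain ⟨δ, hδ, h⟩ := Metric.eventually_nhds_iff.1
    (hC.and (BrascampLieb.eventually_surjective hdatum.surjective))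
  -- The constant is raised to `max C 1` because the interpolation in η uses C^(1-η) ≤ C.
  refine ⟨δ, hδ, Real.toNNReal (Real.exp (1 / 2) * BrascampLieb.gaussNorm H *
    (max C 1 * 2 ^ Module.finrank ℝ H * Real.exp (Module.finrank ℝ H))), fun L hL => sInf_le ?_⟩
  obtain ⟨hbound, hsurj⟩ := h (by rwa [dist_eq_norm] : dist L L₀ < δ)
  refine BrascampLieb.localBrascampLiebInequality_of_gaussian_bound hdatum.exponent_nonneg hsurj
    (le_max_right C 1) fun S hS => (hbound S hS).trans ?_
  refine mul_le_mul_of_nonneg_right (mul_le_mul_of_nonneg_right (le_max_left C 1) ?_)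
    (Real.exp_pos _).le
  exact Finset.prod_nonneg fun j _ => Real.rpow_nonneg
    (BrascampLieb.det_nonneg_of_isPositive (BrascampLieb.isPositive_covOp _)) _
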